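/- **Octonionic matrices.** Let $(\omega_A)_{A\subseteq\{1,2,3\}}$ be the basis of the octonion algebra with $\omega_\emptyset=1$ and $\omega_A\omega_B=(A|B)\,\omega_{A\triangle B}$, where the sign $(A|B)\in\{\pm1\}$ is the entry in row $A$ and column $B$ of the following table, rows and columns being ordered as $\emptyset,\{1\},\{2\},\{3\},\{1,2\},\{1,3\},\{2,3\},\{1,2,3\}$: $$\begin{pmatrix}1&1&1&1&1&1&1&1\\1&-1&1&1&-1&-1&1&-1\\1&-1&-1&1&1&-1&-1&1\\1&-1&-1&-1&1&1&1&-1\\1&1&-1&-1&-1&-1&1&1\\1&1&1&-1&1&-1&-1&-1\\1&-1&1&-1&-1&1&-1&1\\1&1&-1&1&-1&1&-1&-1\end{pmatrix}.$$ For real $n\times n$ matrices $(M^A)_{A\subseteq\{1,2,3\}}$, identify $M=\sum_A M^A\omega_A$ with its real form, the real $8n\times 8n$ block matrix with blocks $M^{A,B}=(A\triangle B|B)\,M^{A\triangle B}$, and let $P(X)=\det(M-X\,\mathrm{Id})$. **Operators.** In each model below, the free entries of $M$ are independent real coordinates, $\mathrm L=\sum_{a,b}\Gamma(x_a,x_b)\,\partial_a\partial_b$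 is the diffusion operator with the indicated constant coefficients and no drift (the entries are Brownian motions), and $\Gamma(F,G)=\frac12(\mathrm L(FG)-F\,\mathrm LG-G\,\mathrm LF)$. *Model 1* ($n=2$). $M^\emptyset$ is a symmetric and each $M^A$, $A\ne\emptyset$, an antisymmetric $2\times2$ matrix, with $\Gamma(M^A_{ij},M^B_{kl})=\frac12\delta_{A,B}\big(\delta_{ik}\delta_{jl}+(A|A)\delta_{il}\delta_{jk}\big)$ and $\mathrm L(M^A_{ij})=0$. *Model 2* (any $n$). $M=M^\emptyset\omega_\emptyset+\mathcal A\sum_{C\neq\emptyset}\omega_C$ with $M^\emptyset$ symmetric and $\mathcal A$ antisymmetric, $\Gamma(M^\emptyset_{ij},M^\emptyset_{kl})=\frac12(\delta_{ik}\delta_{jl}+\delta_{il}\delta_{jk})$, $\Gamma(\mathcal A_{ij},\mathcal A_{kl})=\frac1{14}(\delta_{ik}\delta_{jl}-\delta_{il}\delta_{jk})$, $\Gamma(M^\emptyset_{ij},\mathcal A_{kl})=0$ and $\mathrm L(M^\emptyset_{ij})=\mathrm L(\mathcal A_{ij})=0$. **Statement.** Put $(\alpha_1,\alpha_2,\beta)=(-11,\tfrac{21}2,8)$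 for Model 1 and $(\alpha_1,\alpha_2,\beta)=(-8,\tfrac{63}8,2)$ for Model 2, and $\alpha_3=8$ for both. In each of the two models the following holds. 1. At every matrix $M$ of the model and every real $X$ with $P(X)\neq0$, $$\mathrm L(P(X))=\alpha_1P''(X)+\alpha_2\frac{P'(X)^2}{P(X)},$$ and for all real $X\ne Y$ with $P(X)P(Y)\ne0$, $$\Gamma(\log P(X),\log P(Y))=\frac{\alpha_3}{Y-X}\Big(\frac{P'(X)}{P(X)}-\frac{P'(Y)}{P(Y)}\Big).$$ 2. The equation $a^2(\alpha_1+\alpha_2)-a(\alpha_1+\alpha_3)+\alpha_3=0$ has the unique positive solution $a=8$, and the multiplicity of the eigenvalues of $M$ is $8$: for every $M$ there are real numbers $x_1\le\dots\le x_n$ with $P(X)=\prod_{i=1}^n(X-x_i)^8$, and for Lebesgue-almost every $M$ there are exactly $n$ distinct eigenvalues, each with an eigenspace of dimension $8$. 3. Let $W=\{x\in\mathbb R^n: x_1<\dots<x_n\}$ be the Weyl chamber, and for $M$ with $n$ distinct eigenvalues let $x(M)\in W$ list them increasingly. There is a unique linear operator $\mathcal L$ on $C_c^\infty(W)$ such that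 $\mathrm L(f\circ x)=(\mathcal Lf)\circ x$, on the set of all $M$ with $n$ distinct eigenvalues, for every $f\in C_c^\infty(W)$. Extend $\mathcal L$ to $C^\infty_c(W)\oplus\mathbb R1$ by $\mathcal L1=0$. A measure $\mu$ on $W$ that is finite on compact subsets of $W$ is reversible for $\mathcal L$, i.e. $\int f\,\mathcal Lg\,d\mu=\int g\,\mathcal Lf\,d\mu$ for all $f,g\in C^\infty_c(W)\oplus\mathbb R1$, if and only if, for some constant $C\ge0$, $$d\mu=C\prod_{i<j}|x_i-x_j|^{\beta}\,dx .$$ Thus the reversible density is $C\prod_{i<j}(x_i-x_j)^8$ in Model 1 and $C\prod_{i<j}|x_i-x_j|^2$ in Model 2. -/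

import Mathlib

open MeasureTheory
open scoped NNReal ENNReal

noncomputable section

/-! ### Octonionic matrices in real form -/

/-- Position of a subset of `{1, 2, 3}` (coded as `{0, 1, 2}`) in the ordering
`∅, {1}, {2}, {3}, {1,2}, {1,3}, {2,3}, {1,2,3}`. -/
def octPos (A : Finset (Fin 3)) : Fin 8 :=
  if A = ∅ then 0
  else if A = {0} then 1
  else if A = {1} then 2
  else if A = {2} then 3
  else if A = {0, 1} then 4
  else if A = {0, 2} then 5
  else if A = {1, 2} then 6
  else 7

/-- The sign table of the octonion product. -/
def octTable : Matrix (Fin 8) (Fin 8) ℤ :=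
  !![1,  1,  1,  1,  1,  1,  1,  1;
     1, -1,  1,  1, -1, -1,  1, -1;
     1, -1, -1,  1,  1, -1, -1,  1;
     1, -1, -1, -1,  1,  1,  1, -1;
     1,  1, -1, -1, -1, -1,  1,  1;
     1,  1,  1, -1,  1, -1, -1, -1;
     1, -1,  1, -1, -1,  1, -1,  1;
     1,  1, -1,  1, -1,  1, -1, -1]

/-- The sign `(A|B)`: the basis `ω_A` of the octonions, indexed by the subsets `A` of a three
element set, is multiplied by `ω_A ω_B = (A|B) ω_{A ∆ B}`. -/
def octSign (A B : Finset (Fin 3)) : ℝ := (octTable (octPos A) (octPos B) : ℝ)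

/-- The real form of the octonionic matrix `∑_A M^A ω_A`: the `8n × 8n` real block matrix with
blocks `M^{A,B} = (A ∆ B | B) M^{A ∆ B}`, that is, the matrix of left multiplication by
`∑_A M^A ω_A` on vectors of octonions. -/
def octReal {n : ℕ} (M : Finset (Fin 3) → Matrix (Fin n) (Fin n) ℝ) :
    Matrix (Finset (Fin 3) × Fin n) (Finset (Fin 3) × Fin n) ℝ :=
  Matrix.of fun p q => octSign (symmDiff p.1 q.1) q.1 * M (symmDiff p.1 q.1) p.2 q.2

/-! ### Symmetric and antisymmetric matrices in independent coordinates -/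

/-- Positions of the free entries of a symmetric `n × n` matrix. -/
abbrev SymIdx (n : ℕ) : Type := {p : Fin n × Fin n // p.1 ≤ p.2}

/-- Positions of the free entries of an antisymmetric `n × n` matrix. -/
abbrev AntiIdx (n : ℕ) : Type := {p : Fin n × Fin n // p.1 < p.2}

/-- The symmetric matrix with given entries on and above the diagonal. -/
def symMat {n : ℕ} (s : SymIdx n → ℝ) : Matrix (Fin n) (Fin n) ℝ :=
  Matrix.of fun i j =>
    if h : i ≤ j then s ⟨(i, j), h⟩ else s ⟨(j, i), (not_le.mp h).le⟩

/-- The antisymmetric matrix with given entries above the diagonal. -/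
def antiMat {n : ℕ} (a : AntiIdx n → ℝ) : Matrix (Fin n) (Fin n) ℝ :=
  Matrix.of fun i j =>
    if h : i < j then a ⟨(i, j), h⟩ else if h' : j < i then -a ⟨(j, i), h'⟩ else 0

/-- `(δ_ik δ_jl + ε δ_il δ_jk)` for `p = (i, j)` and `q = (k, l)`. -/
def pairing {n : ℕ} (ε : ℝ) (p q : Fin n × Fin n) : ℝ :=
  (if p.1 = q.1 ∧ p.2 = q.2 then 1 else 0) + ε * (if p.1 = q.2 ∧ p.2 = q.1 then 1 else 0)

/-! ### Diffusion operators -/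

/-- The diffusion operator `L F = ∑_{a,b} g^{ab} ∂_a ∂_b F` on functions on `ℝ^ι`, that is,
the one with `Γ(x_a, x_b) = g^{ab}` (constant) and `L(x_a) = 0` for the coordinates. -/
def diffOp {ι : Type} [Fintype ι] [DecidableEq ι] (g : ι → ι → ℝ)
    (F : (ι → ℝ) → ℝ) (m : ι → ℝ) : ℝ :=
  ∑ a, ∑ b, g a b *
    fderiv ℝ (fun m' => fderiv ℝ F m' (Pi.single b 1)) m (Pi.single a 1)

/-- The carré du champ `Γ(F, G) = (L(FG) - F L(G) - G L(F)) / 2`. -/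
def carre {ι : Type} [Fintype ι] [DecidableEq ι] (g : ι → ι → ℝ)
    (F G : (ι → ℝ) → ℝ) (m : ι → ℝ) : ℝ :=
  (diffOp g (fun m' => F m' * G m') m - F m * diffOp g G m - G m * diffOp g F m) / 2

/-! ### The two models -/

/-- Coordinates of the first model: a symmetric `2 × 2` matrix `M^∅` and, for each `A ≠ ∅`, an
antisymmetric `2 × 2` matrix `M^A`. -/
abbrev Idx1 : Type := SymIdx 2 ⊕ ({A : Finset (Fin 3) // A ≠ ∅} × AntiIdx 2)

/-- The entry `M^A_{ij}`, as `(A, (i, j))`, for which a coordinate of the first model stands. -/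
def entry1 : Idx1 → Finset (Fin 3) × (Fin 2 × Fin 2)
  | Sum.inl p => (∅, p.1)
  | Sum.inr q => (q.1.1, q.2.1)

/-- `Γ(M^A_{ij}, M^B_{kl}) = ½ δ_{AB} (δ_ik δ_jl + (A|A) δ_il δ_jk)`. -/
def cov1 (a b : Idx1) : ℝ :=
  if (entry1 a).1 = (entry1 b).1 then
    1 / 2 * pairing (octSign (entry1 a).1 (entry1 a).1) (entry1 a).2 (entry1 b).2
  else 0

/-- The matrix of the first model, in real form. -/
def model1 (m : Idx1 → ℝ) : Matrix (Finset (Fin 3) × Fin 2) (Finset (Fin 3) × Fin 2) ℝ :=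
  octReal fun A =>
    if h : A = ∅ then symMat fun p => m (Sum.inl p) else antiMat fun p => m (Sum.inr (⟨A, h⟩, p))

/-- Coordinates of the second model: a symmetric `n × n` matrix `M^∅` and a single antisymmetric
`n × n` matrix `𝒜`. -/
abbrev Idx2 (n : ℕ) : Type := SymIdx n ⊕ AntiIdx n

/-- `Γ(M^∅_{ij}, M^∅_{kl}) = ½ (δ_ik δ_jl + δ_il δ_jk)`,
`Γ(𝒜_{ij}, 𝒜_{kl}) = 1/14 (δ_ik δ_jl - δ_il δ_jk)`, `Γ(M^∅_{ij}, 𝒜_{kl}) = 0`. -/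
def cov2 (n : ℕ) : Idx2 n → Idx2 n → ℝ
  | Sum.inl p, Sum.inl q => 1 / 2 * pairing 1 p.1 q.1
  | Sum.inr p, Sum.inr q => 1 / 14 * pairing (-1) p.1 q.1
  | Sum.inl _, Sum.inr _ => 0
  | Sum.inr _, Sum.inl _ => 0

/-- The matrix `M^∅ ω_∅ + 𝒜 ∑_{C ≠ ∅} ω_C` of the second model, in real form. -/
def model2 (n : ℕ) (m : Idx2 n → ℝ) :
    Matrix (Finset (Fin 3) × Fin n) (Finset (Fin 3) × Fin n) ℝ :=
  octReal fun A =>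
    if A = ∅ then symMat fun p => m (Sum.inl p) else antiMat fun p => m (Sum.inr p)

/-! ### Characteristic polynomial and spectrum -/

/-- `P(X) = det (M - X Id)`. -/
def charP {κ : Type} [Fintype κ] [DecidableEq κ] (M : Matrix κ κ ℝ) (X : ℝ) : ℝ :=
  (M - X • (1 : Matrix κ κ ℝ)).det

/-- The Weyl chamber `{x_1 < ... < x_n}`. -/
def weyl (n : ℕ) : TopologicalSpace.Opens (Fin n → ℝ) where
  carrier := {x | StrictMono x}
  is_open' := by
    have h : {x : Fin n → ℝ | StrictMono x} =
        ⋂ i : Fin n, ⋂ j : Fin n, ⋂ _ : i < j, {x : Fin n → ℝ | x i < x j} := by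
      ext x
      simp only [Set.mem_ofPred_eq, Set.mem_iInter]
      exact ⟨fun hx i j hij => hx hij, fun hx i j hij => hx i j hij⟩
    rw [h]
    exact isOpen_iInter_of_finite fun i => isOpen_iInter_of_finite fun j =>
      isOpen_iInter_of_finite fun _ => isOpen_lt (continuous_apply i) (continuous_apply j)

/-- `M` has exactly `n` distinct (real) eigenvalues, listed increasingly by `x`. -/
def ListsSpectrum {κ : Type} [Fintype κ] [DecidableEq κ] {n : ℕ} (M : Matrix κ κ ℝ)
    (x : Fin n → ℝ) : Prop :=
  x ∈ weyl n ∧ Set.range x = spectrum ℝ M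

/-- Smooth functions with compact support contained in the Weyl chamber. -/
abbrev WeylTest (n : ℕ) : Type := TestFunction (weyl n) ℝ ⊤

/-- `ℒ` is the operator that `L = diffOp g` induces on functions of the ordered distinct
eigenvalues `x` of the matrix `M`: `L (f ∘ x) = (ℒ f) ∘ x` where `M` has `n` distinct
eigenvalues. Here `F` is `f ∘ x` on that set and arbitrary elsewhere. -/
def IsSpectralOperator {ι κ : Type} [Fintype ι] [DecidableEq ι] [Fintype κ] [DecidableEq κ]
    {n : ℕ} (g : ι → ι → ℝ) (M : (ι → ℝ) → Matrix κ κ ℝ)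
    (ℒ : WeylTest n →ₗ[ℝ] WeylTest n) : Prop :=
  ∀ (f : WeylTest n) (F : (ι → ℝ) → ℝ),
    (∀ m x, ListsSpectrum (M m) x → F m = f x) →
      ∀ m x, ListsSpectrum (M m) x → diffOp g F m = ℒ f x

/-- `μ` is reversible for `ℒ` on the Weyl chamber: `∫ φ ℒ(ψ) dμ = ∫ ψ ℒ(φ) dμ` for all
`φ = f + c`, `ψ = h + d`, with `f`, `h` smooth and compactly supported in the chamber and
`c`, `d` constants, where `ℒ` is extended by `ℒ(1) = 0`. -/
def IsReversible {n : ℕ} (ℒ : WeylTest n →ₗ[ℝ] WeylTest n) (μ : Measure (Fin n → ℝ)) : Prop :=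
  ∀ (f h : WeylTest n) (c d : ℝ),
    ∫ x in (weyl n : Set (Fin n → ℝ)), (f x + c) * ℒ h x ∂μ =
      ∫ x in (weyl n : Set (Fin n → ℝ)), (h x + d) * ℒ f x ∂μ

/-- `μ` is finite on the compact subsets of the Weyl chamber. -/
def IsRadonOnWeyl {n : ℕ} (μ : Measure (Fin n → ℝ)) : Prop :=
  ∀ K : Set (Fin n → ℝ), IsCompact K → K ⊆ (weyl n : Set (Fin n → ℝ)) → μ K < ⊤

/-- On the Weyl chamber, `μ` has density `ρ` with respect to Lebesgue measure. -/
def HasWeylDensity {n : ℕ} (μ : Measure (Fin n → ℝ)) (ρ : (Fin n → ℝ) → ℝ) : Prop :=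
  μ.restrict (weyl n : Set (Fin n → ℝ)) =
    (volume.restrict (weyl n : Set (Fin n → ℝ))).withDensity fun x => ENNReal.ofReal (ρ x)

end

noncomputable section

/-! ### Calculus of constant coefficient diffusion operators -/

section Calculus

variable {E : Type*} [NormedAddCommGroup E] [NormedSpace ℝ E]

/-! Left multiplication by an imaginary octonion `z` is a real antisymmetric `8 × 8` matrix `T` with
`T² = -|z|²`. In both models the matrix is `1 ⊗ S + T ⊗ A` with `S` symmetric and a single
antisymmetric `A`. Diagonalising the Hermitian matrix `iT`, whose eigenvalues are `±|z|`, splits `M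
- X` into eight complex blocks `S - X ± i|z|A`. These are transposes of each other, so `P = Q ^ 8`,
where `Q` is the characteristic polynomial of the Hermitian matrix `S + i|z|A` (`charP_octReal`).
The multiplicity 8 comes from here.

Everything else follows from two identities for `Q`, collected in `SpectralModel`: `L Q(X) = -(β/2)
Q''(X)` and `(Y - X) Γ(Q(X), Q(Y)) = Q'(X) Q(Y) - Q'(Y) Q(X)`. In the second model `|z|² = 7` and
the variance `1/14` turns `S + i√7 A` into a GUE matrix; the identities are Jacobi's formula, Wick
contraction and the resolvent identity, with `β = 2`. In the first model `Q` is an explicit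
quadratic polynomial, and `β = 8` counts the real coordinates off the diagonal.

The chain rule for `Q ↦ Q ^ 8` gives the formulas for `P`. Evaluating the two identities at the
roots gives `Γ(x_i, x_j) = δ_ij` and `L x_i = β ∑ 1/(x_i - x_j)`, so the induced operator is the
Dyson generator `dysonGen`. With `w = ∏ (x_i - x_j)^β` this operator has the divergence form `w⁻¹ ∑
∂_i (w ∂_i)`, which makes `w dx` reversible. Conversely, testing reversibility on coordinate
functions shows that `μ / w` has zero distributional derivatives, and on a convex cone this forces a
multiple of Lebesgue measure (`exists_restrict_eq_smul_restrict`).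

Almost everywhere simplicity of the spectrum comes from a nonvanishing linear form (first model) or
discriminant (second model). -/

theorem ContDiffAt.differentiableAt_fderiv_apply {F : E → ℝ} {m : E} (hF : ContDiffAt ℝ 2 F m)
    (v : E) : DifferentiableAt ℝ (fun m' => fderiv ℝ F m' v) m :=
  ((hF.fderiv_right (m := 1) le_rfl).differentiableAt one_ne_zero).clm_apply
    (differentiableAt_const v)

theorem ContDiffAt.eventually_differentiableAt {G : Type*} [NormedAddCommGroup G] [NormedSpace ℝ G]
    {F : E → G} {m : E} (hF : ContDiffAt ℝ 2 F m) :
    ∀ᶠ m' in nhds m, DifferentiableAt ℝ F m' :=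
  (hF.eventually (by simp)).mono fun _ h => h.differentiableAt (by simp)

theorem fderiv_fderiv_mul {F G : E → ℝ} {m : E} (hF : ContDiffAt ℝ 2 F m)
    (hG : ContDiffAt ℝ 2 G m) (v w : E) :
    fderiv ℝ (fun m' => fderiv ℝ (fun y => F y * G y) m' v) m w =
      F m * fderiv ℝ (fun m' => fderiv ℝ G m' v) m w +
        G m * fderiv ℝ (fun m' => fderiv ℝ F m' v) m w +
        fderiv ℝ F m w * fderiv ℝ G m v + fderiv ℝ F m v * fderiv ℝ G m w := by
  have h : (fun m' => fderiv ℝ (fun y => F y * G y) m' v) =ᶠ[nhds m]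
      fun m' => F m' * fderiv ℝ G m' v + G m' * fderiv ℝ F m' v := by
    filter_upwards [hF.eventually_differentiableAt, hG.eventually_differentiableAt] with m' h1 h2
    rw [fderiv_fun_mul h1 h2]
    simp
  have dF := hF.differentiableAt (by simp)
  have dG := hG.differentiableAt (by simp)
  rw [h.fderiv_eq, fderiv_fun_add (dF.fun_mul (hG.differentiableAt_fderiv_apply v))
    (dG.fun_mul (hF.differentiableAt_fderiv_apply v)),
    fderiv_fun_mul dF (hG.differentiableAt_fderiv_apply v),
    fderiv_fun_mul dG (hF.differentiableAt_fderiv_apply v)]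
  simp
  ring

theorem fderiv_eq_sum_single {κ : Type*} [Fintype κ] [DecidableEq κ] (L : (κ → ℝ) →L[ℝ] ℝ)
    (v : κ → ℝ) : L v = ∑ i, L (Pi.single i 1) * v i := by
  conv_lhs => rw [pi_eq_sum_univ' v, map_sum]
  refine Finset.sum_congr rfl fun i _ => ?_
  rw [map_smul, smul_eq_mul, mul_comm]

theorem fderiv_comp_pi {κ : Type*} [Fintype κ] [DecidableEq κ] {f : (κ → ℝ) → ℝ} {x : E → κ → ℝ}
    {m : E} (hf : DifferentiableAt ℝ f (x m)) (hx : DifferentiableAt ℝ x m) (v : E) :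
    fderiv ℝ (fun y => f (x y)) m v =
      ∑ i, fderiv ℝ f (x m) (Pi.single i 1) * fderiv ℝ (fun y => x y i) m v := by
  have := fderiv_comp (𝕜 := ℝ) (x := m) (g := f) (f := x) hf hx
  rw [show (fun y => f (x y)) = f ∘ x from rfl, this]
  simp only [ContinuousLinearMap.coe_comp, Function.comp]
  rw [fderiv_eq_sum_single]
  refine Finset.sum_congr rfl fun i _ => ?_
  rw [(hasFDerivAt_pi'.1 hx.hasFDerivAt i).fderiv]
  rfl

theorem fderiv_fderiv_comp_pi {κ : Type*} [Fintype κ] [DecidableEq κ] {f : (κ → ℝ) → ℝ}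
    {x : E → κ → ℝ} {m : E} (hf : ContDiffAt ℝ 2 f (x m)) (hx : ContDiffAt ℝ 2 x m) (v w : E) :
    fderiv ℝ (fun m' => fderiv ℝ (fun y => f (x y)) m' v) m w =
      ∑ i, ∑ j, fderiv ℝ (fun z => fderiv ℝ f z (Pi.single i 1)) (x m) (Pi.single j 1) *
          (fderiv ℝ (fun y => x y j) m w * fderiv ℝ (fun y => x y i) m v) +
        ∑ i, fderiv ℝ f (x m) (Pi.single i 1) *
          fderiv ℝ (fun m' => fderiv ℝ (fun y => x y i) m' v) m w := by
  have hxi : ∀ i, ContDiffAt ℝ 2 (fun y => x y i) m := fun i => contDiffAt_pi.1 hx i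
  have dx := hx.differentiableAt (by simp)
  have h : (fun m' => fderiv ℝ (fun y => f (x y)) m' v) =ᶠ[nhds m]
      fun m' => ∑ i, fderiv ℝ f (x m') (Pi.single i 1) * fderiv ℝ (fun y => x y i) m' v := by
    filter_upwards [hx.continuousAt.eventually hf.eventually_differentiableAt,
      hx.eventually_differentiableAt] with m' h1 h2
    exact fderiv_comp_pi h1 h2 v
  have d1 : ∀ i, DifferentiableAt ℝ (fun m' => fderiv ℝ f (x m') (Pi.single i 1)) m := fun i =>
    DifferentiableAt.comp m (hf.differentiableAt_fderiv_apply _) dx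
  have d2 := fun i => (hxi i).differentiableAt_fderiv_apply v
  rw [h.fderiv_eq, fderiv_fun_sum fun i _ => (d1 i).fun_mul (d2 i), sum_apply,
    ← Finset.sum_add_distrib]
  refine Finset.sum_congr rfl fun i _ => ?_
  rw [fderiv_fun_mul (d1 i) (d2 i)]
  simp only [add_apply, smul_apply, smul_eq_mul]
  rw [fderiv_comp_pi (hf.differentiableAt_fderiv_apply _) dx, Finset.mul_sum, add_comm]
  congr 1
  exact Finset.sum_congr rfl fun j _ => by ring

end Calculus

section DiffOp

variable {ι : Type} [Fintype ι] [DecidableEq ι]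

/-- The bilinear form `∑ g^{ab} ∂_a F ∂_b G`, the carré du champ of `diffOp g` on `C²`. -/
def gradForm (g : ι → ι → ℝ) (F G : (ι → ℝ) → ℝ) (m : ι → ℝ) : ℝ :=
  ∑ a, ∑ b, g a b * (fderiv ℝ F m (Pi.single a 1) * fderiv ℝ G m (Pi.single b 1))

variable {g : ι → ι → ℝ} {F G : (ι → ℝ) → ℝ} {m : ι → ℝ}

theorem gradForm_comm (hg : ∀ a b, g a b = g b a) : gradForm g F G m = gradForm g G F m := by
  unfold gradForm
  rw [Finset.sum_comm]
  exact Finset.sum_congr rfl fun b _ => Finset.sum_congr rfl fun a _ => by rw [hg]; ring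

theorem Filter.EventuallyEq.diffOp_eq (h : F =ᶠ[nhds m] G) : diffOp g F m = diffOp g G m := by
  unfold diffOp
  refine Finset.sum_congr rfl fun a _ => Finset.sum_congr rfl fun b _ => ?_
  have : (fun m' => fderiv ℝ F m' (Pi.single b 1)) =ᶠ[nhds m]
      fun m' => fderiv ℝ G m' (Pi.single b 1) := (h.fderiv (𝕜 := ℝ)).mono fun m' h' => by simp only [h']
  rw [this.fderiv_eq]

theorem diffOp_mul (hg : ∀ a b, g a b = g b a) (hF : ContDiffAt ℝ 2 F m)
    (hG : ContDiffAt ℝ 2 G m) :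
    diffOp g (fun y => F y * G y) m =
      F m * diffOp g G m + G m * diffOp g F m + 2 * gradForm g F G m := by
  rw [two_mul]
  nth_rw 2 [gradForm_comm hg]
  unfold diffOp gradForm
  simp only [Finset.mul_sum, ← Finset.sum_add_distrib]
  refine Finset.sum_congr rfl fun a _ => Finset.sum_congr rfl fun b _ => ?_
  rw [fderiv_fderiv_mul hF hG]
  ring

theorem carre_eq_gradForm (hg : ∀ a b, g a b = g b a) (hF : ContDiffAt ℝ 2 F m)
    (hG : ContDiffAt ℝ 2 G m) : carre g F G m = gradForm g F G m := by
  unfold carre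
  rw [diffOp_mul hg hF hG]
  ring

/-- Only the differentials at `m` enter. This transfers the form to powers, logarithms and roots as
soon as their differentials are known at one point. -/
theorem gradForm_of_fderiv_eq_smul {F' G' : (ι → ℝ) → ℝ} {c d : ℝ}
    (hF : fderiv ℝ F m = c • fderiv ℝ F' m) (hG : fderiv ℝ G m = d • fderiv ℝ G' m) :
    gradForm g F G m = c * d * gradForm g F' G' m := by
  unfold gradForm
  simp only [hF, hG, Finset.mul_sum]
  refine Finset.sum_congr rfl fun a _ => Finset.sum_congr rfl fun b _ => ?_
  simp
  ring

/-- Induction by the product rule. Writing the exponent as `k + 2` avoids truncated subtraction; the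
eighth power is `k = 6`. -/
theorem diffOp_pow (hg : ∀ a b, g a b = g b a) (hF : ContDiffAt ℝ 2 F m) (k : ℕ) :
    diffOp g (fun y => F y ^ (k + 2)) m =
      (k + 2) * F m ^ (k + 1) * diffOp g F m +
        (k + 2) * (k + 1) * F m ^ k * gradForm g F F m := by
  have dF := hF.differentiableAt (by simp)
  have hf : ∀ k : ℕ, fderiv ℝ (fun y => F y ^ (k + 1)) m =
      ((k + 1) * F m ^ k) • fderiv ℝ F m := fun k => by
    rw [fderiv_fun_pow _ dF]; simp
  induction k with
  | zero =>
    simp only [pow_two, zero_add]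
    rw [diffOp_mul hg hF hF]
    simp; ring
  | succ k ih =>
    have : (fun y => F y ^ (k + 1 + 2)) = fun y => F y ^ (k + 1 + 1) * F y := by
      ext y; ring
    rw [this, diffOp_mul hg (hF.pow _) hF, ih,
      gradForm_of_fderiv_eq_smul (hf (k + 1)) (one_smul ℝ _).symm]
    push_cast
    ring

/-- The second order chain rule: `L (f ∘ x) = ∑ ∂_i ∂_j f Γ(x_i, x_j) + ∑ ∂_i f L x_i`. -/
theorem diffOp_comp_pi {κ : Type*} [Fintype κ] [DecidableEq κ] {f : (κ → ℝ) → ℝ}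
    {x : (ι → ℝ) → κ → ℝ} (hf : ContDiffAt ℝ 2 f (x m)) (hx : ContDiffAt ℝ 2 x m) :
    diffOp g (fun y => f (x y)) m =
      ∑ i, ∑ j, fderiv ℝ (fun z => fderiv ℝ f z (Pi.single i 1)) (x m) (Pi.single j 1) *
          gradForm g (fun y => x y j) (fun y => x y i) m +
        ∑ i, fderiv ℝ f (x m) (Pi.single i 1) * diffOp g (fun y => x y i) m := by
  unfold diffOp gradForm
  simp only [fderiv_fderiv_comp_pi hf hx, mul_add, Finset.sum_add_distrib, Finset.mul_sum]
  congr 1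
  · simp only [Finset.sum_comm (s := (Finset.univ : Finset ι)) (t := (Finset.univ : Finset κ))]
    refine Finset.sum_congr rfl fun i _ => Finset.sum_congr rfl fun j _ =>
      Finset.sum_congr rfl fun a _ => Finset.sum_congr rfl fun b _ => by ring
  · simp only [Finset.sum_comm (s := (Finset.univ : Finset ι)) (t := (Finset.univ : Finset κ))]
    refine Finset.sum_congr rfl fun i _ =>
      Finset.sum_congr rfl fun a _ => Finset.sum_congr rfl fun b _ => by ring

end DiffOp

/-! ### Real-rooted families of polynomials -/

section Roots

variable {n : ℕ}

/-- Counting: `n` distinct values inside a list of length `n` exhaust it. It identifies an ordered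
set of eigenvalues with the list of roots of `Q`. -/
theorem eq_of_strictMono_of_monotone_of_range_subset {x y : Fin n → ℝ} (hx : StrictMono x)
    (hy : Monotone y) (h : Set.range x ⊆ Set.range y) : x = y := by
  classical
  have h1 : Finset.univ.image x ⊆ Finset.univ.image y := by
    rw [← Finset.coe_subset]; simpa using h
  have h2 : (Finset.univ.image x).card = n := by
    rw [Finset.card_image_of_injective _ hx.injective]; simp
  have h3 : (Finset.univ.image y).card ≤ n := Finset.card_image_le.trans (by simp)
  have h4 := Finset.eq_of_subset_of_card_le h1 (by omega)
  have h5 : Function.Injective y := by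
    have : Set.InjOn y (Finset.univ : Finset (Fin n)) :=
      Finset.card_image_iff.1 (by rw [← h4, h2]; simp)
    simpa using this
  refine (StrictMono.range_inj hx (hy.strictMono_of_injective h5)).1 ?_
  have := congrArg (fun s : Finset ℝ => (s : Set ℝ)) h4
  simpa using this

theorem hasDerivAt_prod_sub (x : Fin n → ℝ) (s : Finset (Fin n)) (X : ℝ) :
    HasDerivAt (fun X => ∏ i ∈ s, (X - x i)) (∑ i ∈ s, ∏ j ∈ s.erase i, (X - x j)) X := by
  have := HasDerivAt.fun_finsetProd (u := s) (f := fun i X => X - x i) (f' := fun _ => 1)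
    (x := X) fun i _ => (hasDerivAt_id X).sub_const (x i)
  simpa using this

theorem deriv_prod_sub_at_root (x : Fin n → ℝ) (l : Fin n) :
    deriv (fun X => ∏ i, (X - x i)) (x l) = ∏ j ∈ Finset.univ.erase l, (x l - x j) := by
  rw [(hasDerivAt_prod_sub x _ _).deriv, Finset.sum_eq_single_of_mem l (Finset.mem_univ l)]
  intro i _ hi
  exact Finset.prod_eq_zero (Finset.mem_erase.2 ⟨Ne.symm hi, Finset.mem_univ l⟩) (sub_self _)

theorem prod_erase_ne_zero {x : Fin n → ℝ} (hx : Function.Injective x) (l : Fin n) :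
    ∏ j ∈ Finset.univ.erase l, (x l - x j) ≠ 0 :=
  Finset.prod_ne_zero_iff.2 fun _ hj =>
    sub_ne_zero.2 fun h => (Finset.mem_erase.1 hj).1 (hx h).symm

/-- With the factor `X - x_l` split off from the remaining product `R`, the second derivative at
`x_l` is `2 R'(x_l)`, and `R'/R` is the sum of inverses. -/
theorem deriv_deriv_prod_sub_at_root {x : Fin n → ℝ} (hx : Function.Injective x) (l : Fin n) :
    deriv (deriv fun X => ∏ i, (X - x i)) (x l) =
      2 * (∏ j ∈ Finset.univ.erase l, (x l - x j)) *
        ∑ j ∈ Finset.univ.erase l, (x l - x j)⁻¹ := by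
  set s := Finset.univ.erase l with hs
  have h0 : (fun X => ∏ i, (X - x i)) = fun X => (X - x l) * ∏ i ∈ s, (X - x i) := by
    ext X; exact (Finset.mul_prod_erase _ _ (Finset.mem_univ l)).symm
  have h1 : (deriv fun X => ∏ i, (X - x i)) = fun X =>
      ∏ i ∈ s, (X - x i) + (X - x l) * ∑ i ∈ s, ∏ j ∈ s.erase i, (X - x j) := by
    ext X
    rw [h0]
    have := ((hasDerivAt_id X).sub_const (x l)).fun_mul (hasDerivAt_prod_sub x s X)
    simpa using this.deriv
  have d : DifferentiableAt ℝ (fun X => ∑ i ∈ s, ∏ j ∈ s.erase i, (X - x j)) (x l) := by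
    fun_prop
  rw [h1]
  have := (hasDerivAt_prod_sub x s (x l)).fun_add
    (((hasDerivAt_id (x l)).sub_const (x l)).fun_mul d.hasDerivAt)
  have h2 := this.deriv
  simp only [id, sub_self, zero_mul, add_zero, one_mul] at h2
  rw [h2, ← two_mul, mul_assoc]
  congr 1
  rw [Finset.mul_sum]
  refine Finset.sum_congr rfl fun i hi => ?_
  have hne : x l - x i ≠ 0 := sub_ne_zero.2 fun h => (Finset.mem_erase.1 hi).1 (hx h).symm
  rw [← Finset.mul_prod_erase _ _ hi]
  field_simp

/-- Identities proved away from the roots extend to all `X` by continuity. -/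
theorem dense_setOf_prod_sub_ne_zero (x : Fin n → ℝ) :
    Dense {X : ℝ | ∏ i, (X - x i) ≠ 0} := by
  have : {X : ℝ | ∏ i, (X - x i) ≠ 0} = (Set.range x)ᶜ := by
    ext X
    simp [Finset.prod_eq_zero_iff, sub_eq_zero, eq_comm (a := X)]
  rw [this]
  exact (Set.finite_range x).countable.dense_compl ℝ

theorem dense_setOf_prod_sub_ne_zero_and (x : Fin n → ℝ) (Y : ℝ) :
    Dense {X : ℝ | Y ≠ X ∧ ∏ i, (X - x i) ≠ 0} := by
  have : {X : ℝ | Y ≠ X ∧ ∏ i, (X - x i) ≠ 0} = (insert Y (Set.range x))ᶜ := by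
    ext X
    simp [Finset.prod_eq_zero_iff, sub_eq_zero, eq_comm (a := X)]
  rw [this]
  exact ((Set.finite_range x).insert Y).countable.dense_compl ℝ

end Roots

section CharP

variable {κ : Type} [Fintype κ] [DecidableEq κ] {n : ℕ}

theorem mem_spectrum_iff_charP (M : Matrix κ κ ℝ) (X : ℝ) :
    X ∈ spectrum ℝ M ↔ charP M X = 0 := by
  rw [spectrum.mem_iff, ← IsUnit.neg_iff, neg_sub, Matrix.isUnit_iff_isUnit_det, isUnit_iff_ne_zero,
    not_not, charP, Algebra.algebraMap_eq_smul_one]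

end CharP

/-- The family `Q m` of monic real-rooted polynomials of degree `n` is an eighth root of the
characteristic polynomials of the matrices `M m`, and the diffusion `diffOp g` acts on it as on the
characteristic polynomial of a Gaussian ensemble with Dyson index `β`. -/
structure SpectralModel {ι κ : Type} [Fintype ι] [DecidableEq ι] [Fintype κ] [DecidableEq κ]
    (n : ℕ) (g : ι → ι → ℝ) (M : (ι → ℝ) → Matrix κ κ ℝ) (Q : (ι → ℝ) → ℝ → ℝ) (β : ℝ) :
    Prop where
  symm : ∀ a b, g a b = g b a
  contDiff : ContDiff ℝ (⊤ : ℕ∞) (fun p : (ι → ℝ) × ℝ => Q p.1 p.2)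
  roots : ∀ m, ∃ x : Fin n → ℝ, Monotone x ∧ ∀ X, Q m X = ∏ i, (X - x i)
  charP_eq : ∀ m X, charP (M m) X = Q m X ^ 8
  isSymm : ∀ m, (M m).IsSymm
  diffOp_of_ne : ∀ m X, Q m X ≠ 0 →
    diffOp g (fun m' => Q m' X) m = -(β / 2) * deriv (deriv (Q m)) X
  gradForm_of_ne : ∀ m X Y, X ≠ Y → Q m X ≠ 0 → Q m Y ≠ 0 →
    (Y - X) * gradForm g (fun m' => Q m' X) (fun m' => Q m' Y) m =
      deriv (Q m) X * Q m Y - deriv (Q m) Y * Q m X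
  surj : ∀ x : Fin n → ℝ, StrictMono x → ∃ m, ∀ X, Q m X = ∏ i, (X - x i)

/-! ### Action of the diffusion on the characteristic polynomial -/

namespace SpectralModel

variable {ι κ : Type} [Fintype ι] [DecidableEq ι] [Fintype κ] [DecidableEq κ]
    {n : ℕ} {g : ι → ι → ℝ} {M : (ι → ℝ) → Matrix κ κ ℝ} {Q : (ι → ℝ) → ℝ → ℝ} {β : ℝ}

theorem contDiff_left (h : SpectralModel n g M Q β) (X : ℝ) :
    ContDiff ℝ (⊤ : ℕ∞) fun m => Q m X :=
  h.contDiff.comp (contDiff_id.prodMk contDiff_const)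

theorem contDiffAt_left (h : SpectralModel n g M Q β) (X : ℝ) (m : ι → ℝ) :
    ContDiffAt ℝ 2 (fun m => Q m X) m :=
  ((h.contDiff_left X).of_le (WithTop.coe_le_coe.2 (le_top : (2 : ℕ∞) ≤ ⊤))).contDiffAt

theorem contDiff_right (h : SpectralModel n g M Q β) (m : ι → ℝ) :
    ContDiff ℝ (⊤ : ℕ∞) (Q m) :=
  h.contDiff.comp (contDiff_const.prodMk contDiff_id)

theorem contDiff_deriv (h : SpectralModel n g M Q β) (m : ι → ℝ) :
    ContDiff ℝ (⊤ : ℕ∞) (deriv (Q m)) :=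
  (contDiff_infty_iff_deriv.1 (h.contDiff_right m)).2

theorem contDiff_deriv_deriv (h : SpectralModel n g M Q β) (m : ι → ℝ) :
    ContDiff ℝ (⊤ : ℕ∞) (deriv (deriv (Q m))) :=
  (contDiff_infty_iff_deriv.1 (h.contDiff_deriv m)).2

theorem contDiff_fderiv_apply (h : SpectralModel n g M Q β) (v : ι → ℝ) :
    ContDiff ℝ (⊤ : ℕ∞) fun p : (ι → ℝ) × ℝ => fderiv ℝ (fun m' => Q m' p.2) p.1 v := by
  refine (ContDiff.fderiv (n := (⊤ : ℕ∞)) (f := fun (p : (ι → ℝ) × ℝ) m' => Q m' p.2) (g := Prod.fst)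
    (h.contDiff.comp (contDiff_snd.prodMk (contDiff_snd.comp contDiff_fst)))
    contDiff_fst le_rfl).clm_apply contDiff_const

theorem contDiff_fderiv_fderiv_apply (h : SpectralModel n g M Q β) (v w : ι → ℝ) :
    ContDiff ℝ (⊤ : ℕ∞) fun p : (ι → ℝ) × ℝ =>
      fderiv ℝ (fun m => fderiv ℝ (fun m' => Q m' p.2) m v) p.1 w := by
  refine (ContDiff.fderiv (n := (⊤ : ℕ∞))
    (f := fun (p : (ι → ℝ) × ℝ) m => fderiv ℝ (fun m' => Q m' p.2) m v) (g := Prod.fst)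
    ((h.contDiff_fderiv_apply v).comp (contDiff_snd.prodMk (contDiff_snd.comp contDiff_fst)))
    contDiff_fst le_rfl).clm_apply contDiff_const

theorem differentiable_gradForm (h : SpectralModel n g M Q β) (m : ι → ℝ) (X : ℝ) :
    Differentiable ℝ fun Y => gradForm g (fun m' => Q m' X) (fun m' => Q m' Y) m := by
  have : ∀ v, Differentiable ℝ fun Y => fderiv ℝ (fun m' => Q m' Y) m v := fun v =>
    ((h.contDiff_fderiv_apply v).comp (contDiff_const.prodMk contDiff_id)).differentiable (by simp)
  unfold gradForm
  fun_prop

theorem dense_ne_zero (h : SpectralModel n g M Q β) (m : ι → ℝ) : Dense {X | Q m X ≠ 0} := by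
  obtain ⟨x, -, hx⟩ := h.roots m
  simpa only [hx] using dense_setOf_prod_sub_ne_zero x

theorem dense_ne_and_ne_zero (h : SpectralModel n g M Q β) (m : ι → ℝ) (Y : ℝ) :
    Dense {X | Y ≠ X ∧ Q m X ≠ 0} := by
  obtain ⟨x, -, hx⟩ := h.roots m
  simpa only [hx] using dense_setOf_prod_sub_ne_zero_and x Y

theorem diffOp_eq (h : SpectralModel n g M Q β) (m : ι → ℝ) (X : ℝ) :
    diffOp g (fun m' => Q m' X) m = -(β / 2) * deriv (deriv (Q m)) X := by
  have c1 : Continuous fun X => diffOp g (fun m' => Q m' X) m := by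
    unfold diffOp
    refine continuous_finsetSum _ fun a _ => continuous_finsetSum _ fun b _ => ?_
    exact continuous_const.mul ((h.contDiff_fderiv_fderiv_apply _ _).continuous.comp
      (continuous_const.prodMk continuous_id))
  exact congrFun (c1.ext_on (h.dense_ne_zero m) (continuous_const.mul
    (h.contDiff_deriv_deriv m).continuous) fun X hX => h.diffOp_of_ne m X hX) X

theorem gradForm_eq (h : SpectralModel n g M Q β) (m : ι → ℝ) (X Y : ℝ) :
    (Y - X) * gradForm g (fun m' => Q m' X) (fun m' => Q m' Y) m =
      deriv (Q m) X * Q m Y - deriv (Q m) Y * Q m X := by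
  have c0 := (h.contDiff_right m).continuous
  have c1 := (h.contDiff_deriv m).continuous
  have c2 : ∀ X, Continuous fun Y => gradForm g (fun m' => Q m' X) (fun m' => Q m' Y) m :=
    fun X => (h.differentiable_gradForm m X).continuous
  -- Continuity is used one variable at a time: first in `Y` for fixed `X` off the roots, then in
  -- `X`.
  have key : ∀ X, Q m X ≠ 0 → ∀ Y,
      (Y - X) * gradForm g (fun m' => Q m' X) (fun m' => Q m' Y) m =
        deriv (Q m) X * Q m Y - deriv (Q m) Y * Q m X := fun X hX Y =>
    congrFun (Continuous.ext_on (h.dense_ne_and_ne_zero m X)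
      (f := fun Y => (Y - X) * gradForm g (fun m' => Q m' X) (fun m' => Q m' Y) m)
      (g := fun Y => deriv (Q m) X * Q m Y - deriv (Q m) Y * Q m X)
      ((continuous_id.sub continuous_const).mul (c2 X)) (by fun_prop)
      fun Y hY => h.gradForm_of_ne m X Y hY.1 hX hY.2) Y
  have c3 : Continuous fun X => gradForm g (fun m' => Q m' X) (fun m' => Q m' Y) m := by
    simpa only [gradForm_comm h.symm (G := fun m' => Q m' Y)] using c2 Y
  exact congrFun (Continuous.ext_on (h.dense_ne_zero m)
      (f := fun X => (Y - X) * gradForm g (fun m' => Q m' X) (fun m' => Q m' Y) m)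
      (g := fun X => deriv (Q m) X * Q m Y - deriv (Q m) Y * Q m X)
      ((continuous_const.sub continuous_id).mul c3) (by fun_prop)
      fun X hX => key X hX Y) X

/-- Differentiate the two-point identity in `Y` at `Y = X`; on the left only the derivative of the
factor `Y - X` survives. -/
theorem gradForm_self (h : SpectralModel n g M Q β) (m : ι → ℝ) (X : ℝ) :
    gradForm g (fun m' => Q m' X) (fun m' => Q m' X) m =
      deriv (Q m) X ^ 2 - Q m X * deriv (deriv (Q m)) X := by
  have d0 := ((h.contDiff_right m).differentiable (by simp) X).hasDerivAt
  have d1 := ((h.contDiff_deriv m).differentiable (by simp) X).hasDerivAt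
  have h1 := ((hasDerivAt_id X).sub_const X).fun_mul (h.differentiable_gradForm m X X).hasDerivAt
  have h2 := (d0.const_mul (deriv (Q m) X)).fun_sub (d1.mul_const (Q m X))
  simp only [id, h.gradForm_eq] at h1
  have := h1.unique h2
  simp only [sub_self, zero_mul, add_zero, one_mul] at this
  rw [this]
  ring

theorem deriv_charP (h : SpectralModel n g M Q β) (m : ι → ℝ) (X : ℝ) :
    deriv (charP (M m)) X = 8 * Q m X ^ 7 * deriv (Q m) X := by
  rw [show charP (M m) = fun X => Q m X ^ 8 from funext (h.charP_eq m),
    deriv_fun_pow ((h.contDiff_right m).differentiable (by simp) X)]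
  norm_num

theorem iteratedDeriv_charP (h : SpectralModel n g M Q β) (m : ι → ℝ) (X : ℝ) :
    iteratedDeriv 2 (charP (M m)) X =
      56 * Q m X ^ 6 * deriv (Q m) X ^ 2 + 8 * Q m X ^ 7 * deriv (deriv (Q m)) X := by
  rw [iteratedDeriv_succ, iteratedDeriv_one, show deriv (charP (M m)) = _ from
    funext (h.deriv_charP m)]
  have d0 := ((h.contDiff_right m).differentiable (by simp) X).hasDerivAt
  have d1 := ((h.contDiff_deriv m).differentiable (by simp) X).hasDerivAt
  have := (((d0.fun_pow 7).const_mul 8).fun_mul d1).deriv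
  rw [this]
  push_cast
  ring

/-- `L(Q⁸) = 8 Q⁷ L Q + 56 Q⁶ Γ(Q, Q)` is a combination of `Q⁷ Q''` and `Q⁶ Q'²`. Matching with `P''
= 8 Q⁷ Q'' + 56 Q⁶ Q'²` and `P'²/P = 64 Q⁶ Q'²` gives the two constants. -/
theorem diffOp_charP (h : SpectralModel n g M Q β) (m : ι → ℝ) (X : ℝ)
    (hX : charP (M m) X ≠ 0) :
    diffOp g (fun m' => charP (M m') X) m =
      -(β / 2 + 7) * iteratedDeriv 2 (charP (M m)) X +
        (7 + 7 * β / 16) * ((deriv (charP (M m)) X) ^ 2 / charP (M m) X) := by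
  rw [h.iteratedDeriv_charP, h.deriv_charP]
  simp only [h.charP_eq] at hX ⊢
  have hQ : Q m X ≠ 0 := fun h0 => hX (by rw [h0]; norm_num)
  rw [diffOp_pow h.symm (h.contDiffAt_left X m) 6, h.gradForm_self, h.diffOp_eq]
  field_simp
  push_cast
  ring

/-- Since `log P = 8 log |Q|`, the left side is `64 Γ(Q(X), Q(Y)) / (Q(X) Q(Y))`, while `P'/P = 8
Q'/Q`; one factor 8 remains. -/
theorem carre_log_charP (h : SpectralModel n g M Q β) (m : ι → ℝ) (X Y : ℝ) (hXY : X ≠ Y)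
    (hX : charP (M m) X ≠ 0) (hY : charP (M m) Y ≠ 0) :
    carre g (fun m' => Real.log (charP (M m') X)) (fun m' => Real.log (charP (M m') Y)) m =
      8 / (Y - X) * (deriv (charP (M m)) X / charP (M m) X -
        deriv (charP (M m)) Y / charP (M m) Y) := by
  rw [h.deriv_charP, h.deriv_charP]
  simp only [h.charP_eq] at hX hY ⊢
  have hQX : Q m X ≠ 0 := fun h0 => hX (by rw [h0]; norm_num)
  have hQY : Q m Y ≠ 0 := fun h0 => hY (by rw [h0]; norm_num)
  have hf : ∀ X, Q m X ≠ 0 → fderiv ℝ (fun m' => Real.log (Q m' X ^ 8)) m =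
      (8 / Q m X) • fderiv ℝ (fun m' => Q m' X) m := fun X hX => by
    have d := (h.contDiffAt_left X m).differentiableAt (by simp)
    simp only [Real.log_pow]
    rw [fderiv_const_mul (d.log hX), fderiv.log d hX, smul_smul]
    rfl
  have hc : ∀ X, Q m X ≠ 0 → ContDiffAt ℝ 2 (fun m' => Real.log (Q m' X ^ 8)) m := fun X hX =>
    ((h.contDiffAt_left X m).pow 8).log (pow_ne_zero _ hX)
  rw [carre_eq_gradForm h.symm (hc X hQX) (hc Y hQY),
    gradForm_of_fderiv_eq_smul (hf X hQX) (hf Y hQY)]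
  have hne : Y - X ≠ 0 := sub_ne_zero.2 hXY.symm
  have := h.gradForm_eq m X Y
  rw [← mul_right_inj' hne]
  field_simp
  linear_combination this

end SpectralModel

/-! ### The eigenvalues as a Dyson diffusion -/

namespace SpectralModel

variable {ι κ : Type} [Fintype ι] [DecidableEq ι] [Fintype κ] [DecidableEq κ]
    {n : ℕ} {g : ι → ι → ℝ} {M : (ι → ℝ) → Matrix κ κ ℝ} {Q : (ι → ℝ) → ℝ → ℝ} {β : ℝ}

theorem mem_spectrum_iff (h : SpectralModel n g M Q β) (m : ι → ℝ) (X : ℝ) :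
    X ∈ spectrum ℝ (M m) ↔ Q m X = 0 := by
  rw [mem_spectrum_iff_charP, h.charP_eq]
  simp

theorem spectrum_eq_range (h : SpectralModel n g M Q β) {m : ι → ℝ} {x : Fin n → ℝ}
    (hx : ∀ X, Q m X = ∏ i, (X - x i)) : spectrum ℝ (M m) = Set.range x := by
  ext X
  rw [h.mem_spectrum_iff, hx]
  simp [Finset.prod_eq_zero_iff, sub_eq_zero, eq_comm (a := X)]

theorem listsSpectrum_iff (h : SpectralModel n g M Q β) {m : ι → ℝ} {x : Fin n → ℝ} :
    ListsSpectrum (M m) x ↔ StrictMono x ∧ ∀ X, Q m X = ∏ i, (X - x i) := by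
  constructor
  · rintro ⟨hx, hr⟩
    refine ⟨hx, ?_⟩
    obtain ⟨y, hy, hQ⟩ := h.roots m
    rw [h.spectrum_eq_range hQ] at hr
    rwa [eq_of_strictMono_of_monotone_of_range_subset hx hy hr.le]
  · rintro ⟨hx, hQ⟩
    exact ⟨hx, (h.spectrum_eq_range hQ).symm⟩

/-- A simple root has `∂_X Q = ∏_{j ≠ i} (x_i - x_j) ≠ 0`, so the implicit function theorem applies
to each one. The strict order is an open condition, hence nearby the `n` branches stay distinct and
are all the roots. -/
theorem exists_contDiffAt_roots (h : SpectralModel n g M Q β) {m : ι → ℝ} {x : Fin n → ℝ}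
    (hx : StrictMono x) (hQ : ∀ X, Q m X = ∏ i, (X - x i)) :
    ∃ ξ : (ι → ℝ) → Fin n → ℝ, ContDiffAt ℝ 2 ξ m ∧ ξ m = x ∧
      ∀ᶠ m' in nhds m, StrictMono (ξ m') ∧ ∀ X, Q m' X = ∏ i, (X - ξ m' i) := by
  have hc : ∀ i, ContDiffAt ℝ 2 (fun p : (ι → ℝ) × ℝ => Q p.1 p.2) (m, x i) := fun i =>
    (h.contDiff.of_le (WithTop.coe_le_coe.2 (le_top : (2 : ℕ∞) ≤ ⊤))).contDiffAt
  have hd : ∀ i, (fderiv ℝ (fun p : (ι → ℝ) × ℝ => Q p.1 p.2) (m, x i)) (0, 1) =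
      ∏ j ∈ Finset.univ.erase i, (x i - x j) := fun i => by
    rw [← deriv_prod_sub_at_root x i]
    have h1 := ((hc i).differentiableAt (by simp)).hasFDerivAt
    have h2 := h1.comp_hasDerivAt (x i) ((hasDerivAt_const (x i) m).prodMk (hasDerivAt_id (x i)))
    rw [← h2.deriv]
    congr 1
    ext X
    simp [← hQ]
  have hinv : ∀ i, (fderiv ℝ (fun p : (ι → ℝ) × ℝ => Q p.1 p.2) (m, x i) ∘L
      .inr ℝ (ι → ℝ) ℝ).IsInvertible := fun i => by
    refine ⟨ContinuousLinearEquiv.unitsEquivAut ℝ (Units.mk0 _ (prod_erase_ne_zero hx.injective i)),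
      ?_⟩
    ext
    simp [← hd i]
  set ξ : (ι → ℝ) → Fin n → ℝ := fun m' i => (hc i).implicitFunction two_ne_zero (hinv i) m'
    with hξ
  have h1 : ξ m = x := funext fun i => (hc i).implicitFunction_apply_self two_ne_zero (hinv i)
  have h2 : ContDiffAt ℝ 2 ξ m :=
    contDiffAt_pi.2 fun i => (hc i).contDiffAt_implicitFunction two_ne_zero (hinv i)
  refine ⟨ξ, h2, h1, ?_⟩
  have h3 : ∀ᶠ m' in nhds m, ∀ i, Q m' (ξ m' i) = 0 := Filter.eventually_all.2 fun i => by
    filter_upwards [(hc i).eventually_apply_implicitFunction two_ne_zero (hinv i)] with m' h'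
    refine h'.trans ?_
    rw [hQ]
    exact Finset.prod_eq_zero (Finset.mem_univ i) (sub_self _)
  have h4 : ∀ᶠ m' in nhds m, ξ m' ∈ weyl n :=
    h2.continuousAt.eventually ((weyl n).isOpen.mem_nhds (by rw [h1]; exact hx))
  filter_upwards [h3, h4] with m' h3 h4
  obtain ⟨y, hy, hy'⟩ := h.roots m'
  have : ξ m' = y := by
    refine eq_of_strictMono_of_monotone_of_range_subset h4 hy ?_
    rintro _ ⟨i, rfl⟩
    rw [← h.spectrum_eq_range hy', h.mem_spectrum_iff]
    exact h3 i
  exact ⟨h4, by rwa [this]⟩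

section Roots

variable {m : ι → ℝ} {ξ : (ι → ℝ) → Fin n → ℝ}

theorem fderiv_prod_sub (s : Finset (Fin n)) (hξ : DifferentiableAt ℝ ξ m) (X : ℝ) :
    fderiv ℝ (fun m' => ∏ i ∈ s, (X - ξ m' i)) m =
      ∑ i ∈ s, (-∏ j ∈ s.erase i, (X - ξ m j)) • fderiv ℝ (fun m' => ξ m' i) m := by
  have := HasFDerivAt.finsetProd (u := s) (g := fun i m' => X - ξ m' i)
    (g' := fun i => -fderiv ℝ (fun m' => ξ m' i) m) (x := m)
    fun i _ => (differentiableAt_pi.1 hξ i).hasFDerivAt.const_sub X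
  rw [this.fderiv]
  exact Finset.sum_congr rfl fun i _ => by ext v; simp

/-- The point `X = ξ m l` is frozen while `m'` varies, so every term of the product rule that
retains the factor `l` vanishes at `m`. -/
theorem fderiv_Q_at_root (hξ : DifferentiableAt ℝ ξ m)
    (hQ : ∀ᶠ m' in nhds m, ∀ X, Q m' X = ∏ i, (X - ξ m' i)) (l : Fin n) :
    fderiv ℝ (fun m' => Q m' (ξ m l)) m =
      (-∏ j ∈ Finset.univ.erase l, (ξ m l - ξ m j)) • fderiv ℝ (fun m' => ξ m' l) m := by
  have : (fun m' => Q m' (ξ m l)) =ᶠ[nhds m] fun m' => ∏ i, (ξ m l - ξ m' i) :=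
    hQ.mono fun m' h => h _
  rw [this.fderiv_eq, fderiv_prod_sub _ hξ, Finset.sum_eq_single_of_mem l (Finset.mem_univ l)]
  intro i _ hi
  rw [Finset.prod_eq_zero (Finset.mem_erase.2 ⟨Ne.symm hi, Finset.mem_univ l⟩) (sub_self _)]
  simp

/-- At two roots the right side of the two-point identity vanishes, so distinct roots are
orthogonal. At a double point `Γ(Q, Q) = Q'²`, and `Q'` is exactly the factor relating `dQ` to
`-dξ_i`. -/
theorem gradForm_roots (h : SpectralModel n g M Q β) (hm : StrictMono (ξ m))
    (hξ : DifferentiableAt ℝ ξ m)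
    (hQ : ∀ᶠ m' in nhds m, ∀ X, Q m' X = ∏ i, (X - ξ m' i)) (i j : Fin n) :
    gradForm g (fun m' => ξ m' i) (fun m' => ξ m' j) m = if i = j then 1 else 0 := by
  have hQm := hQ.self_of_nhds
  have hinj := hm.injective
  have key := gradForm_of_fderiv_eq_smul (g := g) (fderiv_Q_at_root hξ hQ i)
    (fderiv_Q_at_root hξ hQ j)
  have hi := prod_erase_ne_zero hinj i
  have hj := prod_erase_ne_zero hinj j
  have hz : ∀ i, Q m (ξ m i) = 0 := fun i => by
    rw [hQm]; exact Finset.prod_eq_zero (Finset.mem_univ i) (sub_self _)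
  split_ifs with hij
  · subst hij
    have h1 := h.gradForm_self m (ξ m i)
    rw [key, hz, show Q m = _ from funext hQm, deriv_prod_sub_at_root] at h1
    refine mul_left_cancel₀ (pow_ne_zero 2 hi) ?_
    linear_combination h1
  · have h1 := h.gradForm_eq m (ξ m i) (ξ m j)
    rw [key, hz, hz, mul_zero, mul_zero, sub_zero] at h1
    have h2 : ξ m j - ξ m i ≠ 0 := sub_ne_zero.2 fun e => hij (hinj e.symm)
    simpa [h2, hi, hj] using h1

/-- Apply the product rule to `Q(ξ_l(m)) = (ξ_l(m) - ξ_l) R`. The first factor vanishes at `m` and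
the cross term vanishes by orthogonality of the roots, leaving `-R L ξ_l = -(β/2) Q''(ξ_l) = -β R ∑
1/(ξ_l - ξ_j)`. -/
theorem diffOp_roots (h : SpectralModel n g M Q β) (hm : StrictMono (ξ m))
    (hξ : ContDiffAt ℝ 2 ξ m)
    (hQ : ∀ᶠ m' in nhds m, ∀ X, Q m' X = ∏ i, (X - ξ m' i)) (l : Fin n) :
    diffOp g (fun m' => ξ m' l) m = β * ∑ j ∈ Finset.univ.erase l, (ξ m l - ξ m j)⁻¹ := by
  have hinj := hm.injective
  have hdξ := hξ.differentiableAt (by simp)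
  have hl := prod_erase_ne_zero hinj l
  set s := Finset.univ.erase l with hs
  set R : (ι → ℝ) → ℝ := fun m' => ∏ j ∈ s, (ξ m l - ξ m' j) with hR
  have hξi : ∀ i, ContDiffAt ℝ 2 (fun m' => ξ m' i) m := fun i => contDiffAt_pi.1 hξ i
  have cR : ContDiffAt ℝ 2 R m := contDiffAt_prod fun i _ => contDiffAt_const.sub (hξi i)
  have cl : ContDiffAt ℝ 2 (fun m' => ξ m l - ξ m' l) m := contDiffAt_const.sub (hξi l)
  have h1 : (fun m' => Q m' (ξ m l)) =ᶠ[nhds m] fun m' => (ξ m l - ξ m' l) * R m' :=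
    hQ.mono fun m' h => (h _).trans (Finset.mul_prod_erase _ _ (Finset.mem_univ l)).symm
  have h2 := h.diffOp_eq m (ξ m l)
  rw [h1.diffOp_eq, diffOp_mul h.symm cl cR, show Q m = _ from funext hQ.self_of_nhds,
    deriv_deriv_prod_sub_at_root hinj] at h2
  have h3 : gradForm g (fun m' => ξ m l - ξ m' l) R m = 0 := by
    have : ∀ a b, g a b * (fderiv ℝ (fun m' => ξ m l - ξ m' l) m (Pi.single a 1) *
        fderiv ℝ R m (Pi.single b 1)) = ∑ i ∈ s, (∏ j ∈ s.erase i, (ξ m l - ξ m j)) *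
          (g a b * (fderiv ℝ (fun m' => ξ m' l) m (Pi.single a 1) *
            fderiv ℝ (fun m' => ξ m' i) m (Pi.single b 1))) := fun a b => by
      rw [hR, fderiv_prod_sub _ hdξ, fderiv_const_sub, sum_apply, Finset.mul_sum,
        Finset.mul_sum]
      refine Finset.sum_congr rfl fun i _ => ?_
      simp
      ring
    unfold gradForm
    simp only [this, Finset.sum_comm (s := (Finset.univ : Finset ι)) (t := s), ← Finset.mul_sum]
    refine Finset.sum_eq_zero fun i hi => ?_
    have h4 := h.gradForm_roots hm hdξ hQ l i
    rw [if_neg (Finset.mem_erase.1 hi).1.symm] at h4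
    unfold gradForm at h4
    rw [h4, mul_zero]
  have h5 : diffOp g (fun m' => ξ m l - ξ m' l) m = -diffOp g (fun m' => ξ m' l) m := by
    unfold diffOp
    simp only [fderiv_const_sub, ← Finset.sum_neg_distrib]
    refine Finset.sum_congr rfl fun a _ => Finset.sum_congr rfl fun b _ => ?_
    have : (fun m' => (-fderiv ℝ (fun m' => ξ m' l) m') (Pi.single b (1 : ℝ))) =
      fun m' => -(fderiv ℝ (fun m' => ξ m' l) m' (Pi.single b (1 : ℝ))) := rfl
    rw [this, fderiv_fun_neg]
    simp
  rw [h3, h5, sub_self, zero_mul, zero_add, mul_zero, add_zero] at h2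
  refine mul_left_cancel₀ hl ?_
  change _ * -_ = _ at h2
  linear_combination -h2

end Roots

/-- The generator of Dyson Brownian motion. -/
def _root_.dysonGen (n : ℕ) (β : ℝ) (f : (Fin n → ℝ) → ℝ) (x : Fin n → ℝ) : ℝ :=
  ∑ i, (fderiv ℝ (fun z => fderiv ℝ f z (Pi.single i 1)) x (Pi.single i 1) +
    β * ∑ j ∈ Finset.univ.erase i, (x i - x j)⁻¹ * fderiv ℝ f x (Pi.single i 1))

/-- Near `m` the function `F` equals `f ∘ ξ` for the smooth branch `ξ`, so its values at matrices
with multiple eigenvalues do not matter. -/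
theorem diffOp_comp_eigenvalues (h : SpectralModel n g M Q β) {f : (Fin n → ℝ) → ℝ}
    {F : (ι → ℝ) → ℝ} (hF : ∀ m x, ListsSpectrum (M m) x → F m = f x) {m : ι → ℝ}
    {x : Fin n → ℝ} (hx : ListsSpectrum (M m) x) (hf : ContDiffAt ℝ 2 f x) :
    diffOp g F m = dysonGen n β f x := by
  obtain ⟨hx1, hx2⟩ := h.listsSpectrum_iff.1 hx
  obtain ⟨ξ, hξ, rfl, hev⟩ := h.exists_contDiffAt_roots hx1 hx2
  have h1 : F =ᶠ[nhds m] fun m' => f (ξ m') :=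
    hev.mono fun m' h' => hF m' _ (h.listsSpectrum_iff.2 h')
  have hQ := hev.mono fun m' h' => h'.2
  rw [h1.diffOp_eq, diffOp_comp_pi hf hξ, dysonGen, ← Finset.sum_add_distrib]
  refine Finset.sum_congr rfl fun i _ => ?_
  simp only [h.gradForm_roots hx1 (hξ.differentiableAt (by simp)) hQ, h.diffOp_roots hx1 hξ hQ,
    ← Finset.sum_mul]
  simp
  ring

end SpectralModel

/-! ### Measures on an open cone with vanishing distributional derivatives -/

section Cone

variable {E : Type*} [NormedAddCommGroup E] [NormedSpace ℝ E] [FiniteDimensional ℝ E]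

theorem exists_testFunction_eq_one_nhds {W : TopologicalSpace.Opens E} {K : Set E}
    (hK : IsCompact K) (hKW : K ⊆ W) :
    ∃ χ : TestFunction W ℝ ⊤, (∀ᶠ x in nhdsSet K, χ x = 1) ∧ ∀ x, 0 ≤ χ x := by
  obtain ⟨K', hK', h1, h2⟩ := exists_compact_between hK W.isOpen hKW
  obtain ⟨f, hf1, hf0, hf⟩ := exists_contMDiffMap_one_nhds_of_subset_interior (n := (⊤ : ℕ∞))
    (modelWithCornersSelf ℝ E) hK.isClosed h1
  have ht : tsupport f ⊆ K' := closure_minimal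
    (fun x hx => by_contra fun h => hx (hf0 x h)) hK'.isClosed
  exact ⟨⟨f, f.contMDiff.contDiff, hK'.of_isClosed_subset (isClosed_tsupport _) ht,
    ht.trans h2⟩, hf1, fun x => (hf x).1⟩

/-- A smooth function whose support is contained in that of a test function, as a test function. -/
def TestFunction.ofTsupportSubset {W : TopologicalSpace.Opens E} (φ : TestFunction W ℝ ⊤)
    (u : E → ℝ) (hu : ContDiff ℝ (⊤ : ℕ∞) u) (h : tsupport u ⊆ tsupport φ) :
    TestFunction W ℝ ⊤ :=
  ⟨u, hu, φ.hasCompactSupport.of_isClosed_subset (isClosed_tsupport _) h,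
    h.trans φ.tsupport_subset⟩

/-- The product of a test function with a smooth function. -/
def TestFunction.smoothMul {W : TopologicalSpace.Opens E} (φ : TestFunction W ℝ ⊤)
    (u : E → ℝ) (hu : ContDiff ℝ (⊤ : ℕ∞) u) : TestFunction W ℝ ⊤ :=
  φ.ofTsupportSubset (fun x => u x * φ x) (hu.mul φ.contDiff) (tsupport_mul_subset_right (f := u))

variable {W : TopologicalSpace.Opens E}

theorem tsupport_comp_sub_const (φ : E → ℝ) (y : E) :
    tsupport (fun x => φ (x - y)) = (fun x => x - y) ⁻¹' tsupport φ :=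
  tsupport_comp_eq_preimage φ (Homeomorph.subRight y)

/-- The translate of a test function by a vector that maps its support into the open set. -/
def TestFunction.translate (φ : TestFunction W ℝ ⊤) (y : E) (hy : ∀ x ∈ tsupport φ, x + y ∈ W) :
    TestFunction W ℝ ⊤ where
  toFun x := φ (x - y)
  contDiff' := φ.contDiff.comp (contDiff_id.sub contDiff_const)
  hasCompactSupport' := φ.hasCompactSupport.comp_homeomorph (Homeomorph.subRight y)
  tsupport_subset' := by
    rw [tsupport_comp_sub_const]
    intro x hx
    simpa using hy _ hx

variable [MeasurableSpace E] [BorelSpace E] {ν : Measure E}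

theorem isFiniteMeasure_restrict_of_isCompact (hν : ∀ K, IsCompact K → K ⊆ W → ν K < ⊤)
    {K : Set E} (hK : IsCompact K) (hKW : K ⊆ W) : IsFiniteMeasure (ν.restrict K) :=
  ⟨by rw [Measure.restrict_apply_univ]; exact hν K hK hKW⟩

theorem integrable_of_hasCompactSupport_of_tsupport_subset
    (hν : ∀ K, IsCompact K → K ⊆ W → ν K < ⊤) {u : E → ℝ} (hu : Continuous u)
    (hc : HasCompactSupport u) (hs : tsupport u ⊆ W) : Integrable u ν := by
  have := isFiniteMeasure_restrict_of_isCompact hν hc hs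
  rw [← integrableOn_iff_integrable_of_support_subset (subset_tsupport u)]
  exact hu.integrable_of_hasCompactSupport hc

/-- The derivative of `t ↦ ∫ φ(x - t v) dν` is minus the integral of the directional derivative of a
translated test function, hence zero. The translates stay test functions because `W` is a cone
closed under addition. -/
theorem integral_translate_eq (hν : ∀ K, IsCompact K → K ⊆ W → ν K < ⊤)
    (hadd : ∀ x ∈ W, ∀ y ∈ W, x + y ∈ W) (hsmul : ∀ t : ℝ, 0 < t → ∀ x ∈ W, t • x ∈ W)
    (hz : ∀ (φ : TestFunction W ℝ ⊤) (v : E), ∫ x, fderiv ℝ φ x v ∂ν = 0)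
    (φ : TestFunction W ℝ ⊤) {v : E} (hv : v ∈ W) : ∫ x, φ (x - v) ∂ν = ∫ x, φ x ∂ν := by
  have hmem : ∀ t ∈ Set.Icc (0 : ℝ) 1, ∀ x ∈ W, x + t • v ∈ W := fun t ht x hx => by
    rcases ht.1.eq_or_lt with h | h
    · simpa [← h] using hx
    · exact hadd _ hx _ (hsmul t h v hv)
  -- The region swept by the support along the translation; it is compact in `W`, so `ν` is finite
  -- on it and Fubini applies.
  set K : Set E := (fun p : ℝ × E => p.2 + p.1 • v) '' (Set.Icc (0 : ℝ) 1 ×ˢ tsupport φ) with hKdef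
  have hK : IsCompact K :=
    (isCompact_Icc.prod φ.hasCompactSupport).image (by fun_prop)
  have hKW : K ⊆ W := by
    rintro _ ⟨⟨t, x⟩, ⟨ht, hx⟩, rfl⟩
    exact hmem t ht x (φ.tsupport_subset hx)
  have hsub : ∀ t ∈ Set.Icc (0 : ℝ) 1, ∀ x, x - t • v ∈ tsupport φ → x ∈ K := fun t ht x hx =>
    ⟨(t, x - t • v), ⟨ht, hx⟩, by simp⟩
  have := isFiniteMeasure_restrict_of_isCompact hν hK hKW
  have dφ : Differentiable ℝ φ := φ.contDiff.differentiable (by simp)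
  have cφ' : Continuous fun x => fderiv ℝ φ x v :=
    (φ.contDiff.continuous_fderiv (by simp)).clm_apply continuous_const
  have hφt : ∀ t ∈ Set.Icc (0 : ℝ) 1, ∫ x in K, φ (x - t • v) ∂ν = ∫ x, φ (x - t • v) ∂ν :=
    fun t ht => setIntegral_eq_integral_of_forall_compl_eq_zero fun x hx =>
      image_eq_zero_of_notMem_tsupport fun h => hx (hsub t ht x h)
  have hφ't : ∀ t ∈ Set.Icc (0 : ℝ) 1, ∫ x in K, fderiv ℝ φ (x - t • v) v ∂ν = 0 := fun t ht => by
    rw [setIntegral_eq_integral_of_forall_compl_eq_zero fun x hx => ?_]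
    · rw [← hz (φ.translate (t • v) fun x hx => hmem t ht x (φ.tsupport_subset hx)) v]
      congr 1
      ext x
      exact (congrArg (fun L : E →L[ℝ] ℝ => L v) (fderiv_comp_sub (f := φ) (x := x) (t • v))).symm
    · have : fderiv ℝ φ (x - t • v) = 0 := image_eq_zero_of_notMem_tsupport fun h =>
        hx (hsub t ht x (tsupport_fderiv_subset ℝ h))
      rw [this]
      rfl
  have ftc : ∀ x, ∫ t in (0 : ℝ)..1, fderiv ℝ φ (x - t • v) v = φ x - φ (x - v) := fun x => by
    have h1 : ∀ t ∈ Set.uIcc (0 : ℝ) 1, HasDerivAt (fun t : ℝ => -φ (x - t • v))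
        (fderiv ℝ φ (x - t • v) v) t := fun t _ => by
      have h2 : HasDerivAt (fun t : ℝ => x - t • v) (-v) t := by
        simpa using ((hasDerivAt_id t).smul_const v).const_sub x
      simpa using ((dφ _).hasFDerivAt.comp_hasDerivAt t h2).fun_neg
    rw [intervalIntegral.integral_eq_sub_of_hasDerivAt h1
      (Continuous.intervalIntegrable (by fun_prop) _ _)]
    simp
    ring
  obtain ⟨C, hC⟩ := cφ'.bounded_above_of_compact_support
    (φ.hasCompactSupport.fderiv_apply (𝕜 := ℝ) v)
  have swap : ∫ x in K, (∫ t in (0 : ℝ)..1, fderiv ℝ φ (x - t • v) v) ∂ν =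
      ∫ t in (0 : ℝ)..1, ∫ x in K, fderiv ℝ φ (x - t • v) v ∂ν := by
    simp only [intervalIntegral.integral_of_le zero_le_one]
    refine integral_integral_swap ?_
    refine Integrable.of_bound (C := C) ?_ (Filter.Eventually.of_forall fun p => hC _)
    exact (cφ'.comp (by fun_prop : Continuous fun p : E × ℝ =>
      p.1 - p.2 • v)).aestronglyMeasurable
  have h0 := hφt 0 (by simp)
  have h1 := hφt 1 (by simp)
  simp only [zero_smul, sub_zero, one_smul] at h0 h1
  have hz' : ∫ t in (0 : ℝ)..1, ∫ x in K, fderiv ℝ φ (x - t • v) v ∂ν = 0 := by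
    rw [intervalIntegral.integral_congr (g := fun _ => 0) fun t ht => ?_]
    · simp
    · rw [Set.uIcc_of_le zero_le_one] at ht
      exact hφ't t ht
  have hint : ∀ u : E → ℝ, Continuous u → HasCompactSupport u → Integrable u (ν.restrict K) :=
    fun u h1 h2 => h1.integrable_of_hasCompactSupport h2
  simp only [ftc] at swap
  rw [integral_sub (hint _ φ.continuous φ.hasCompactSupport)
    (hint (fun x => φ (x - v)) (by fun_prop)
      (φ.hasCompactSupport.comp_homeomorph (Homeomorph.subRight v))),
    h0, h1, hz'] at swap
  linarith

variable {lam : Measure E} [lam.IsAddHaarMeasure]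

/-- Both sides equal `∫ (ψ * φ) dν`: translation by points of the support of one function does not
change the integral of the other, and convolution is commutative. -/
theorem integral_mul_integral_comm (hν : ∀ K, IsCompact K → K ⊆ W → ν K < ⊤)
    (hadd : ∀ x ∈ W, ∀ y ∈ W, x + y ∈ W) (hsmul : ∀ t : ℝ, 0 < t → ∀ x ∈ W, t • x ∈ W)
    (hz : ∀ (φ : TestFunction W ℝ ⊤) (v : E), ∫ x, fderiv ℝ φ x v ∂ν = 0)
    (φ ψ : TestFunction W ℝ ⊤) :
    (∫ y, ψ y ∂lam) * ∫ x, φ x ∂ν = (∫ y, φ y ∂lam) * ∫ x, ψ x ∂ν := by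
  have key : ∀ φ ψ : TestFunction W ℝ ⊤,
      (∫ y, ψ y ∂lam) * ∫ x, φ x ∂ν = ∫ x, (∫ y, ψ y * φ (x - y) ∂lam) ∂ν := fun φ ψ => by
    set K : Set E := (fun p : E × E => p.1 + p.2) '' (tsupport ψ ×ˢ tsupport φ) with hKdef
    have hK : IsCompact K :=
      (ψ.hasCompactSupport.isCompact.prod φ.hasCompactSupport.isCompact).image (by fun_prop)
    have hKW : K ⊆ W := by
      rintro _ ⟨⟨y, x⟩, ⟨hy, hx⟩, rfl⟩
      exact hadd _ (ψ.tsupport_subset hy) _ (φ.tsupport_subset hx)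
    have := isFiniteMeasure_restrict_of_isCompact hν hK hKW
    have hne : ∀ x y, x ∉ K → ψ y * φ (x - y) = 0 := fun x y hx => by
      by_contra h
      refine hx ⟨(y, x - y), ⟨subset_tsupport _ (left_ne_zero_of_mul h),
        subset_tsupport _ (right_ne_zero_of_mul h)⟩, by simp⟩
    have h1 : ∫ x, (∫ y, ψ y * φ (x - y) ∂lam) ∂ν = ∫ x in K, (∫ y, ψ y * φ (x - y) ∂lam) ∂ν :=
      (setIntegral_eq_integral_of_forall_compl_eq_zero fun x hx => by simp [hne x _ hx]).symm
    have h2 : ∀ y, ∫ x in K, ψ y * φ (x - y) ∂ν = ψ y * ∫ x, φ x ∂ν := fun y => by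
      rw [setIntegral_eq_integral_of_forall_compl_eq_zero fun x hx => hne x y hx,
        integral_const_mul]
      by_cases hy : ψ y = 0
      · simp [hy]
      · rw [integral_translate_eq hν hadd hsmul hz φ (ψ.tsupport_subset (subset_tsupport _ hy))]
    rw [h1, integral_integral_swap_of_hasCompactSupport]
    · simp only [h2, integral_mul_const]
    · have h1 := φ.continuous
      have h2 := ψ.continuous
      unfold Function.uncurry
      fun_prop
    · refine HasCompactSupport.of_support_subset_isCompact
        (hK.prod ψ.hasCompactSupport.isCompact) ?_
      rintro ⟨x, y⟩ hxy
      exact ⟨by_contra fun h => hxy (hne x y h),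
        subset_tsupport _ (left_ne_zero_of_mul hxy)⟩
  rw [key φ ψ, key ψ φ]
  congr 1
  ext x
  rw [← integral_sub_left_eq_self _ lam x]
  congr 1
  ext y
  simp [mul_comm]

/-- After multiplication by a cutoff both measures are finite, and their characteristic functions
are integrals of test functions. They therefore agree on each compact set, and `W` is a countable
union of compact sets. -/
theorem restrict_eq_of_forall_integral_eq {ν' : Measure E}
    (hν : ∀ K, IsCompact K → K ⊆ W → ν K < ⊤) (hν' : ∀ K, IsCompact K → K ⊆ W → ν' K < ⊤)
    (h : ∀ φ : TestFunction W ℝ ⊤, ∫ x, φ x ∂ν = ∫ x, φ x ∂ν') :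
    ν.restrict W = ν'.restrict W := by
  have hcompact : ∀ K, IsCompact K → K ⊆ W → ν.restrict K = ν'.restrict K := fun K hK hKW => by
    obtain ⟨χ, hχ, hχ0⟩ := exists_testFunction_eq_one_nhds hK hKW
    have hfin : ∀ ν : Measure E, (∀ K, IsCompact K → K ⊆ W → ν K < ⊤) →
        IsFiniteMeasure (ν.withDensity fun x => ENNReal.ofReal (χ x)) := fun ν hν =>
      isFiniteMeasure_withDensity_ofReal (integrable_of_hasCompactSupport_of_tsupport_subset hν
        χ.continuous χ.hasCompactSupport χ.tsupport_subset).2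
    have := hfin ν hν
    have := hfin ν' hν'
    -- Real and imaginary parts of the exponential, times `χ`, are real test functions.
    have hchar : ∀ ν : Measure E, (∀ K, IsCompact K → K ⊆ W → ν K < ⊤) → ∀ L : StrongDual ℝ E,
        charFunDual (ν.withDensity fun x => ENNReal.ofReal (χ x)) L =
          ((∫ x, Real.cos (L x) * χ x ∂ν : ℝ) : ℂ) +
            ((∫ x, Real.sin (L x) * χ x ∂ν : ℝ) : ℂ) * Complex.I := fun ν hν L => by
      have hi : ∀ u : E → ℝ, ContDiff ℝ (⊤ : ℕ∞) u → Integrable (fun x => u x * χ x) ν :=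
        fun u hu => integrable_of_hasCompactSupport_of_tsupport_subset hν
          (χ.smoothMul u hu).continuous (χ.smoothMul u hu).hasCompactSupport
          (χ.smoothMul u hu).tsupport_subset
      have h1 := hi _ (Real.contDiff_cos.comp L.contDiff)
      have h2 := hi _ (Real.contDiff_sin.comp L.contDiff)
      rw [charFunDual_apply, integral_withDensity_eq_integral_toReal_smul
        (by fun_prop) (by simp), ← integral_complex_ofReal, ← integral_complex_ofReal,
        ← integral_mul_const,
        ← integral_add h1.ofReal (h2.ofReal.mul_const _)]
      congr 1
      ext x
      rw [ENNReal.toReal_ofReal (hχ0 x), Complex.exp_mul_I, Complex.real_smul]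
      push_cast
      ring
    have heq : (ν.withDensity fun x => ENNReal.ofReal (χ x)) =
        ν'.withDensity fun x => ENNReal.ofReal (χ x) := by
      refine Measure.ext_of_charFunDual (funext fun L => ?_)
      rw [hchar ν hν, hchar ν' hν',
        show ∫ x, Real.cos (L x) * χ x ∂ν = _ from
          h (χ.smoothMul _ (Real.contDiff_cos.comp L.contDiff)),
        show ∫ x, Real.sin (L x) * χ x ∂ν = _ from
          h (χ.smoothMul _ (Real.contDiff_sin.comp L.contDiff))]
      rfl
    have hone : ∀ ν : Measure E, (ν.withDensity fun x => ENNReal.ofReal (χ x)).restrict K =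
        ν.restrict K := fun ν => by
      rw [restrict_withDensity hK.measurableSet]
      have : (fun x => ENNReal.ofReal (χ x)) =ᵐ[ν.restrict K] 1 := by
        filter_upwards [ae_restrict_mem hK.measurableSet] with x hx
        simp [hχ.self_of_nhdsSet x hx]
      rw [withDensity_congr_ae this, withDensity_one]
    rw [← hone ν, heq, hone]
  obtain ⟨F, hF, hFW, hU, -⟩ := W.isOpen.exists_iUnion_isClosed
  have hWU : (W : Set E) = ⋃ k : ℕ, ⋃ l : ℕ, F k ∩ Metric.closedBall 0 l := by
    simp only [← Set.inter_iUnion, Metric.iUnion_closedBall_nat, Set.inter_univ, hU]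
  rw [hWU]
  simp only [Measure.restrict_iUnion_congr]
  intro k l
  exact hcompact _ ((isCompact_closedBall _ _).inter_left (hF k))
    (Set.inter_subset_left.trans (hFW k))

/-- Fix one `ψ ≥ 0` with positive Lebesgue integral in the exchange identity; the constant is the
ratio of its two integrals. -/
theorem exists_restrict_eq_smul_restrict (hν : ∀ K, IsCompact K → K ⊆ W → ν K < ⊤)
    (hadd : ∀ x ∈ W, ∀ y ∈ W, x + y ∈ W) (hsmul : ∀ t : ℝ, 0 < t → ∀ x ∈ W, t • x ∈ W)
    (hne : (W : Set E).Nonempty)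
    (hz : ∀ (φ : TestFunction W ℝ ⊤) (v : E), ∫ x, fderiv ℝ φ x v ∂ν = 0) :
    ∃ C : ℝ≥0, ν.restrict W = C • lam.restrict W := by
  obtain ⟨x, hx⟩ := hne
  obtain ⟨ψ, hψ1, hψ0⟩ := exists_testFunction_eq_one_nhds (W := W) (K := {x}) isCompact_singleton
    (by simpa using hx)
  have hpos : 0 < ∫ y, ψ y ∂lam :=
    ψ.continuous.integral_pos_of_hasCompactSupport_nonneg_nonzero ψ.hasCompactSupport hψ0
      (x := x) (by rw [hψ1.self_of_nhdsSet x rfl]; exact one_ne_zero)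
  refine ⟨((∫ y, ψ y ∂ν) / ∫ y, ψ y ∂lam).toNNReal, ?_⟩
  rw [← Measure.restrict_smul]
  refine restrict_eq_of_forall_integral_eq hν (fun K hK _ => ?_) fun φ => ?_
  · rw [Measure.smul_apply]
    exact ENNReal.mul_lt_top ENNReal.coe_lt_top hK.measure_lt_top
  · rw [integral_smul_nnreal_measure]
    have := integral_mul_integral_comm (lam := lam) hν hadd hsmul hz φ ψ
    rw [NNReal.smul_def, Real.coe_toNNReal _ (div_nonneg (integral_nonneg hψ0) hpos.le), smul_eq_mul]
    field_simp
    linarith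

end Cone

/-! ### The generator of Dyson Brownian motion and its reversible measures -/

section Weyl

variable {n : ℕ}

theorem weyl_add {x y : Fin n → ℝ} (hx : x ∈ weyl n) (hy : y ∈ weyl n) : x + y ∈ weyl n :=
  fun _ _ h => add_lt_add (hx h) (hy h)

theorem weyl_smul {t : ℝ} (ht : 0 < t) {x : Fin n → ℝ} (hx : x ∈ weyl n) : t • x ∈ weyl n :=
  fun _ _ h => mul_lt_mul_of_pos_left (hx h) ht

theorem weyl_nonempty : (weyl n : Set (Fin n → ℝ)).Nonempty :=
  ⟨fun i => (i : ℝ), fun i j h => by simpa using h⟩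

theorem sub_ne_zero_of_mem_weyl {x : Fin n → ℝ} (hx : x ∈ weyl n) {i j : Fin n} (h : i ≠ j) :
    x i - x j ≠ 0 :=
  sub_ne_zero.2 fun e => h (StrictMono.injective hx e)

end Weyl

section DysonGen

variable {n : ℕ} {β : ℝ}

theorem Filter.EventuallyEq.dysonGen_eq {f h : (Fin n → ℝ) → ℝ} {x : Fin n → ℝ}
    (hf : f =ᶠ[nhds x] h) : dysonGen n β f x = dysonGen n β h x := by
  unfold dysonGen
  refine Finset.sum_congr rfl fun i _ => ?_
  have : (fun z => fderiv ℝ f z (Pi.single i 1)) =ᶠ[nhds x]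
      fun z => fderiv ℝ h z (Pi.single i 1) :=
    (hf.fderiv (𝕜 := ℝ)).mono fun m' h' => by simp only [h']
  rw [this.fderiv_eq, hf.fderiv_eq]

theorem dysonGen_eq_zero_of_notMem_tsupport {f : (Fin n → ℝ) → ℝ} {x : Fin n → ℝ}
    (hx : x ∉ tsupport f) : dysonGen n β f x = 0 := by
  rw [(notMem_tsupport_iff_eventuallyEq.1 hx).dysonGen_eq]
  have : ∀ z : Fin n → ℝ, fderiv ℝ (0 : (Fin n → ℝ) → ℝ) z = 0 := fun z => fderiv_const_apply 0
  simp [dysonGen, this]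

theorem tsupport_dysonGen_subset (f : (Fin n → ℝ) → ℝ) :
    tsupport (dysonGen n β f) ⊆ tsupport f :=
  closure_minimal (fun _ hx => by_contra fun h => hx (dysonGen_eq_zero_of_notMem_tsupport h))
    (isClosed_tsupport f)

theorem contDiff_fderiv_apply_const {E : Type*} [NormedAddCommGroup E] [NormedSpace ℝ E]
    {f : E → ℝ} (hf : ContDiff ℝ (⊤ : ℕ∞) f) (v : E) :
    ContDiff ℝ (⊤ : ℕ∞) fun x => fderiv ℝ f x v :=
  (hf.fderiv_right (m := (⊤ : ℕ∞)) le_rfl).clm_apply contDiff_const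

theorem contDiffAt_inv_sub {x : Fin n → ℝ} (hx : x ∈ weyl n) {i j : Fin n} (hij : i ≠ j) :
    ContDiffAt ℝ (⊤ : ℕ∞) (fun x : Fin n → ℝ => (x i - x j)⁻¹) x := by
  refine ContDiffAt.inv ?_ (sub_ne_zero_of_mem_weyl hx hij)
  fun_prop

theorem contDiff_of_forall_mem_tsupport {E : Type*} [NormedAddCommGroup E] [NormedSpace ℝ E]
    {f : E → ℝ} {s : Set E} (hs : tsupport f ⊆ s)
    (h : ∀ x ∈ s, ContDiffAt ℝ (⊤ : ℕ∞) f x) : ContDiff ℝ (⊤ : ℕ∞) f := by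
  rw [contDiff_iff_contDiffAt]
  intro x
  by_cases hx : x ∈ tsupport f
  · exact h x (hs hx)
  · exact (contDiffAt_const (c := (0 : ℝ))).congr_of_eventuallyEq
      (notMem_tsupport_iff_eventuallyEq.1 hx)

theorem contDiff_dysonGen (f : WeylTest n) : ContDiff ℝ (⊤ : ℕ∞) (dysonGen n β f) := by
  refine contDiff_of_forall_mem_tsupport
    ((tsupport_dysonGen_subset f).trans f.tsupport_subset) fun x hx => ?_
  unfold dysonGen
  refine ContDiffAt.sum fun i _ => ContDiffAt.add ?_ (contDiffAt_const.mul
    (ContDiffAt.sum fun j hj => ?_))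
  · exact (contDiff_fderiv_apply_const (contDiff_fderiv_apply_const f.contDiff _) _).contDiffAt
  · exact (contDiffAt_inv_sub hx (Finset.mem_erase.1 hj).1.symm).mul
      (contDiff_fderiv_apply_const f.contDiff _).contDiffAt

theorem dysonGen_add {f h : (Fin n → ℝ) → ℝ} (hf : ContDiff ℝ (⊤ : ℕ∞) f)
    (hh : ContDiff ℝ (⊤ : ℕ∞) h) (x : Fin n → ℝ) :
    dysonGen n β (f + h) x = dysonGen n β f x + dysonGen n β h x := by
  have d1 := hf.differentiable (by simp)
  have d2 := hh.differentiable (by simp)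
  have e1 : ∀ v z, fderiv ℝ (f + h) z v = fderiv ℝ f z v + fderiv ℝ h z v := fun v z => by
    rw [fderiv_add (d1 z) (d2 z)]; rfl
  unfold dysonGen
  rw [← Finset.sum_add_distrib]
  refine Finset.sum_congr rfl fun i _ => ?_
  simp only [e1, mul_add, Finset.sum_add_distrib]
  rw [fderiv_fun_add ((contDiff_fderiv_apply_const hf _).differentiable (by simp) x)
    ((contDiff_fderiv_apply_const hh _).differentiable (by simp) x), add_apply]
  ring

theorem dysonGen_smul {f : (Fin n → ℝ) → ℝ} (hf : ContDiff ℝ (⊤ : ℕ∞) f) (c : ℝ)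
    (x : Fin n → ℝ) : dysonGen n β (c • f) x = c * dysonGen n β f x := by
  have d1 := hf.differentiable (by simp)
  have e1 : ∀ v z, fderiv ℝ (c • f) z v = c * fderiv ℝ f z v := fun v z => by
    rw [fderiv_const_smul (d1 z)]; rfl
  unfold dysonGen
  rw [Finset.mul_sum]
  refine Finset.sum_congr rfl fun i _ => ?_
  simp only [e1]
  rw [fderiv_const_mul ((contDiff_fderiv_apply_const hf _).differentiable (by simp) x), smul_apply,
    smul_eq_mul, mul_add, Finset.mul_sum, Finset.mul_sum, Finset.mul_sum]
  congr 1
  exact Finset.sum_congr rfl fun j _ => by ring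

variable (n β) in
/-- The generator of Dyson Brownian motion as an operator on test functions. -/
def dysonOp : WeylTest n →ₗ[ℝ] WeylTest n where
  toFun f := f.ofTsupportSubset (dysonGen n β f) (contDiff_dysonGen f)
    (tsupport_dysonGen_subset f)
  map_add' f h := TestFunction.ext fun x => dysonGen_add f.contDiff h.contDiff x
  map_smul' c f := TestFunction.ext fun x => dysonGen_smul f.contDiff c x

@[simp]
theorem dysonOp_apply (f : WeylTest n) (x : Fin n → ℝ) : dysonOp n β f x = dysonGen n β f x := rfl

namespace SpectralModel

variable {ι κ : Type} [Fintype ι] [DecidableEq ι] [Fintype κ] [DecidableEq κ]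
    {g : ι → ι → ℝ} {M : (ι → ℝ) → Matrix κ κ ℝ} {Q : (ι → ℝ) → ℝ → ℝ}

theorem isSpectralOperator_dysonOp (h : SpectralModel n g M Q β) :
    IsSpectralOperator g M (dysonOp n β) := fun f _ hF _ _ hx =>
  h.diffOp_comp_eigenvalues hF hx
    (f.contDiff.of_le (WithTop.coe_le_coe.2 (le_top : (2 : ℕ∞) ≤ ⊤))).contDiffAt

/-- Every point of the chamber is the spectrum of some matrix of the model, which determines `ℒ f`
there; outside the chamber test functions vanish. -/
theorem eq_dysonOp (h : SpectralModel n g M Q β) {ℒ : WeylTest n →ₗ[ℝ] WeylTest n}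
    (hℒ : IsSpectralOperator g M ℒ) : ℒ = dysonOp n β := by
  classical
  refine LinearMap.ext fun f => TestFunction.ext fun x => ?_
  by_cases hx : x ∈ weyl n
  · obtain ⟨m, hm⟩ := h.surj x hx
    have hl : ListsSpectrum (M m) x := h.listsSpectrum_iff.2 ⟨hx, hm⟩
    -- A concrete extension of `f ∘ x`, by zero; the choice is harmless since the increasing list is
    -- determined by the spectrum.
    have hF : ∀ m x, ListsSpectrum (M m) x →
        (fun m => if hm : ∃ x : Fin n → ℝ, ListsSpectrum (M m) x then f hm.choose else 0) m =
          f x := fun m x hx => by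
      have he : ∃ x : Fin n → ℝ, ListsSpectrum (M m) x := ⟨x, hx⟩
      simp only [dif_pos he]
      congr 1
      exact (StrictMono.range_inj he.choose_spec.1 hx.1).1 (he.choose_spec.2.trans hx.2.symm)
    rw [← hℒ f _ hF m x hl, ← h.isSpectralOperator_dysonOp f _ hF m x hl]
  · rw [image_eq_zero_of_notMem_tsupport fun h' => hx ((ℒ f).tsupport_subset h'),
      image_eq_zero_of_notMem_tsupport fun h' => hx ((dysonOp n β f).tsupport_subset h')]

theorem existsUnique_isSpectralOperator (h : SpectralModel n g M Q β) :
    ∃! ℒ : WeylTest n →ₗ[ℝ] WeylTest n, IsSpectralOperator g M ℒ :=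
  ⟨dysonOp n β, h.isSpectralOperator_dysonOp, fun _ hℒ => h.eq_dysonOp hℒ⟩

end SpectralModel

end DysonGen

/-! ### The Vandermonde weight and the divergence form -/

section Weight

variable {n : ℕ} {k : ℕ}

/-- The squared Vandermonde determinant to the power `k`. -/
def weylWeight (n k : ℕ) (x : Fin n → ℝ) : ℝ := ∏ i, ∏ j ∈ Finset.Ioi i, (x i - x j) ^ (2 * k)

theorem contDiff_weylWeight : ContDiff ℝ (⊤ : ℕ∞) (weylWeight n k) := by
  unfold weylWeight
  refine contDiff_prod fun i _ => contDiff_prod fun j _ => ?_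
  fun_prop

theorem weylWeight_nonneg (x : Fin n → ℝ) : 0 ≤ weylWeight n k x :=
  Finset.prod_nonneg fun i _ => Finset.prod_nonneg fun j _ => by
    rw [pow_mul]; positivity

theorem weylWeight_pos {x : Fin n → ℝ} (hx : x ∈ weyl n) : 0 < weylWeight n k x := by
  refine (weylWeight_nonneg x).lt_of_ne' ?_
  exact Finset.prod_ne_zero_iff.2 fun i _ => Finset.prod_ne_zero_iff.2 fun j hj =>
    pow_ne_zero _ (sub_ne_zero_of_mem_weyl hx (Finset.mem_Ioi.1 hj).ne)

/-- Logarithmic derivatives `L a` add under products; stated this way no division by `f a` is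
needed. -/
theorem hasFDerivAt_prod_of_logDeriv {E ι : Type*} [NormedAddCommGroup E] [NormedSpace ℝ E]
    {s : Finset ι} {f : ι → E → ℝ} {L : ι → E →L[ℝ] ℝ} {x : E}
    (h : ∀ a ∈ s, HasFDerivAt (f a) (f a x • L a) x) :
    HasFDerivAt (fun y => ∏ a ∈ s, f a y) ((∏ a ∈ s, f a x) • ∑ a ∈ s, L a) x := by
  classical
  induction s using Finset.induction_on with
  | empty => simpa using hasFDerivAt_const (1 : ℝ) x
  | insert a s ha ih =>
    have h1 := h a (Finset.mem_insert_self a s)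
    have h2 := ih fun b hb => h b (Finset.mem_insert_of_mem hb)
    simp only [Finset.prod_insert ha, Finset.sum_insert ha]
    refine (h1.fun_mul h2).congr_fderiv ?_
    ext v
    simp
    ring

/-- The derivative in direction `l` sees only the pairs containing `l`; antisymmetry of `c` gives
the pairs `i < l` the same form as the pairs `l < j`. -/
theorem sum_Ioi_sub_eq_sum_erase (c : Fin n → Fin n → ℝ) (hc : ∀ i j, c j i = -c i j)
    (l : Fin n) :
    ∑ i, ∑ j ∈ Finset.Ioi i, c i j * ((if i = l then 1 else 0) - if j = l then 1 else 0) =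
      ∑ j ∈ Finset.univ.erase l, c l j := by
  have h1 : ∀ i : Fin n, Finset.Ioi i = Finset.univ.filter fun j => i < j := fun i => by
    ext; simp
  have h2 : Finset.univ.erase l = Finset.univ.filter fun j => j ≠ l := by ext; simp
  simp only [h1, h2, Finset.sum_filter, mul_sub, mul_ite, mul_one, mul_zero]
  have h3 : ∀ i j : Fin n, (if i < j then (if i = l then c i j else 0) -
      (if j = l then c i j else 0) else 0) = (if i = l then (if i < j then c i j else 0) else 0) -
        if j = l then (if i < j then c i j else 0) else 0 := fun i j => by
    split_ifs <;> simp
  simp only [h3, Finset.sum_sub_distrib]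
  rw [Finset.sum_comm]
  simp only [Finset.sum_ite_eq', Finset.mem_univ, if_true]
  rw [← Finset.sum_sub_distrib]
  refine Finset.sum_congr rfl fun j _ => ?_
  rcases lt_trichotomy l j with h | h | h
  · simp [h, h.not_gt, h.ne']
  · simp [h]
  · simp [h, h.not_gt, h.ne, hc l j]

theorem fderiv_weylWeight {x : Fin n → ℝ} (hx : x ∈ weyl n) (l : Fin n) :
    fderiv ℝ (weylWeight n k) x (Pi.single l 1) =
      weylWeight n k x * ((2 * k : ℕ) * ∑ j ∈ Finset.univ.erase l, (x l - x j)⁻¹) := by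
  have h1 : ∀ i : Fin n, ∀ j ∈ Finset.Ioi i,
      HasFDerivAt (fun x : Fin n → ℝ => (x i - x j) ^ (2 * k))
        ((x i - x j) ^ (2 * k) • (((2 * k : ℕ) : ℝ) * (x i - x j)⁻¹) •
          (ContinuousLinearMap.proj (R := ℝ) (φ := fun _ : Fin n => ℝ) i -
            ContinuousLinearMap.proj (R := ℝ) (φ := fun _ : Fin n => ℝ) j)) x := fun i j hj => by
    have hne := sub_ne_zero_of_mem_weyl hx (Finset.mem_Ioi.1 hj).ne
    refine ((((hasFDerivAt_apply i x).sub (hasFDerivAt_apply j x)).pow (2 * k))).congr_fderiv ?_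
    ext v
    rcases Nat.eq_zero_or_pos (2 * k) with h0 | h0
    · simp [h0]
    · obtain ⟨r, hr⟩ := Nat.exists_eq_add_of_le' h0
      rw [hr]
      simp
      field_simp
      ring
  have h2 := hasFDerivAt_prod_of_logDeriv (s := Finset.univ) fun i _ =>
    hasFDerivAt_prod_of_logDeriv (h1 i)
  have h3 : fderiv ℝ (weylWeight n k) x = _ := h2.fderiv
  rw [h3, smul_apply, smul_eq_mul]
  congr 1
  simp only [sum_apply, smul_apply, sub_apply, ContinuousLinearMap.proj_apply, smul_eq_mul,
    Pi.single_apply]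
  rw [sum_Ioi_sub_eq_sum_erase (fun i j => ((2 * k : ℕ) : ℝ) * (x i - x j)⁻¹), Finset.mul_sum]
  intro i j
  rw [← neg_sub, inv_neg, mul_neg]

/-- The drift is `∇ log w`, so `w ℒ h = ∑ ∂_i (w ∂_i h)`. Outside the chamber, where the drift is
not controlled, both sides vanish with `h`. -/
theorem weylWeight_mul_dysonGen (h : WeylTest n) (x : Fin n → ℝ) :
    weylWeight n k x * dysonGen n (2 * k : ℕ) h x = ∑ i, fderiv ℝ (fun z =>
      weylWeight n k z * fderiv ℝ h z (Pi.single i 1)) x (Pi.single i 1) := by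
  have d1 : DifferentiableAt ℝ (weylWeight n k) x :=
    contDiff_weylWeight.differentiable (by simp) x
  have d2 := fun v => (contDiff_fderiv_apply_const h.contDiff v).differentiable (by simp) x
  simp only [fderiv_fun_mul d1 (d2 _)]
  by_cases hx : x ∈ weyl n
  · simp only [add_apply, smul_apply, fderiv_weylWeight hx, smul_eq_mul, dysonGen,
      Finset.mul_sum (s := Finset.univ)]
    refine Finset.sum_congr rfl fun i _ => ?_
    rw [← Finset.sum_mul]
    ring
  · have hx' : x ∉ tsupport h := fun h' => hx (h.tsupport_subset h')
    have hx1 : ∀ v, fderiv ℝ h x v = 0 := fun v => by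
      rw [image_eq_zero_of_notMem_tsupport fun h' => hx' (tsupport_fderiv_subset ℝ h')]; rfl
    have hx2 : ∀ v, fderiv ℝ (fun z => fderiv ℝ h z v) x = 0 := fun v =>
      image_eq_zero_of_notMem_tsupport fun h' => hx' (tsupport_fderiv_apply_subset ℝ v
        (tsupport_fderiv_subset ℝ h'))
    rw [dysonGen_eq_zero_of_notMem_tsupport hx']
    simp [hx1, hx2]

end Weight

/-! ### Reversible measures of the Dyson generator -/

section Reversible

variable {n : ℕ} {k : ℕ} {μ : Measure (Fin n → ℝ)}

theorem setIntegral_of_hasWeylDensity {C : ℝ≥0}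
    (hμ : HasWeylDensity μ fun x => C * weylWeight n k x) {u : (Fin n → ℝ) → ℝ}
    (hu : ∀ x, x ∉ weyl n → u x = 0) :
    ∫ x in (weyl n : Set (Fin n → ℝ)), u x ∂μ = C * ∫ x, u x * weylWeight n k x := by
  have hm : Measurable (weylWeight n k) := contDiff_weylWeight.continuous.measurable
  have hμ' : μ.restrict (weyl n : Set (Fin n → ℝ)) = _ := hμ
  rw [hμ', integral_withDensity_eq_integral_toReal_smul (by fun_prop)
      (Filter.Eventually.of_forall fun x => ENNReal.ofReal_lt_top),
    setIntegral_eq_integral_of_forall_compl_eq_zero fun x hx => by rw [hu x hx, smul_zero],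
    ← integral_const_mul]
  congr 1
  ext x
  change (ENNReal.ofReal (C * weylWeight n k x)).toReal • u x = _
  rw [ENNReal.toReal_ofReal (mul_nonneg C.coe_nonneg (weylWeight_nonneg x)), smul_eq_mul]
  ring

/-- Integration by parts in divergence form. The result is the Dirichlet form, symmetric in `f` and
`h` and free of the constant `c`. -/
theorem integral_mul_dysonGen (f h : WeylTest n) (c : ℝ) :
    ∫ x, (f x + c) * dysonGen n (2 * k : ℕ) h x * weylWeight n k x =
      -∑ i, ∫ x, fderiv ℝ f x (Pi.single i 1) * (weylWeight n k x *
        fderiv ℝ h x (Pi.single i 1)) := by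
  have hf := f.contDiff
  have hw : ContDiff ℝ (⊤ : ℕ∞) (weylWeight n k) := contDiff_weylWeight
  have hg : ∀ i : Fin n, ContDiff ℝ (⊤ : ℕ∞)
      (fun z => weylWeight n k z * fderiv ℝ h z (Pi.single i 1)) := fun i =>
    hw.mul (contDiff_fderiv_apply_const h.contDiff _)
  have hgs : ∀ i : Fin n, HasCompactSupport
      (fun z => weylWeight n k z * fderiv ℝ h z (Pi.single i 1)) := fun i =>
    (h.hasCompactSupport.fderiv_apply (𝕜 := ℝ) _).mul_left
  have cf' := fun i : Fin n => (contDiff_fderiv_apply_const hf (Pi.single i 1)).continuous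
  have cg' := fun i : Fin n => (contDiff_fderiv_apply_const (hg i) (Pi.single i 1)).continuous
  have i1 : ∀ i : Fin n, Integrable fun x => (f x + c) * fderiv ℝ (fun z => weylWeight n k z *
      fderiv ℝ h z (Pi.single i 1)) x (Pi.single i 1) := fun i =>
    ((f.continuous.add continuous_const).mul (cg' i)).integrable_of_hasCompactSupport
      ((hgs i).fderiv_apply (𝕜 := ℝ) _).mul_left
  have e1 : ∀ x, (f x + c) * dysonGen n (2 * k : ℕ) h x * weylWeight n k x =
      ∑ i, (f x + c) * fderiv ℝ (fun z => weylWeight n k z *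
        fderiv ℝ h z (Pi.single i 1)) x (Pi.single i 1) := fun x => by
    rw [← Finset.mul_sum, ← weylWeight_mul_dysonGen]
    ring
  have hf' : ∀ x, fderiv ℝ (fun x => f x + c) x = fderiv ℝ f x := fun x => fderiv_add_const c
  simp only [e1]
  rw [integral_finsetSum _ fun i _ => i1 i, ← Finset.sum_neg_distrib]
  refine Finset.sum_congr rfl fun i _ => ?_
  rw [integral_mul_fderiv_eq_neg_fderiv_mul_of_integrable _ (i1 i)]
  · simp only [hf']
  · exact ((f.continuous.add continuous_const).mul
      (hg i).continuous).integrable_of_hasCompactSupport (hgs i).mul_left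
  · exact fun x _ => (hf.differentiable (by simp) x).add_const c
  · exact fun x _ => (hg i).differentiable (by simp) x
  · simp only [hf']
    exact ((cf' i).mul (hg i).continuous).integrable_of_hasCompactSupport (hgs i).mul_left

theorem isReversible_dysonOp_of_hasWeylDensity {C : ℝ≥0}
    (hμ : HasWeylDensity μ fun x => C * weylWeight n k x) :
    IsReversible (dysonOp n (2 * k : ℕ)) μ := by
  intro f h c d
  have hz : ∀ f : WeylTest n, ∀ x, x ∉ weyl n → dysonGen n (2 * k : ℕ) f x = 0 := fun f x hx =>
    dysonGen_eq_zero_of_notMem_tsupport fun h' => hx (f.tsupport_subset h')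
  simp only [dysonOp_apply]
  rw [setIntegral_of_hasWeylDensity hμ fun x hx => by rw [hz h x hx, mul_zero],
    setIntegral_of_hasWeylDensity hμ fun x hx => by rw [hz f x hx, mul_zero],
    integral_mul_dysonGen, integral_mul_dysonGen]
  congr 2
  refine Finset.sum_congr rfl fun i _ => integral_congr_ae (Filter.Eventually.of_forall fun x => ?_)
  ring

/-- Leibniz rule, with `ℒ x_i = β ∑ 1/(x_i - x_j)` and `Γ(x_i, f) = ∂_i f`. -/
theorem dysonGen_coord_mul {β : ℝ} {f : (Fin n → ℝ) → ℝ} (hf : ContDiff ℝ (⊤ : ℕ∞) f) (i : Fin n)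
    (x : Fin n → ℝ) :
    dysonGen n β (fun z => z i * f z) x = x i * dysonGen n β f x +
      f x * (β * ∑ j ∈ Finset.univ.erase i, (x i - x j)⁻¹) +
        2 * fderiv ℝ f x (Pi.single i 1) := by
  have hc : ContDiff ℝ (⊤ : ℕ∞) fun z : Fin n → ℝ => z i := contDiff_apply ℝ ℝ i
  have hle : (2 : WithTop ℕ∞) ≤ (⊤ : ℕ∞) := WithTop.coe_le_coe.2 (le_top : (2 : ℕ∞) ≤ ⊤)
  have hd : ∀ z v, fderiv ℝ (fun z : Fin n → ℝ => z i) z v = v i := fun z v => by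
    rw [(hasFDerivAt_apply i z).fderiv]; rfl
  have h1 : ∀ v, fderiv ℝ (fun z => z i * f z) x v = x i * fderiv ℝ f x v + f x * v i :=
    fun v => by
      rw [fderiv_fun_mul (hc.differentiable (by simp) x) (hf.differentiable (by simp) x)]
      simp [hd]
  unfold dysonGen
  simp only [fderiv_fderiv_mul (hc.of_le hle).contDiffAt (hf.of_le hle).contDiffAt, h1, hd]
  have h2 : ∀ l : Fin n, x i * fderiv ℝ (fun m' => fderiv ℝ f m' (Pi.single l 1)) x
        (Pi.single l 1) + f x * fderiv ℝ (fun _ => (Pi.single l (1 : ℝ) : Fin n → ℝ) i) x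
        (Pi.single l 1) + (Pi.single l (1 : ℝ) : Fin n → ℝ) i * fderiv ℝ f x (Pi.single l 1) +
        (Pi.single l (1 : ℝ) : Fin n → ℝ) i * fderiv ℝ f x (Pi.single l 1) +
      β * ∑ j ∈ Finset.univ.erase l, (x l - x j)⁻¹ * (x i * fderiv ℝ f x (Pi.single l 1) +
        f x * (Pi.single l (1 : ℝ) : Fin n → ℝ) i) =
      x i * (fderiv ℝ (fun m' => fderiv ℝ f m' (Pi.single l 1)) x (Pi.single l 1) +
        β * ∑ j ∈ Finset.univ.erase l, (x l - x j)⁻¹ * fderiv ℝ f x (Pi.single l 1)) +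
      if i = l then (f x * (β * ∑ j ∈ Finset.univ.erase i, (x i - x j)⁻¹) +
        2 * fderiv ℝ f x (Pi.single i 1)) else 0 := fun l => by
    simp only [← Finset.sum_mul]
    by_cases h : i = l
    · subst h
      simp
      ring
    · simp [h]
      ring
  simp only [h2]
  rw [Finset.sum_add_distrib, ← Finset.mul_sum, Finset.sum_ite_eq, if_pos (Finset.mem_univ i)]
  ring

/-- Put `f = φ / w` and `b = ℒ x_i`. Reversibility gives `∫ x_i ℒ f = ∫ f b` and, against the
constant 1, `∫ ℒ(x_i f) = 0`. The Leibniz rule turns this into `∫ (f b + ∂_i f) dμ = 0`, and the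
integrand is `w⁻¹ ∂_i (w f) = w⁻¹ ∂_i φ`. -/
theorem setIntegral_fderiv_div_weylWeight (hμ : IsRadonOnWeyl μ)
    (hr : IsReversible (dysonOp n (2 * k : ℕ)) μ) (φ : WeylTest n) (i : Fin n) :
    ∫ x in (weyl n : Set (Fin n → ℝ)),
      (weylWeight n k x)⁻¹ * fderiv ℝ φ x (Pi.single i 1) ∂μ = 0 := by
  set W : Set (Fin n → ℝ) := (weyl n : Set (Fin n → ℝ)) with hW
  have hwd : ContDiff ℝ (⊤ : ℕ∞) (weylWeight n k) := contDiff_weylWeight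
  have hsup : tsupport (fun x => (weylWeight n k x)⁻¹ * φ x) ⊆ tsupport φ :=
    tsupport_mul_subset_right
  let f : WeylTest n := φ.ofTsupportSubset (fun x => (weylWeight n k x)⁻¹ * φ x)
    (contDiff_of_forall_mem_tsupport (hsup.trans φ.tsupport_subset) fun x hx =>
      (hwd.contDiffAt.inv (weylWeight_pos hx).ne').mul φ.contDiff.contDiffAt) hsup
  have hc : ContDiff ℝ (⊤ : ℕ∞) fun z : Fin n → ℝ => z i := contDiff_apply ℝ ℝ i
  let p : WeylTest n := f.smoothMul (fun z => z i) hc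
  -- The coordinate `x_i` is not a test function; a cutoff equal to 1 near the support of `f`
  -- replaces it by `h` without changing the integrals.
  obtain ⟨χ, hχ, -⟩ := exists_testFunction_eq_one_nhds (W := weyl n)
    f.hasCompactSupport.isCompact f.tsupport_subset
  let h : WeylTest n := χ.smoothMul (fun z => z i) hc
  have hint : ∀ u : WeylTest n, Integrable u (μ.restrict W) := fun u =>
    integrable_of_hasCompactSupport_of_tsupport_subset (W := weyl n)
      (fun K hK hKW => (Measure.restrict_apply_le _ _).trans_lt (hμ K hK hKW))
      u.continuous u.hasCompactSupport u.tsupport_subset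
  have hbd : ∀ x ∈ W, f x * ((2 * k : ℕ) * ∑ j ∈ Finset.univ.erase i, (x i - x j)⁻¹) +
      fderiv ℝ f x (Pi.single i 1) = (weylWeight n k x)⁻¹ * fderiv ℝ φ x (Pi.single i 1) :=
    fun x hx => by
      have hpos : weylWeight n k x ≠ 0 := (weylWeight_pos hx).ne'
      have e : φ =ᶠ[nhds x] fun z => weylWeight n k z * f z := by
        filter_upwards [(weyl n).isOpen.mem_nhds hx] with z hz
        exact (mul_inv_cancel_left₀ (weylWeight_pos hz).ne' _).symm
      rw [e.fderiv_eq, fderiv_fun_mul (hwd.differentiable (by simp) x)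
        (f.contDiff.differentiable (by simp) x)]
      simp only [add_apply, smul_apply, smul_eq_mul, fderiv_weylWeight hx]
      field_simp
      ring
  have hp : ∀ x, dysonGen n (2 * k : ℕ) p x = _ := fun x => dysonGen_coord_mul f.contDiff i x
  have hh : ∀ x, f x * dysonGen n (2 * k : ℕ) h x =
      f x * ((2 * k : ℕ) * ∑ j ∈ Finset.univ.erase i, (x i - x j)⁻¹) := fun x => by
    by_cases hx : x ∈ tsupport f
    · have e : h =ᶠ[nhds x] fun z => z i * 1 := by
        filter_upwards [hχ.filter_mono (nhds_le_nhdsSet hx)] with z hz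
        change z i * χ z = _
        rw [hz]
      rw [e.dysonGen_eq, dysonGen_coord_mul contDiff_const]
      simp [dysonGen]
    · rw [image_eq_zero_of_notMem_tsupport hx, zero_mul, zero_mul]
  have hh' : ∀ x, h x * dysonGen n (2 * k : ℕ) f x = x i * dysonGen n (2 * k : ℕ) f x := fun x => by
    by_cases hx : x ∈ tsupport f
    · change x i * χ x * _ = _
      rw [hχ.self_of_nhdsSet x hx, mul_one]
    · rw [dysonGen_eq_zero_of_notMem_tsupport hx, mul_zero, mul_zero]
  have r1 := hr f h 0 0
  have r2 := hr 0 p 1 0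
  -- Now `r1` reads `∫ f b = ∫ x_i ℒ f`, and `r2` is the vanishing of `∫ ℒ(x_i f)`, obtained from
  -- the constant function 1.
  simp only [dysonOp_apply, add_zero, hh, hh', map_zero, FunLike.coe_zero, Pi.zero_apply, zero_add,
    one_mul, mul_zero, integral_zero, hp] at r1 r2
  have hi1 : Integrable (fun x => x i * dysonGen n (2 * k : ℕ) f x) (μ.restrict W) :=
    hint ((dysonOp n (2 * k : ℕ) f).smoothMul _ hc)
  have hi2 : Integrable (fun x => f x * ((2 * k : ℕ) *
      ∑ j ∈ Finset.univ.erase i, (x i - x j)⁻¹)) (μ.restrict W) := by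
    simp only [← hh]
    exact hint ((dysonOp n (2 * k : ℕ) h).smoothMul _ f.contDiff)
  have hi3 : Integrable (fun x => fderiv ℝ f x (Pi.single i 1)) (μ.restrict W) :=
    hint (f.ofTsupportSubset _ (contDiff_fderiv_apply_const f.contDiff _)
      (tsupport_fderiv_apply_subset ℝ _))
  have hi12 : Integrable (fun x => x i * dysonGen n (2 * k : ℕ) f x + f x * ((2 * k : ℕ) *
      ∑ j ∈ Finset.univ.erase i, (x i - x j)⁻¹)) (μ.restrict W) := hi1.add hi2
  rw [integral_add hi12 (hi3.const_mul 2), integral_add hi1 hi2, integral_const_mul] at r2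
  rw [← setIntegral_congr_fun (weyl n).isOpen.measurableSet hbd, integral_add hi2 hi3]
  linarith

theorem hasWeylDensity_of_isReversible_dysonOp (hμ : IsRadonOnWeyl μ)
    (hr : IsReversible (dysonOp n (2 * k : ℕ)) μ) :
    ∃ C : ℝ≥0, HasWeylDensity μ fun x => C * weylWeight n k x := by
  set W : Set (Fin n → ℝ) := (weyl n : Set (Fin n → ℝ)) with hW
  have hWm : MeasurableSet W := (weyl n).isOpen.measurableSet
  have hm : Measurable (weylWeight n k) := contDiff_weylWeight.continuous.measurable
  -- The candidate multiple of Lebesgue measure is `μ / w`; it is locally finite because `w` is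
  -- continuous and positive on the chamber.
  set ν : Measure (Fin n → ℝ) :=
    (μ.restrict W).withDensity fun x => ENNReal.ofReal (weylWeight n k x)⁻¹ with hνdef
  have hν : ∀ K, IsCompact K → K ⊆ (weyl n : Set (Fin n → ℝ)) → ν K < ⊤ := fun K hK hKW => by
    rw [hνdef, withDensity_apply _ hK.measurableSet]
    have hco : ContinuousOn (fun x => (weylWeight n k x)⁻¹) K :=
      contDiff_weylWeight.continuous.continuousOn.inv₀ fun x hx => (weylWeight_pos (hKW hx)).ne'
    obtain ⟨B, hB⟩ := (hK.image_of_continuousOn hco).bddAbove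
    refine setLIntegral_lt_top_of_le_nnreal
      ((Measure.restrict_apply_le _ _).trans_lt (hμ K hK hKW)).ne ⟨B.toNNReal, fun x hx => ?_⟩
    exact ENNReal.ofReal_le_ofReal (hB ⟨x, hx, rfl⟩)
  have hz : ∀ (φ : WeylTest n) (v : Fin n → ℝ), ∫ x, fderiv ℝ φ x v ∂ν = 0 := fun φ v => by
    have h1 : ∀ i, Integrable (fun x => fderiv ℝ φ x (Pi.single i 1) * v i) ν := fun i =>
      (integrable_of_hasCompactSupport_of_tsupport_subset hν
        (contDiff_fderiv_apply_const φ.contDiff _).continuous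
        (φ.hasCompactSupport.fderiv_apply (𝕜 := ℝ) _)
        ((tsupport_fderiv_apply_subset ℝ _).trans φ.tsupport_subset)).mul_const _
    simp only [fun x => fderiv_eq_sum_single (fderiv ℝ φ x) v]
    rw [integral_finsetSum _ fun i _ => h1 i]
    refine Finset.sum_eq_zero fun i _ => ?_
    rw [integral_mul_const, hνdef,
      integral_withDensity_eq_integral_toReal_smul (by fun_prop) (by simp)]
    have := setIntegral_fderiv_div_weylWeight hμ hr φ i
    simp only [ENNReal.toReal_ofReal (inv_nonneg.2 (weylWeight_nonneg _)), smul_eq_mul]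
    rw [this, zero_mul]
  obtain ⟨C, hC⟩ := exists_restrict_eq_smul_restrict (lam := (volume : Measure (Fin n → ℝ))) hν
    (fun _ hx _ hy => weyl_add hx hy) (fun _ ht _ hx => weyl_smul ht hx) weyl_nonempty hz
  refine ⟨C, ?_⟩
  have hνW : ν.restrict W = ν := by
    rw [hνdef, restrict_withDensity hWm, Measure.restrict_restrict hWm, Set.inter_self]
  have h1 : μ.restrict W = ν.withDensity fun x => ENNReal.ofReal (weylWeight n k x) := by
    rw [hνdef, ← withDensity_mul _ (by fun_prop) (by fun_prop)]
    have : ((fun x => ENNReal.ofReal (weylWeight n k x)⁻¹) *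
        fun x => ENNReal.ofReal (weylWeight n k x)) =ᵐ[μ.restrict W] 1 := by
      filter_upwards [ae_restrict_mem hWm] with x hx
      have hpos : 0 < weylWeight n k x := weylWeight_pos hx
      rw [Pi.mul_apply, ← ENNReal.ofReal_mul (inv_nonneg.2 hpos.le), inv_mul_cancel₀ hpos.ne']
      simp
    rw [withDensity_congr_ae this, withDensity_one]
  unfold HasWeylDensity
  rw [← hW, h1, ← hνW, hC]
  ext s hs
  rw [withDensity_apply _ hs, withDensity_apply _ hs, Measure.restrict_smul,
    show (C • (volume.restrict W).restrict s) = (C : ℝ≥0∞) • (volume.restrict W).restrict s from rfl,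
    lintegral_smul_measure, smul_eq_mul, ← lintegral_const_mul _ (by fun_prop)]
  refine lintegral_congr fun x => ?_
  rw [ENNReal.ofReal_mul C.coe_nonneg, ENNReal.ofReal_coe_nnreal]

theorem isReversible_dysonOp_iff (hμ : IsRadonOnWeyl μ) :
    IsReversible (dysonOp n (2 * k : ℕ)) μ ↔
      ∃ C : ℝ≥0, HasWeylDensity μ fun x => C * weylWeight n k x :=
  ⟨hasWeylDensity_of_isReversible_dysonOp hμ, fun ⟨_, hC⟩ =>
    isReversible_dysonOp_of_hasWeylDensity hC⟩

end Reversible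

/-! ### Determinants of octonionic matrices -/

section Octonions

theorem octTable_symmDiff_comm : ∀ p q : Finset (Fin 3), p ≠ q →
    octTable (octPos (symmDiff q p)) (octPos p) = -octTable (octPos (symmDiff p q)) (octPos q) := by
  decide +kernel

/-- This sign cancellation, a finite check, is what remains of the octonion algebra: it pairs `q`
with `p ∆ q ∆ s` in an off-diagonal entry of a square. -/
theorem octTable_mul_add_mul : ∀ p q s : Finset (Fin 3), p ≠ q → q ≠ s → p ≠ s →
    octTable (octPos (symmDiff p q)) (octPos q) * octTable (octPos (symmDiff q s)) (octPos s) +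
      octTable (octPos (symmDiff q s)) (octPos (symmDiff (symmDiff p q) s)) *
        octTable (octPos (symmDiff p q)) (octPos s) = 0 := by
  decide +kernel

theorem octTable_mul_self : ∀ p q : Finset (Fin 3),
    octTable (octPos p) (octPos q) * octTable (octPos p) (octPos q) = 1 := by
  decide +kernel

theorem octTable_empty : ∀ q : Finset (Fin 3), octTable (octPos ∅) (octPos q) = 1 := by
  decide +kernel

theorem octSign_empty (q : Finset (Fin 3)) : octSign ∅ q = 1 := by
  unfold octSign; rw [octTable_empty]; simp

/-- The matrix of left multiplication by the imaginary octonion `∑_{C ≠ ∅} z C ω_C`. -/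
def octIm (z : Finset (Fin 3) → ℝ) : Matrix (Finset (Fin 3)) (Finset (Fin 3)) ℝ :=
  Matrix.of fun p q => if p = q then 0 else octSign (symmDiff p q) q * z (symmDiff p q)

theorem octIm_apply_comm (z : Finset (Fin 3) → ℝ) (p q : Finset (Fin 3)) :
    octIm z q p = -octIm z p q := by
  simp only [octIm, Matrix.of_apply]
  by_cases h : p = q
  · simp [h]
  · rw [if_neg h, if_neg (Ne.symm h), symmDiff_comm q p, octSign, octSign]
    have := octTable_symmDiff_comm p q h
    rw [symmDiff_comm q p] at this
    rw [this]
    push_cast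
    ring

theorem octIm_transpose (z : Finset (Fin 3) → ℝ) : (octIm z).transpose = -octIm z := by
  ext p q
  exact octIm_apply_comm z p q

/-- On the diagonal, antisymmetry gives minus the sum of squares. Off the diagonal, the involution
`q ↦ p ∆ q ∆ s` pairs terms of opposite sign, so the entry equals its own negative. -/
theorem octIm_mul_self (z : Finset (Fin 3) → ℝ) :
    octIm z * octIm z = -(∑ C ∈ Finset.univ.erase ∅, z C ^ 2) • 1 := by
  ext p s
  rw [Matrix.mul_apply, Matrix.smul_apply, Matrix.one_apply]
  by_cases hps : p = s
  · subst hps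
    have h1 : ∀ q, octIm z p q * octIm z q p =
        -(fun C => if C = ∅ then 0 else z C ^ 2) (symmDiff p q) := fun q => by
      rw [octIm_apply_comm z p q]
      simp only [octIm, Matrix.of_apply]
      by_cases h : p = q
      · simp [h]
      · have h2 : symmDiff p q ≠ ∅ := fun e => h (symmDiff_eq_bot.1 e)
        have h3 : octSign (symmDiff p q) q * octSign (symmDiff p q) q = 1 := by
          unfold octSign; exact_mod_cast octTable_mul_self _ _
        rw [if_neg h, if_neg h2]
        linear_combination -(z (symmDiff p q)) ^ 2 * h3
    have h4 : ∑ q, (fun C => if C = ∅ then 0 else z C ^ 2) (symmDiff p q) =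
        ∑ C ∈ Finset.univ.erase ∅, z C ^ 2 := by
      refine (Equiv.sum_comp (Function.Involutive.toPerm (symmDiff p)
        (symmDiff_symmDiff_cancel_left p)) (fun C => if C = ∅ then 0 else z C ^ 2)).trans ?_
      rw [← Finset.sum_erase_add _ _ (Finset.mem_univ (∅ : Finset (Fin 3))), if_pos rfl, add_zero]
      exact Finset.sum_congr rfl fun C hC => if_neg (Finset.mem_erase.1 hC).1
    simp only [h1, Finset.sum_neg_distrib]
    rw [h4]
    simp
  · rw [if_neg hps, smul_zero]
    have hinv : Function.Involutive fun q : Finset (Fin 3) => symmDiff (symmDiff p q) s := fun q => by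
      ext a; simp [Finset.mem_symmDiff]; tauto
    set σ := Function.Involutive.toPerm _ hinv with hσ
    have h1 := Equiv.sum_comp σ fun q => octIm z p q * octIm z q s
    have h2 : ∀ q, octIm z p q * octIm z q s + octIm z p (σ q) *
        octIm z (σ q) s = 0 := fun q => by
      have e1 : symmDiff p (symmDiff (symmDiff p q) s) = symmDiff q s := by
        rw [symmDiff_assoc, symmDiff_symmDiff_cancel_left]
      have e2 : symmDiff (symmDiff (symmDiff p q) s) s = symmDiff p q := by
        rw [symmDiff_symmDiff_cancel_right]
      have e3 : p = symmDiff (symmDiff p q) s ↔ q = s := by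
        rw [← symmDiff_eq_bot (a := q), ← e1, symmDiff_eq_bot]
      have e4 : symmDiff (symmDiff p q) s = s ↔ p = q := by
        rw [← symmDiff_eq_bot, e2, symmDiff_eq_bot]
      change _ + octIm z p (symmDiff (symmDiff p q) s) * octIm z (symmDiff (symmDiff p q) s) s = 0
      simp only [octIm, Matrix.of_apply, e1, e2, e3, e4]
      by_cases hpq : p = q
      · simp [hpq]
      by_cases hqs : q = s
      · simp [hqs]
      simp only [if_neg hpq, if_neg hqs]
      have h3 : octSign (symmDiff p q) q * octSign (symmDiff q s) s +
          octSign (symmDiff q s) (symmDiff (symmDiff p q) s) * octSign (symmDiff p q) s = 0 := by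
        unfold octSign; exact_mod_cast octTable_mul_add_mul p q s hpq hqs hps
      linear_combination z (symmDiff p q) * z (symmDiff q s) * h3
    have h3 : (∑ q, octIm z p q * octIm z q s) + ∑ q, octIm z p q * octIm z q s = 0 := by
      nth_rw 2 [← h1]
      rw [← Finset.sum_add_distrib]
      exact Finset.sum_eq_zero fun q _ => h2 q
    linarith

open scoped Kronecker in
theorem octReal_eq_kronecker {n : ℕ} (S A : Matrix (Fin n) (Fin n) ℝ) (z : Finset (Fin 3) → ℝ) :
    octReal (fun C => if C = ∅ then S else z C • A) =
      (1 : Matrix (Finset (Fin 3)) (Finset (Fin 3)) ℝ) ⊗ₖ S + octIm z ⊗ₖ A := by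
  ext ⟨p, i⟩ ⟨q, j⟩
  simp only [octReal, Matrix.of_apply, Matrix.add_apply, Matrix.kroneckerMap_apply, octIm,
    Matrix.one_apply]
  by_cases h : p = q
  · subst h
    simp [octSign_empty]
  · have : symmDiff p q ≠ ∅ := fun e => h (symmDiff_eq_bot.1 e)
    simp [h, this]
    ring

end Octonions

/-! ### Splitting a Kronecker sum into complex blocks -/

section Determinant

open scoped Kronecker

theorem det_one_kronecker_add_diagonal_kronecker {R σ τ : Type*} [CommRing R] [Fintype σ]
    [DecidableEq σ] [Fintype τ] [DecidableEq τ] (B A : Matrix τ τ R) (d : σ → R) :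
    ((1 : Matrix σ σ R) ⊗ₖ B + Matrix.diagonal d ⊗ₖ A).det = ∏ k, (B + d k • A).det := by
  rw [← Matrix.det_blockDiagonal, ← Matrix.det_submatrix_equiv_self (Equiv.prodComm τ σ)]
  congr 1
  ext ⟨i, k⟩ ⟨j, l⟩
  by_cases h : k = l
  · simp [Matrix.blockDiagonal_apply, h]
  · simp [Matrix.blockDiagonal_apply, h]

/-- Left multiplication by `T` on the first factor has square `-r²`, so that `1 ⊗ B + T ⊗ A` splits
into blocks `B ± i r A`, which are transposes of each other. -/
theorem det_one_kronecker_add_kronecker {σ τ : Type*} [Fintype σ]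
    [DecidableEq σ] [Fintype τ] [DecidableEq τ] {B A : Matrix τ τ ℂ} (hB : B.transpose = B)
    (hA : A.transpose = -A) {T : Matrix σ σ ℝ} (hT : T.transpose = -T) {r : ℝ}
    (hTr : T * T = -(r ^ 2) • 1) :
    ((1 : Matrix σ σ ℂ) ⊗ₖ B + T.map Complex.ofReal ⊗ₖ A).det =
      (B + (Complex.I * r) • A).det ^ Fintype.card σ := by
  -- `i T` is Hermitian with square `r²`, so it is unitarily diagonalisable with eigenvalues `±r`.
  set N : Matrix σ σ ℂ := Complex.I • T.map Complex.ofReal with hN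
  have hH : N.IsHermitian := by
    ext p q
    have : T q p = -T p q := congrFun (congrFun hT p) q
    simp [hN, Matrix.conjTranspose_apply, this]
  have hNN : N * N = ((r ^ 2 : ℝ) : ℂ) • 1 := by
    have h1 : T.map Complex.ofReal * T.map Complex.ofReal =
        (T * T).map (Complex.ofRealHom : ℝ →+* ℂ) := (Matrix.map_mul (f := Complex.ofRealHom)).symm
    rw [hN, Matrix.smul_mul, Matrix.mul_smul, h1, hTr, smul_smul, Complex.I_mul_I]
    ext p q
    by_cases h : p = q <;> simp [h]
  set U : Matrix σ σ ℂ := (hH.eigenvectorUnitary : Matrix σ σ ℂ) with hU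
  set D : Matrix σ σ ℂ := Matrix.diagonal (RCLike.ofReal ∘ hH.eigenvalues) with hD
  have hUU : star U * U = 1 := Unitary.coe_star_mul_self _
  have hUU' : U * star U = 1 := Unitary.coe_mul_star_self _
  have hspec : N = U * D * star U := by
    conv_lhs => rw [hH.spectral_theorem]
    rfl
  have hev : ∀ k, hH.eigenvalues k ^ 2 = r ^ 2 := fun k => by
    have h1 : D * D = ((r ^ 2 : ℝ) : ℂ) • 1 := by
      have h2 : D = star U * N * U := by
        rw [hspec]
        simp only [← mul_assoc, hUU, one_mul]
        rw [mul_assoc, hUU, mul_one]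
      rw [h2, show star U * N * U * (star U * N * U) = star U * (N * (U * star U) * N) * U by
        simp only [mul_assoc], hUU', mul_one, hNN, Matrix.mul_smul, mul_one, Matrix.smul_mul, hUU]
    have h3 := congrFun (congrFun h1 k) k
    rw [hD, Matrix.diagonal_mul_diagonal] at h3
    simp at h3
    rw [pow_two]
    exact_mod_cast h3
  have hT' : T.map Complex.ofReal = U * Matrix.diagonal (fun k => -Complex.I * hH.eigenvalues k) *
      star U := by
    have h1 : T.map Complex.ofReal = (-Complex.I) • N := by
      rw [hN, smul_smul]; simp
    have h2 : Matrix.diagonal (fun k => -Complex.I * (hH.eigenvalues k : ℂ)) =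
        (-Complex.I) • D := by
      ext p q
      by_cases h : p = q <;> simp [hD, h]
    rw [h1, h2, hspec, Matrix.mul_smul, Matrix.smul_mul]
  have hfac : (1 : Matrix σ σ ℂ) ⊗ₖ B + T.map Complex.ofReal ⊗ₖ A =
      (U ⊗ₖ (1 : Matrix τ τ ℂ)) * ((1 : Matrix σ σ ℂ) ⊗ₖ B +
        Matrix.diagonal (fun k => -Complex.I * hH.eigenvalues k) ⊗ₖ A) *
        (star U ⊗ₖ (1 : Matrix τ τ ℂ)) := by
    rw [mul_add, add_mul]
    simp only [← Matrix.mul_kronecker_mul, mul_one, one_mul, hUU', ← hT']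
  have hdet : (U ⊗ₖ (1 : Matrix τ τ ℂ)).det * (star U ⊗ₖ (1 : Matrix τ τ ℂ)).det = 1 := by
    rw [← Matrix.det_mul, ← Matrix.mul_kronecker_mul, hUU', one_mul, Matrix.one_kronecker_one,
      Matrix.det_one]
  rw [hfac, Matrix.det_mul, Matrix.det_mul, mul_right_comm, hdet, one_mul,
    det_one_kronecker_add_diagonal_kronecker]
  rw [Finset.prod_eq_pow_card (b := (B + (Complex.I * r) • A).det), Finset.card_univ]
  intro k _
  -- Transposition exchanges the two signs, so all blocks have one determinant and the
  -- multiplicities of `±r` are irrelevant.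
  rcases sq_eq_sq_iff_eq_or_eq_neg.1 (hev k) with h | h
  · rw [h, ← Matrix.det_transpose]
    congr 1
    rw [Matrix.transpose_add, Matrix.transpose_smul, hB, hA]
    ext; simp
  · rw [h]
    simp

end Determinant

/-! ### Reduction of octonionic matrices to complex Hermitian ones -/

section HermitianModel

variable {n : ℕ}

/-- The complex Hermitian matrix `S + i r A`. -/
def hermMat (S A : Matrix (Fin n) (Fin n) ℝ) (r : ℝ) : Matrix (Fin n) (Fin n) ℂ :=
  Matrix.of fun i j => (S i j : ℂ) + Complex.I * r * A i j

theorem isHermitian_hermMat {S A : Matrix (Fin n) (Fin n) ℝ} (hS : S.transpose = S)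
    (hA : A.transpose = -A) (r : ℝ) : (hermMat S A r).IsHermitian := by
  ext i j
  have h1 : S j i = S i j := congrFun (congrFun hS i) j
  have h2 : A j i = -A i j := congrFun (congrFun hA i) j
  simp [hermMat, Matrix.conjTranspose_apply, h1, h2]

/-- The power sums of the same sorted eigenvalues are recorded as well; they serve to compute the
discriminant `traceDisc`. -/
theorem exists_monotone_roots_of_isHermitian {H : Matrix (Fin n) (Fin n) ℂ} (hH : H.IsHermitian) :
    ∃ x : Fin n → ℝ, Monotone x ∧ (∀ X : ℝ, ((X : ℂ) • 1 - H).det = (∏ i, (X - x i) : ℝ)) ∧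
      ∀ k : ℕ, (H ^ k).trace = ((∑ i, x i ^ k : ℝ) : ℂ) := by
  refine ⟨hH.eigenvalues ∘ Tuple.sort hH.eigenvalues, Tuple.monotone_sort _, fun X => ?_,
    fun k => ?_⟩
  · have := congrArg (Polynomial.eval (X : ℂ)) hH.charpoly_eq
    rw [Matrix.eval_charpoly, Polynomial.eval_prod] at this
    rw [← Equiv.prod_comp (Tuple.sort hH.eigenvalues)] at this
    rw [show ((X : ℂ) • (1 : Matrix (Fin n) (Fin n) ℂ)) = Matrix.scalar (Fin n) (X : ℂ) by
      ext i j; simp [Matrix.one_apply, Matrix.diagonal_apply], this]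
    simp
  · have hUU : star (hH.eigenvectorUnitary : Matrix (Fin n) (Fin n) ℂ) *
        (hH.eigenvectorUnitary : Matrix (Fin n) (Fin n) ℂ) = 1 := Unitary.coe_star_mul_self _
    have h1 : H ^ k = Unitary.conjStarAlgAut ℂ _ hH.eigenvectorUnitary
        (Matrix.diagonal (RCLike.ofReal ∘ hH.eigenvalues) ^ k) := by
      rw [map_pow, ← hH.spectral_theorem]
    rw [h1, Matrix.diagonal_pow, Unitary.conjStarAlgAut_apply, Matrix.trace_mul_comm, ← mul_assoc, hUU, one_mul, Matrix.trace_diagonal,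
      ← Equiv.sum_comp (Tuple.sort hH.eigenvalues)]
    simp

theorem charP_octReal (S A : Matrix (Fin n) (Fin n) ℝ) (hS : S.transpose = S)
    (hA : A.transpose = -A) (z : Finset (Fin 3) → ℝ) {r : ℝ}
    (hr : ∑ C ∈ Finset.univ.erase ∅, z C ^ 2 = r ^ 2) (X : ℝ) :
    (charP (octReal (fun C => if C = ∅ then S else z C • A)) X : ℂ) =
      ((X : ℂ) • 1 - hermMat S A r).det ^ 8 := by
  have h1 := det_one_kronecker_add_kronecker (B := (S - X • 1).map Complex.ofReal)
    (A := A.map Complex.ofReal) (T := octIm z) (r := r)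
    (by rw [← Matrix.transpose_map, Matrix.transpose_sub, hS]; simp)
    (by rw [← Matrix.transpose_map, hA]; ext; simp) (octIm_transpose z) (by rw [octIm_mul_self, hr])
  have h2 : ((S - X • 1).map Complex.ofReal + (Complex.I * r) • A.map Complex.ofReal) =
      -((X : ℂ) • 1 - hermMat S A r) := by
    ext i j
    by_cases h : i = j
    · simp [hermMat, h]
      ring
    · simp [hermMat, h]
  have h3 : Fintype.card (Finset (Fin 3)) = 8 := by simp
  rw [h2, h3, Matrix.det_neg, mul_pow, ← pow_mul, mul_comm _ 8, pow_mul] at h1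
  rw [show ((-1 : ℂ) ^ 8) = 1 by norm_num, one_pow, one_mul] at h1
  rw [← h1, octReal_eq_kronecker, charP]
  change Complex.ofRealHom _ = _
  rw [RingHom.map_det]
  congr 1
  ext ⟨p, i⟩ ⟨q, j⟩
  by_cases h : p = q <;> by_cases h' : i = j <;>
    simp [h, h', Matrix.kroneckerMap_apply, octIm]

theorem isSymm_octReal (S A : Matrix (Fin n) (Fin n) ℝ) (hS : S.transpose = S)
    (hA : A.transpose = -A) (z : Finset (Fin 3) → ℝ) :
    (octReal (fun C => if C = ∅ then S else z C • A)).IsSymm := by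
  rw [octReal_eq_kronecker, Matrix.IsSymm, Matrix.transpose_add]
  ext ⟨p, i⟩ ⟨q, j⟩
  have h1 : S j i = S i j := congrFun (congrFun hS i) j
  have h2 : A j i = -A i j := congrFun (congrFun hA i) j
  simp [Matrix.kroneckerMap_apply, h1, h2, octIm_apply_comm z p q, Matrix.one_apply, eq_comm]

end HermitianModel

/-! ### Derivatives of determinants -/

section DetDeriv

variable {τ : Type*} [Fintype τ] [DecidableEq τ]

/-- Jacobi's formula: differentiate the Leibniz expansion; replacing one column at a time produces
the adjugate by Cramer's rule. -/
theorem hasDerivAt_det {A : ℝ → Matrix τ τ ℂ} {A' : Matrix τ τ ℂ} {t : ℝ}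
    (h : ∀ i j, HasDerivAt (fun s => A s i j) (A' i j) t) :
    HasDerivAt (fun s => (A s).det) ((A t).adjugate * A').trace t := by
  have h1 : ((A t).adjugate * A').trace = ∑ σ : Equiv.Perm τ, (Equiv.Perm.sign σ : ℂ) *
      ∑ i, (∏ j ∈ Finset.univ.erase i, A t (σ j) j) * A' (σ i) i := by
    have h2 : ∀ i, ((A t).adjugate * A') i i = ((A t).updateCol i fun j => A' j i).det := fun i => by
      rw [← Matrix.cramer_apply, Matrix.cramer_eq_adjugate_mulVec]
      rfl
    simp only [Matrix.trace, Matrix.diag_apply, h2, Matrix.det_apply', Finset.mul_sum]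
    rw [Finset.sum_comm]
    refine Finset.sum_congr rfl fun σ _ => Finset.sum_congr rfl fun i _ => ?_
    rw [← Finset.mul_prod_erase _ _ (Finset.mem_univ i), Matrix.updateCol_self, mul_comm (A' _ _)]
    congr 2
    exact Finset.prod_congr rfl fun j hj => Matrix.updateCol_ne (Finset.mem_erase.1 hj).1
  rw [h1]
  simp only [Matrix.det_apply']
  refine HasDerivAt.fun_sum fun σ _ => HasDerivAt.const_mul _ ?_
  have := HasDerivAt.fun_finsetProd (u := Finset.univ) (f := fun i s => A s (σ i) i)
    (f' := fun i => A' (σ i) i) (x := t) fun i _ => h _ _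
  simpa using this

/-- Differentiating `adj(A) A = det(A) 1` and solving for the derivative of `adj(A)`, with `A`
invertible at `t`, gives the second derivative of the determinant. -/
theorem hasDerivAt_trace_adjugate_mul {A : ℝ → Matrix τ τ ℂ} {A' : Matrix τ τ ℂ} {t : ℝ}
    (h : ∀ i j, HasDerivAt (fun s => A s i j) (A' i j) t) (hdet : (A t).det ≠ 0)
    (K : Matrix τ τ ℂ) :
    HasDerivAt (fun s => ((A s).adjugate * K).trace)
      ((A t).det * (((A t)⁻¹ * A').trace * ((A t)⁻¹ * K).trace -
        ((A t)⁻¹ * A' * (A t)⁻¹ * K).trace)) t := by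
  have hu : IsUnit (A t).det := isUnit_iff_ne_zero.2 hdet
  have hadj : (A t).adjugate = (A t).det • (A t)⁻¹ := by
    rw [Matrix.inv_def, smul_smul, Ring.mul_inverse_cancel _ hu, one_smul]
  have hd := hasDerivAt_det h
  -- Entries of the adjugate are determinants, hence differentiable; only existence is needed here,
  -- the value is solved for below.
  have hex : ∀ i j, ∃ c, HasDerivAt (fun s => (A s).adjugate i j) c t := fun i j => by
    simp only [Matrix.adjugate_apply]
    refine ⟨_, hasDerivAt_det (A' := A'.updateRow j 0) fun k l => ?_⟩
    by_cases hk : k = j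
    · subst hk
      simpa using hasDerivAt_const t ((Pi.single i 1 : τ → ℂ) l)
    · simpa [Matrix.updateRow_ne hk] using h k l
  choose c hc using hex
  set D : Matrix τ τ ℂ := Matrix.of c with hD
  have h1 : D * A t + (A t).adjugate * A' = ((A t).adjugate * A').trace • 1 := by
    ext i j
    have e1 : HasDerivAt (fun s => ((A s).adjugate * A s) i j)
        ((D * A t + (A t).adjugate * A') i j) t := by
      simp only [Matrix.mul_apply, Matrix.add_apply, ← Finset.sum_add_distrib]
      exact HasDerivAt.fun_sum fun k _ => (hc i k).fun_mul (h k j)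
    have e2 : HasDerivAt (fun s => ((A s).adjugate * A s) i j)
        ((((A t).adjugate * A').trace • (1 : Matrix τ τ ℂ)) i j) t := by
      simp only [Matrix.adjugate_mul, Matrix.smul_apply, smul_eq_mul]
      exact hd.mul_const _
    exact e1.unique e2
  have h2 : D = (A t).det • (((A t)⁻¹ * A').trace • (A t)⁻¹ - (A t)⁻¹ * A' * (A t)⁻¹) := by
    have e : D * A t * (A t)⁻¹ = D := by rw [mul_assoc, Matrix.mul_nonsing_inv _ hu, mul_one]
    rw [← e, eq_sub_of_add_eq h1, hadj]
    simp only [Matrix.smul_mul, Matrix.trace_smul, sub_mul, smul_sub, one_mul, smul_eq_mul, mul_smul]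
  have h3 : HasDerivAt (fun s => ((A s).adjugate * K).trace) (D * K).trace t := by
    simp only [Matrix.trace, Matrix.diag_apply, Matrix.mul_apply]
    exact HasDerivAt.fun_sum fun i _ => HasDerivAt.fun_sum fun j _ => (hc i j).mul_const _
  refine h3.congr_deriv ?_
  rw [h2]
  simp only [Matrix.smul_mul, Matrix.trace_smul, sub_mul, Matrix.trace_sub, smul_eq_mul]

theorem ofReal_fderiv_eq_of_hasDerivAt {E : Type*} [NormedAddCommGroup E] [NormedSpace ℝ E]
    {F : E → ℝ} {m v : E} (hF : DifferentiableAt ℝ F m) {c : ℂ}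
    (h : HasDerivAt (fun t : ℝ => (F (m + t • v) : ℂ)) c 0) : (fderiv ℝ F m v : ℂ) = c := by
  have h1 : HasDerivAt (fun t : ℝ => m + t • v) v 0 := by
    simpa using ((hasDerivAt_id (0 : ℝ)).smul_const v).const_add m
  have h2 : HasFDerivAt F (fderiv ℝ F m) (m + (0 : ℝ) • v) := by
    rw [zero_smul, add_zero]; exact hF.hasFDerivAt
  exact (h2.comp_hasDerivAt (0 : ℝ) h1).ofReal_comp.unique h

end DetDeriv

/-! ### The second model -/

section Model2

variable {n : ℕ}

theorem transpose_symMat (s : SymIdx n → ℝ) : (symMat s).transpose = symMat s := by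
  ext i j
  simp only [symMat, Matrix.transpose_apply, Matrix.of_apply]
  rcases lt_trichotomy i j with h | h | h
  · rw [dif_neg h.not_ge, dif_pos h.le]
  · subst h; rfl
  · rw [dif_pos h.le, dif_neg h.not_ge]

theorem transpose_antiMat (a : AntiIdx n → ℝ) : (antiMat a).transpose = -antiMat a := by
  ext i j
  simp only [antiMat, Matrix.transpose_apply, Matrix.of_apply, Matrix.neg_apply]
  rcases lt_trichotomy i j with h | h | h
  · rw [dif_neg h.not_gt, dif_pos h, dif_pos h]
  · subst h; simp
  · rw [dif_pos h, dif_neg h.not_gt, dif_pos h, neg_neg]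

/-- The Gaussian Hermitian matrix underlying the second model. -/
def herm2 (n : ℕ) (m : Idx2 n → ℝ) : Matrix (Fin n) (Fin n) ℂ :=
  hermMat (symMat fun p => m (Sum.inl p)) (antiMat fun p => m (Sum.inr p)) (Real.sqrt 7)

theorem symMat_add_smul (s s' : SymIdx n → ℝ) (t : ℝ) (i j : Fin n) :
    symMat (fun p => s p + t * s' p) i j = symMat s i j + t * symMat s' i j := by
  simp only [symMat, Matrix.of_apply]
  split_ifs <;> ring

theorem antiMat_add_smul (s s' : AntiIdx n → ℝ) (t : ℝ) (i j : Fin n) :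
    antiMat (fun p => s p + t * s' p) i j = antiMat s i j + t * antiMat s' i j := by
  simp only [antiMat, Matrix.of_apply]
  split_ifs <;> ring

theorem herm2_add_smul (m v : Idx2 n → ℝ) (t : ℝ) (i j : Fin n) :
    herm2 n (m + t • v) i j = herm2 n m i j + t * herm2 n v i j := by
  have h1 := symMat_add_smul (fun p => m (Sum.inl p)) (fun p => v (Sum.inl p)) t i j
  have h2 := antiMat_add_smul (fun p => m (Sum.inr p)) (fun p => v (Sum.inr p)) t i j
  simp only [herm2, hermMat, Matrix.of_apply, Pi.add_apply, Pi.smul_apply, smul_eq_mul, h1, h2]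
  push_cast
  ring

theorem isHermitian_herm2 (m : Idx2 n → ℝ) : (herm2 n m).IsHermitian :=
  isHermitian_hermMat (transpose_symMat _) (transpose_antiMat _) _

/-- The characteristic polynomial of the Hermitian matrix underlying the second model. -/
def herm2Poly (n : ℕ) (m : Idx2 n → ℝ) (X : ℝ) : ℝ := (((X : ℂ) • 1 - herm2 n m).det).re

theorem ofReal_herm2Poly (m : Idx2 n → ℝ) (X : ℝ) :
    (herm2Poly n m X : ℂ) = ((X : ℂ) • 1 - herm2 n m).det := by
  obtain ⟨x, -, hx, -⟩ := exists_monotone_roots_of_isHermitian (isHermitian_herm2 m)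
  rw [herm2Poly, hx, Complex.ofReal_re]

/-- All seven imaginary coefficients are 1, so `|z|² = 7`. -/
theorem charP_model2 (m : Idx2 n → ℝ) (X : ℝ) : charP (model2 n m) X = herm2Poly n m X ^ 8 := by
  have h := charP_octReal (symMat fun p => m (Sum.inl p)) (antiMat fun p => m (Sum.inr p))
    (transpose_symMat _) (transpose_antiMat _) (fun _ => 1) (r := Real.sqrt 7)
    (by rw [Real.sq_sqrt (by norm_num)]; simp) X
  simp only [one_smul] at h
  have h2 : (charP (model2 n m) X : ℂ) = (herm2Poly n m X : ℂ) ^ 8 := by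
    rw [ofReal_herm2Poly]; exact h
  exact_mod_cast h2

theorem isSymm_model2 (m : Idx2 n → ℝ) : (model2 n m).IsSymm := by
  have h := isSymm_octReal (symMat fun p => m (Sum.inl p)) (antiMat fun p => m (Sum.inr p))
    (transpose_symMat _) (transpose_antiMat _) (fun _ => 1)
  simp only [one_smul] at h
  exact h

theorem contDiff_herm2_apply (i j : Fin n) :
    ContDiff ℝ (⊤ : ℕ∞) fun m : Idx2 n → ℝ => herm2 n m i j := by
  have h1 : ContDiff ℝ (⊤ : ℕ∞) fun m : Idx2 n → ℝ => symMat (fun p => m (Sum.inl p)) i j := by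
    simp only [symMat, Matrix.of_apply]
    split_ifs <;> fun_prop
  have h2 : ContDiff ℝ (⊤ : ℕ∞) fun m : Idx2 n → ℝ => antiMat (fun p => m (Sum.inr p)) i j := by
    simp only [antiMat, Matrix.of_apply]
    split_ifs <;> fun_prop
  exact (Complex.ofRealCLM.contDiff.comp h1).add
    (contDiff_const.mul (Complex.ofRealCLM.contDiff.comp h2))

theorem contDiff_herm2Poly :
    ContDiff ℝ (⊤ : ℕ∞) fun p : (Idx2 n → ℝ) × ℝ => herm2Poly n p.1 p.2 := by
  refine Complex.reCLM.contDiff.comp ?_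
  simp only [Matrix.det_apply']
  refine ContDiff.sum fun σ _ => contDiff_const.mul (contDiff_prod fun i _ => ?_)
  simp only [Matrix.sub_apply, Matrix.smul_apply, smul_eq_mul]
  exact ((Complex.ofRealCLM.contDiff.comp contDiff_snd).mul contDiff_const).sub
    ((contDiff_herm2_apply _ _).comp contDiff_fst)

theorem hasDerivAt_sub_herm2_apply (m v : Idx2 n → ℝ) (X : ℝ) (i j : Fin n) :
    HasDerivAt (fun t : ℝ => ((X : ℂ) • (1 : Matrix (Fin n) (Fin n) ℂ) - herm2 n (m + t • v)) i j)
      ((-herm2 n v) i j) 0 := by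
  simp only [Matrix.sub_apply, herm2_add_smul, Matrix.neg_apply]
  simpa using (((hasDerivAt_id (0 : ℝ)).ofReal_comp.mul_const (herm2 n v i j)).const_add
    (herm2 n m i j)).const_sub (((X : ℂ) • (1 : Matrix (Fin n) (Fin n) ℂ)) i j)

theorem hasDerivAt_smul_one_sub_apply (H : Matrix (Fin n) (Fin n) ℂ) (X : ℝ) (i j : Fin n) :
    HasDerivAt (fun t : ℝ => ((t : ℂ) • (1 : Matrix (Fin n) (Fin n) ℂ) - H) i j)
      ((1 : Matrix (Fin n) (Fin n) ℂ) i j) X := by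
  simp only [Matrix.sub_apply, Matrix.smul_apply, smul_eq_mul]
  simpa using ((hasDerivAt_id X).ofReal_comp.mul_const _).sub_const (H i j)

theorem contDiff_herm2Poly_left (X : ℝ) :
    ContDiff ℝ (⊤ : ℕ∞) fun m : Idx2 n → ℝ => herm2Poly n m X :=
  contDiff_herm2Poly.comp (contDiff_id.prodMk contDiff_const)

theorem contDiff_herm2Poly_right (m : Idx2 n → ℝ) : ContDiff ℝ (⊤ : ℕ∞) (herm2Poly n m) :=
  contDiff_herm2Poly.comp (contDiff_const.prodMk contDiff_id)

theorem ofReal_fderiv_herm2Poly (m v : Idx2 n → ℝ) (X : ℝ) :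
    (fderiv ℝ (fun m' => herm2Poly n m' X) m v : ℂ) =
      -(((X : ℂ) • 1 - herm2 n m).adjugate * herm2 n v).trace := by
  refine ofReal_fderiv_eq_of_hasDerivAt ((contDiff_herm2Poly_left X).differentiable (by simp) m) ?_
  simp only [ofReal_herm2Poly]
  have := hasDerivAt_det (hasDerivAt_sub_herm2_apply m v X)
  simpa using this

theorem ofReal_fderiv_fderiv_herm2Poly (m v w : Idx2 n → ℝ) {X : ℝ} (hX : herm2Poly n m X ≠ 0) :
    (fderiv ℝ (fun m' => fderiv ℝ (fun m' => herm2Poly n m' X) m' v) m w : ℂ) =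
      herm2Poly n m X * ((((X : ℂ) • 1 - herm2 n m)⁻¹ * herm2 n w).trace *
        (((X : ℂ) • 1 - herm2 n m)⁻¹ * herm2 n v).trace -
        (((X : ℂ) • 1 - herm2 n m)⁻¹ * herm2 n w * ((X : ℂ) • 1 - herm2 n m)⁻¹ *
          herm2 n v).trace) := by
  refine ofReal_fderiv_eq_of_hasDerivAt
    ((contDiff_fderiv_apply_const (contDiff_herm2Poly_left X) v).differentiable (by simp) m) ?_
  simp only [ofReal_fderiv_herm2Poly]
  have hne : ((X : ℂ) • 1 - herm2 n (m + (0 : ℝ) • w)).det ≠ 0 := by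
    rw [← ofReal_herm2Poly]
    simpa using hX
  have := (hasDerivAt_trace_adjugate_mul (hasDerivAt_sub_herm2_apply m w X) hne (herm2 n v)).fun_neg
  refine this.congr_deriv ?_
  rw [ofReal_herm2Poly]
  simp
  ring

theorem ofReal_deriv_herm2Poly (m : Idx2 n → ℝ) (X : ℝ) :
    ((deriv (herm2Poly n m) X : ℝ) : ℂ) = (((X : ℂ) • 1 - herm2 n m).adjugate).trace := by
  have h1 := ((contDiff_herm2Poly_right m).differentiable (by simp) X).hasDerivAt.ofReal_comp
  simp only [ofReal_herm2Poly] at h1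
  have h2 := hasDerivAt_det (hasDerivAt_smul_one_sub_apply (herm2 n m) X)
  rw [mul_one] at h2
  exact h1.unique h2

theorem ofReal_deriv_deriv_herm2Poly (m : Idx2 n → ℝ) {X : ℝ} (hX : herm2Poly n m X ≠ 0) :
    ((deriv (deriv (herm2Poly n m)) X : ℝ) : ℂ) = herm2Poly n m X *
      ((((X : ℂ) • 1 - herm2 n m)⁻¹).trace ^ 2 -
        (((X : ℂ) • 1 - herm2 n m)⁻¹ * ((X : ℂ) • 1 - herm2 n m)⁻¹).trace) := by
  have h0 := (contDiff_infty_iff_deriv.1 (contDiff_herm2Poly_right m)).2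
  have h1 := (h0.differentiable (by simp) X).hasDerivAt.ofReal_comp
  simp only [ofReal_deriv_herm2Poly] at h1
  have hne : ((X : ℂ) • 1 - herm2 n m).det ≠ 0 := by
    rw [← ofReal_herm2Poly]
    simpa using hX
  have h2 := hasDerivAt_trace_adjugate_mul (hasDerivAt_smul_one_sub_apply (herm2 n m) X) hne 1
  simp only [mul_one] at h2
  rw [h1.unique h2, ofReal_herm2Poly]
  ring

end Model2

/-! ### Gaussian covariances and Wick contractions -/

section Covariance

variable {n : ℕ}

/-- The position at or above the diagonal of the symmetric entry `(i, j)`. -/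
def symIdx (i j : Fin n) : SymIdx n :=
  if h : i ≤ j then ⟨(i, j), h⟩ else ⟨(j, i), (not_le.mp h).le⟩

theorem symMat_apply (s : SymIdx n → ℝ) (i j : Fin n) : symMat s i j = s (symIdx i j) := by
  simp only [symMat, symIdx, Matrix.of_apply]
  split_ifs <;> rfl

theorem pairing_symIdx (i j k l : Fin n) :
    pairing 1 (symIdx i j).1 (symIdx k l).1 =
      (if i = k ∧ j = l then 1 else 0) + if i = l ∧ j = k then 1 else 0 := by
  unfold pairing symIdx
  rcases le_or_gt i j with h | h <;> rcases le_or_gt k l with h' | h'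
  · simp only [h, h', dif_pos]; grind
  · simp only [h, h'.not_ge, dif_pos, dif_neg, not_false_eq_true]; grind
  · simp only [h.not_ge, h', dif_pos, dif_neg, not_false_eq_true]; grind
  · simp only [h.not_ge, h'.not_ge, dif_neg, not_false_eq_true]; grind

theorem sum_cov_symMat (i j k l : Fin n) :
    ∑ p : SymIdx n, ∑ q : SymIdx n, 1 / 2 * pairing 1 p.1 q.1 *
        (symMat (fun p' => (Pi.single p 1 : SymIdx n → ℝ) p') i j *
          symMat (fun p' => (Pi.single q 1 : SymIdx n → ℝ) p') k l) =
      1 / 2 * ((if i = k ∧ j = l then 1 else 0) + if i = l ∧ j = k then 1 else 0) := by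
  simp only [symMat_apply, Pi.single_apply, mul_ite, mul_one, mul_zero]
  simp [pairing_symIdx]

theorem sum_cov_antiMat (i j k l : Fin n) :
    ∑ p : AntiIdx n, ∑ q : AntiIdx n, 1 / 14 * pairing (-1) p.1 q.1 *
        (antiMat (fun p' => (Pi.single p 1 : AntiIdx n → ℝ) p') i j *
          antiMat (fun p' => (Pi.single q 1 : AntiIdx n → ℝ) p') k l) =
      1 / 14 * ((if i = k ∧ j = l then 1 else 0) - if i = l ∧ j = k then 1 else 0) := by
  simp only [antiMat, Matrix.of_apply, Pi.single_apply]
  rcases lt_trichotomy i j with h | h | h <;> rcases lt_trichotomy k l with h' | h' | h'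
  all_goals
    simp only [h, h', h.not_gt, h'.not_gt, dif_pos, dif_neg, not_false_eq_true, lt_irrefl, mul_ite,
      mul_one, mul_zero, mul_neg, Finset.sum_neg_distrib,
      Finset.sum_ite_eq, Finset.sum_const_zero, Finset.mem_univ, if_true, neg_neg]
    try unfold pairing
    grind

theorem herm2_single_inl (p : SymIdx n) (i j : Fin n) :
    herm2 n (Pi.single (Sum.inl p) 1) i j =
      (symMat (fun p' => (Pi.single p 1 : SymIdx n → ℝ) p') i j : ℂ) := by
  have h1 : (fun p' => (Pi.single (Sum.inl p) 1 : Idx2 n → ℝ) (Sum.inl p')) = Pi.single p 1 := by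
    ext p'; simp [Pi.single_apply]
  simp only [herm2, hermMat, Matrix.of_apply, h1]
  simp [antiMat]

theorem herm2_single_inr (p : AntiIdx n) (i j : Fin n) :
    herm2 n (Pi.single (Sum.inr p) 1) i j =
      Complex.I * Real.sqrt 7 * (antiMat (fun p' => (Pi.single p 1 : AntiIdx n → ℝ) p') i j : ℂ) := by
  have h1 : (fun p' => (Pi.single (Sum.inr p) 1 : Idx2 n → ℝ) (Sum.inr p')) = Pi.single p 1 := by
    ext p'; simp [Pi.single_apply]
  simp only [herm2, hermMat, Matrix.of_apply, h1]
  simp [symMat]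

/-- The entries of the Gaussian Hermitian matrix have the covariances of the unitary ensemble. -/
theorem sum_cov2_herm2 (i j k l : Fin n) :
    ∑ a, ∑ b, (cov2 n a b : ℂ) * (herm2 n (Pi.single a 1) i j * herm2 n (Pi.single b 1) k l) =
      if i = l ∧ j = k then 1 else 0 := by
  have h1 := congrArg Complex.ofReal (sum_cov_symMat i j k l)
  have h2 := congrArg Complex.ofReal (sum_cov_antiMat i j k l)
  have h7 : ((Real.sqrt 7 : ℝ) : ℂ) ^ 2 = 7 := by
    rw [← Complex.ofReal_pow, Real.sq_sqrt (by norm_num)]; norm_num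
  -- The factor `(i√7)² = -7` turns the variance `1/14` into `-1/2`; added to the symmetric part
  -- this cancels `δ_ik δ_jl` and leaves `δ_il δ_jk`.
  have h3 : ∀ g x y : ℂ, g * (Complex.I * Real.sqrt 7 * x * (Complex.I * Real.sqrt 7 * y)) =
      -7 * (g * (x * y)) := fun g x y => by
    linear_combination g * x * y * (Complex.I ^ 2 * h7 + 7 * Complex.I_sq)
  rw [Complex.ofReal_sum] at h1 h2
  simp only [Complex.ofReal_sum, Complex.ofReal_mul] at h1 h2
  simp only [Fintype.sum_sum_type, herm2_single_inl, herm2_single_inr, cov2, h3, ← Finset.mul_sum,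
    Complex.ofReal_zero, zero_mul, Finset.sum_const_zero, add_zero, zero_add]
  simp only [Complex.ofReal_mul, h1, h2]
  split_ifs <;> norm_num

/-- Wick contraction of an arbitrary quadratic form in the entries, from which the two trace
contractions are specialised. -/
theorem sum_cov2_quadratic_herm2 (c : Fin n → Fin n → Fin n → Fin n → ℂ) :
    ∑ a, ∑ b, (cov2 n a b : ℂ) * ∑ i, ∑ j, ∑ k, ∑ l,
        c i j k l * (herm2 n (Pi.single a 1) i j * herm2 n (Pi.single b 1) k l) =
      ∑ i, ∑ j, c i j j i := by
  have h1 : ∀ f : Fin n → Fin n → Fin n → Fin n → ℂ, ∑ i, ∑ j, ∑ k, ∑ l, f i j k l =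
      ∑ t : Fin n × Fin n × Fin n × Fin n, f t.1 t.2.1 t.2.2.1 t.2.2.2 := fun f => by
    simp only [Fintype.sum_prod_type]
  simp only [h1, Finset.mul_sum]
  simp only [Finset.sum_comm (s := (Finset.univ : Finset (Idx2 n)))
    (t := (Finset.univ : Finset (Fin n × Fin n × Fin n × Fin n)))]
  simp only [mul_left_comm _ (c _ _ _ _), ← Finset.mul_sum, sum_cov2_herm2]
  rw [← h1 fun i j k l => c i j k l * if i = l ∧ j = k then 1 else 0]
  refine Finset.sum_congr rfl fun i _ => Finset.sum_congr rfl fun j _ => ?_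
  rw [Finset.sum_eq_single_of_mem j (Finset.mem_univ j), Finset.sum_eq_single_of_mem i
    (Finset.mem_univ i)]
  · simp
  · intro l _ hl; simp [Ne.symm hl]
  · intro k _ hk; simp [Ne.symm hk]

theorem sum_cov2_trace_mul_trace (U V : Matrix (Fin n) (Fin n) ℂ) :
    ∑ a, ∑ b, (cov2 n a b : ℂ) *
        ((U * herm2 n (Pi.single a 1)).trace * (V * herm2 n (Pi.single b 1)).trace) =
      (U * V).trace := by
  have h := sum_cov2_quadratic_herm2 fun i j k l => U j i * V l k
  have e : ∀ U H : Matrix (Fin n) (Fin n) ℂ, (U * H).trace = ∑ i, ∑ j, U j i * H i j :=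
    fun U H => by
      rw [Matrix.trace_mul_comm]
      simp only [Matrix.trace, Matrix.diag_apply, Matrix.mul_apply, mul_comm]
  simp only [e]
  refine Eq.trans ?_ (h.trans ?_)
  · refine Finset.sum_congr rfl fun a _ => Finset.sum_congr rfl fun b _ => ?_
    simp only [Finset.sum_mul]
    simp only [Finset.mul_sum]
    refine Finset.sum_congr rfl fun i _ => Finset.sum_congr rfl fun j _ =>
      Finset.sum_congr rfl fun k _ => Finset.sum_congr rfl fun l _ => ?_
    ring
  · rfl

theorem sum_cov2_trace_mul_mul_mul (U V : Matrix (Fin n) (Fin n) ℂ) :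
    ∑ a, ∑ b, (cov2 n a b : ℂ) *
        (U * herm2 n (Pi.single a 1) * V * herm2 n (Pi.single b 1)).trace =
      U.trace * V.trace := by
  have h := sum_cov2_quadratic_herm2 fun i j k l => U l i * V j k
  refine Eq.trans ?_ (h.trans ?_)
  · refine Finset.sum_congr rfl fun a _ => Finset.sum_congr rfl fun b _ => ?_
    rw [mul_assoc, mul_assoc, Matrix.trace_mul_comm, mul_assoc, mul_assoc]
    simp only [Matrix.trace, Matrix.diag_apply, Matrix.mul_apply, Finset.mul_sum]
    refine Finset.sum_congr rfl fun i _ => Finset.sum_congr rfl fun j _ =>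
      Finset.sum_congr rfl fun k _ => Finset.sum_congr rfl fun l _ => ?_
    ring
  · simp only [Matrix.trace, Matrix.diag_apply, Finset.sum_mul_sum]

end Covariance

/-! ### The two identities for the Gaussian Hermitian matrix -/

section SpectralModel2

variable {n : ℕ}

theorem cov2_comm (a b : Idx2 n) : cov2 n a b = cov2 n b a := by
  rcases a with a | a <;> rcases b with b | b <;> simp only [cov2, pairing] <;> grind

theorem symMat_diagonal (x : Fin n → ℝ) :
    symMat (fun p => if p.1.1 = p.1.2 then x p.1.1 else 0) = Matrix.diagonal x := by
  ext i j
  simp only [symMat, Matrix.of_apply, Matrix.diagonal_apply]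
  split_ifs <;> grind

/-- The coordinates of the diagonal matrices in the second model. -/
def diagCoord2 (x : Fin n → ℝ) : Idx2 n → ℝ :=
  Sum.elim (fun p => if p.1.1 = p.1.2 then x p.1.1 else 0) fun _ => 0

theorem herm2_diagCoord2 (x : Fin n → ℝ) :
    herm2 n (diagCoord2 x) = Matrix.diagonal fun i => (x i : ℂ) := by
  ext i j
  have h := congrFun (congrFun (symMat_diagonal x) i) j
  simp only [herm2, hermMat, diagCoord2, Sum.elim_inl, Sum.elim_inr, Matrix.of_apply, h]
  simp only [antiMat, Matrix.diagonal_apply]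
  split_ifs <;> simp

/-- With `B` the resolvent, the second derivative of `Q` is `Q (tr(BH) tr(BH') - tr(BHBH'))`.
Contraction gives `Q (tr B² - (tr B)²)`, which is `-Q''`. -/
theorem diffOp_herm2Poly (m : Idx2 n → ℝ) {X : ℝ} (hX : herm2Poly n m X ≠ 0) :
    diffOp (cov2 n) (fun m' => herm2Poly n m' X) m = -deriv (deriv (herm2Poly n m)) X := by
  apply Complex.ofReal_injective
  rw [Complex.ofReal_neg, ofReal_deriv_deriv_herm2Poly m hX, diffOp]
  set B := ((X : ℂ) • 1 - herm2 n m)⁻¹ with hB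
  simp only [Complex.ofReal_sum, Complex.ofReal_mul, ofReal_fderiv_fderiv_herm2Poly m _ _ hX, ← hB,
    mul_sub, mul_left_comm _ (herm2Poly n m X : ℂ), Finset.sum_sub_distrib, ← Finset.mul_sum,
    sum_cov2_trace_mul_trace, sum_cov2_trace_mul_mul_mul]
  ring

/-- Contraction gives `Q(X) Q(Y) tr(B_X B_Y)`; the resolvent identity `(Y - X) B_X B_Y = B_X - B_Y`
and `Q' = Q tr B` do the rest. -/
theorem gradForm_herm2Poly (m : Idx2 n → ℝ) {X Y : ℝ} (hX : herm2Poly n m X ≠ 0)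
    (hY : herm2Poly n m Y ≠ 0) :
    (Y - X) * gradForm (cov2 n) (fun m' => herm2Poly n m' X) (fun m' => herm2Poly n m' Y) m =
      deriv (herm2Poly n m) X * herm2Poly n m Y - deriv (herm2Poly n m) Y * herm2Poly n m X := by
  have hu : ∀ {Z : ℝ}, herm2Poly n m Z ≠ 0 → IsUnit ((Z : ℂ) • 1 - herm2 n m).det := fun {Z} hZ => by
    rw [← ofReal_herm2Poly]; exact isUnit_iff_ne_zero.2 (by exact_mod_cast hZ)
  have hadj : ∀ {Z : ℝ}, herm2Poly n m Z ≠ 0 → ((Z : ℂ) • 1 - herm2 n m).adjugate =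
      (herm2Poly n m Z : ℂ) • ((Z : ℂ) • 1 - herm2 n m)⁻¹ := fun {Z} hZ => by
    rw [ofReal_herm2Poly, Matrix.inv_def, smul_smul, Ring.mul_inverse_cancel _ (hu hZ), one_smul]
  have hres : ((Y : ℂ) - X) • (((X : ℂ) • 1 - herm2 n m)⁻¹ * ((Y : ℂ) • 1 - herm2 n m)⁻¹) =
      ((X : ℂ) • 1 - herm2 n m)⁻¹ - ((Y : ℂ) • 1 - herm2 n m)⁻¹ := by
    have e : ((Y : ℂ) - X) • (1 : Matrix (Fin n) (Fin n) ℂ) =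
        ((Y : ℂ) • 1 - herm2 n m) - ((X : ℂ) • 1 - herm2 n m) := by
      rw [sub_smul]; abel
    rw [← Matrix.mul_one ((X : ℂ) • 1 - herm2 n m)⁻¹, mul_assoc, ← Matrix.mul_smul,
      ← Matrix.smul_mul, e, sub_mul, Matrix.mul_nonsing_inv _ (hu hY), mul_sub, mul_one,
      ← mul_assoc, Matrix.nonsing_inv_mul _ (hu hX), one_mul]
  apply Complex.ofReal_injective
  simp only [gradForm, Complex.ofReal_sum, Complex.ofReal_mul, Complex.ofReal_sub,
    ofReal_fderiv_herm2Poly, ofReal_deriv_herm2Poly, hadj hX, hadj hY]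
  have h1 := sum_cov2_trace_mul_trace (((X : ℂ) • 1 - herm2 n m)⁻¹) (((Y : ℂ) • 1 - herm2 n m)⁻¹)
  have h2 := congrArg Matrix.trace hres
  rw [Matrix.trace_smul, Matrix.trace_sub, ← h1, smul_eq_mul] at h2
  simp only [Matrix.smul_mul, Matrix.trace_smul, smul_eq_mul]
  have h3 : ∀ g p q u v : ℂ, g * (-(p * u) * -(q * v)) = (p * q) * (g * (u * v)) := fun _ _ _ _ _ => by
    ring
  simp only [h3, ← Finset.mul_sum]
  linear_combination (herm2Poly n m X : ℂ) * herm2Poly n m Y * h2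

theorem spectralModel_model2 (n : ℕ) :
    SpectralModel n (cov2 n) (model2 n) (herm2Poly n) ((2 * 1 : ℕ) : ℝ) where
  symm := cov2_comm
  contDiff := contDiff_herm2Poly
  roots m := by
    obtain ⟨x, hx, h, -⟩ := exists_monotone_roots_of_isHermitian (isHermitian_herm2 m)
    exact ⟨x, hx, fun X => by rw [herm2Poly, h, Complex.ofReal_re]⟩
  charP_eq := charP_model2
  isSymm := isSymm_model2
  diffOp_of_ne m X hX := by rw [diffOp_herm2Poly m hX]; norm_num
  gradForm_of_ne m X Y _ hX hY := gradForm_herm2Poly m hX hY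
  surj x _ := by
    refine ⟨diagCoord2 x, fun X => ?_⟩
    apply Complex.ofReal_injective
    rw [ofReal_herm2Poly, herm2_diagCoord2, ← Matrix.diagonal_one, ← Matrix.diagonal_smul,
      Matrix.diagonal_sub, Matrix.det_diagonal]
    simp

end SpectralModel2

/-! ### The first model -/

section Model1

/-- The position of the upper left entry. -/
abbrev symIdx00 : SymIdx 2 := ⟨(0, 0), le_rfl⟩

/-- The position of the upper right symmetric entry. -/
abbrev symIdx01 : SymIdx 2 := ⟨(0, 1), Fin.zero_le 1⟩

/-- The position of the lower right entry. -/
abbrev symIdx11 : SymIdx 2 := ⟨(1, 1), le_rfl⟩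

/-- The position of the upper right antisymmetric entry. -/
abbrev antiIdx01 : AntiIdx 2 := ⟨(0, 1), Fin.zero_lt_one⟩

theorem antiIdx_two_eq : ∀ p : AntiIdx 2, p = antiIdx01 := by decide

theorem sum_symIdx_two (f : SymIdx 2 → ℝ) :
    ∑ p, f p = f symIdx00 + f symIdx01 + f symIdx11 := by
  have h : (Finset.univ : Finset (SymIdx 2)) = {symIdx00, symIdx01, symIdx11} := by decide
  rw [h, Finset.sum_insert (by decide), Finset.sum_insert (by decide), Finset.sum_singleton, add_assoc]

theorem symMat_two (s : SymIdx 2 → ℝ) :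
    symMat s = !![s symIdx00, s symIdx01; s symIdx01, s symIdx11] := by
  ext i j
  fin_cases i <;> fin_cases j <;> simp [symMat]

theorem antiMat_two (a : AntiIdx 2 → ℝ) :
    antiMat a = !![0, a antiIdx01; -a antiIdx01, 0] := by
  ext i j
  fin_cases i <;> fin_cases j <;> simp [antiMat]

/-- The characteristic polynomial of a `2 × 2` octonionic Hermitian matrix. -/
def poly1 (m : Idx1 → ℝ) (X : ℝ) : ℝ :=
  (X - m (Sum.inl symIdx00)) * (X - m (Sum.inl symIdx11)) - m (Sum.inl symIdx01) ^ 2 -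
    ∑ q, m (Sum.inr q) ^ 2

/-- The differential of `poly1`. -/
def poly1Deriv (X : ℝ) (v m : Idx1 → ℝ) : ℝ :=
  -((X - m (Sum.inl symIdx11)) * v (Sum.inl symIdx00) +
      (X - m (Sum.inl symIdx00)) * v (Sum.inl symIdx11) +
      2 * m (Sum.inl symIdx01) * v (Sum.inl symIdx01) + 2 * ∑ q, m (Sum.inr q) * v (Sum.inr q))

theorem contDiff_poly1 : ContDiff ℝ (⊤ : ℕ∞) fun p : (Idx1 → ℝ) × ℝ => poly1 p.1 p.2 := by
  unfold poly1
  fun_prop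

/-- The functions of the first model are at most quadratic on lines, so their derivatives are read
off from an exact expansion. -/
theorem fderiv_eq_of_quadratic {E : Type*} [NormedAddCommGroup E] [NormedSpace ℝ E] {F : E → ℝ}
    {m v : E} (hF : DifferentiableAt ℝ F m) {c d : ℝ}
    (h : ∀ t : ℝ, F (m + t • v) = F m + t * c + t ^ 2 * d) : fderiv ℝ F m v = c := by
  have h1 : HasDerivAt (fun t : ℝ => F m + t * c + t ^ 2 * d) c 0 := by
    simpa using (((hasDerivAt_id (0 : ℝ)).mul_const c).const_add (F m)).fun_add
      (((hasDerivAt_id (0 : ℝ)).fun_pow 2).mul_const d)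
  have h2 : HasDerivAt (fun t : ℝ => ((F (m + t • v) : ℝ) : ℂ)) (c : ℂ) 0 := by
    simp only [h]; exact h1.ofReal_comp
  exact_mod_cast ofReal_fderiv_eq_of_hasDerivAt hF h2

theorem fderiv_poly1 (m v : Idx1 → ℝ) (X : ℝ) :
    fderiv ℝ (fun m' => poly1 m' X) m v = poly1Deriv X v m := by
  have hd : Differentiable ℝ fun m' : Idx1 → ℝ => poly1 m' X := by
    unfold poly1
    fun_prop
  refine fderiv_eq_of_quadratic (d := v (Sum.inl symIdx00) * v (Sum.inl symIdx11) -
    v (Sum.inl symIdx01) ^ 2 - ∑ q, v (Sum.inr q) ^ 2)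
    (hd m) fun t => ?_
  have h : ∑ q, (m (Sum.inr q) + t * v (Sum.inr q)) ^ 2 = ∑ q, m (Sum.inr q) ^ 2 +
      2 * t * ∑ q, m (Sum.inr q) * v (Sum.inr q) + t ^ 2 * ∑ q, v (Sum.inr q) ^ 2 := by
    simp only [Finset.mul_sum, ← Finset.sum_add_distrib]
    exact Finset.sum_congr rfl fun q _ => by ring
  simp only [poly1, poly1Deriv, Pi.add_apply, Pi.smul_apply, smul_eq_mul, h]
  ring

theorem fderiv_fderiv_poly1 (m v w : Idx1 → ℝ) (X : ℝ) :
    fderiv ℝ (fun m' => fderiv ℝ (fun m' => poly1 m' X) m' v) m w =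
      w (Sum.inl symIdx11) * v (Sum.inl symIdx00) + w (Sum.inl symIdx00) * v (Sum.inl symIdx11) -
        2 * w (Sum.inl symIdx01) * v (Sum.inl symIdx01) -
          2 * ∑ q, w (Sum.inr q) * v (Sum.inr q) := by
  simp only [fderiv_poly1]
  have hd : Differentiable ℝ (poly1Deriv X v) := by
    unfold poly1Deriv
    fun_prop
  refine fderiv_eq_of_quadratic (d := 0) (hd m) fun t => ?_
  have h : ∑ q, (m (Sum.inr q) + t * w (Sum.inr q)) * v (Sum.inr q) =
      ∑ q, m (Sum.inr q) * v (Sum.inr q) + t * ∑ q, w (Sum.inr q) * v (Sum.inr q) := by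
    simp only [Finset.mul_sum, ← Finset.sum_add_distrib]
    exact Finset.sum_congr rfl fun q _ => by ring
  simp only [poly1Deriv, Pi.add_apply, Pi.smul_apply, smul_eq_mul, h]
  ring

/-- The covariance is diagonal: variance 1 for the two diagonal entries and `1/2` for the eight
coordinates off the diagonal. -/
theorem sum_cov1 (f : Idx1 → Idx1 → ℝ) :
    ∑ a, ∑ b, cov1 a b * f a b = f (Sum.inl symIdx00) (Sum.inl symIdx00) +
      f (Sum.inl symIdx11) (Sum.inl symIdx11) +
        1 / 2 * (f (Sum.inl symIdx01) (Sum.inl symIdx01) + ∑ q, f (Sum.inr q) (Sum.inr q)) := by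
  have h1 : ∀ p q, cov1 (Sum.inl p) (Sum.inr q) = 0 := fun p q =>
    if_neg (Ne.symm q.1.2)
  have h2 : ∀ p q, cov1 (Sum.inr q) (Sum.inl p) = 0 := fun p q =>
    if_neg q.1.2
  have h3 : ∀ p q, cov1 (Sum.inr p) (Sum.inr q) = if p = q then 1 / 2 else 0 := fun p q => by
    obtain ⟨⟨A, hA⟩, a⟩ := p
    obtain ⟨⟨B, hB⟩, b⟩ := q
    rw [antiIdx_two_eq a, antiIdx_two_eq b]
    simp [cov1, entry1, pairing]
  have h4 : ∀ p q, cov1 (Sum.inl p) (Sum.inl q) = 1 / 2 * pairing 1 p.1 q.1 := fun p q => by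
    simp [cov1, entry1, octSign_empty]
  simp only [Fintype.sum_sum_type, h1, h2, h3, h4, zero_mul, Finset.sum_const_zero, add_zero,
    zero_add, ite_mul, Finset.sum_ite_eq, Finset.mem_univ, if_true, ← Finset.mul_sum]
  simp only [sum_symIdx_two, pairing]
  simp
  ring

/-- Each of the eight off-diagonal coordinates contributes `1/2 · (-2) = -1`; the product of the two
diagonal entries contributes nothing, as they are uncorrelated. As `Q'' = 2`, this is `β = 8`. -/
theorem diffOp_poly1 (m : Idx1 → ℝ) (X : ℝ) : diffOp cov1 (fun m' => poly1 m' X) m = -8 := by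
  simp only [diffOp, fderiv_fderiv_poly1]
  rw [sum_cov1]
  have h : Fintype.card (AntiIdx 2) = 1 := by decide
  simp [Pi.single_apply, h]
  norm_num

theorem hasDerivAt_poly1 (m : Idx1 → ℝ) (X : ℝ) :
    HasDerivAt (poly1 m) (2 * X - m (Sum.inl symIdx00) - m (Sum.inl symIdx11)) X := by
  have := ((((hasDerivAt_id X).sub_const (m (Sum.inl symIdx00))).fun_mul
    ((hasDerivAt_id X).sub_const (m (Sum.inl symIdx11)))).sub_const
      (m (Sum.inl symIdx01) ^ 2)).sub_const (∑ q, m (Sum.inr q) ^ 2)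
  refine this.congr_deriv ?_
  simp only [id]
  ring

theorem deriv_deriv_poly1 (m : Idx1 → ℝ) (X : ℝ) : deriv (deriv (poly1 m)) X = 2 := by
  rw [show deriv (poly1 m) = _ from funext fun X => (hasDerivAt_poly1 m X).deriv]
  simp

theorem gradForm_poly1 (m : Idx1 → ℝ) (X Y : ℝ) :
    (Y - X) * gradForm cov1 (fun m' => poly1 m' X) (fun m' => poly1 m' Y) m =
      deriv (poly1 m) X * poly1 m Y - deriv (poly1 m) Y * poly1 m X := by
  simp only [gradForm, fderiv_poly1, (hasDerivAt_poly1 m _).deriv]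
  rw [sum_cov1]
  simp [poly1Deriv, poly1, Pi.single_apply]
  have h : ∑ q, 2 * m (Sum.inr q) * (2 * m (Sum.inr q)) = 4 * ∑ q, m (Sum.inr q) ^ 2 := by
    rw [Finset.mul_sum]
    exact Finset.sum_congr rfl fun q _ => by ring
  rw [h]
  ring

/-- The Hermitian matrix with the eigenvalues of the octonionic matrix of the first model. -/
def herm1 (m : Idx1 → ℝ) : Matrix (Fin 2) (Fin 2) ℂ :=
  hermMat (symMat fun p => m (Sum.inl p)) (antiMat fun _ => 1) (Real.sqrt (∑ q, m (Sum.inr q) ^ 2))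

theorem isHermitian_herm1 (m : Idx1 → ℝ) : (herm1 m).IsHermitian :=
  isHermitian_hermMat (transpose_symMat _) (transpose_antiMat _) _

/-- Only the norm of the imaginary octonion off the diagonal enters, so an imaginary complex number
of the same norm gives the same polynomial. -/
theorem ofReal_poly1 (m : Idx1 → ℝ) (X : ℝ) :
    (poly1 m X : ℂ) = ((X : ℂ) • 1 - herm1 m).det := by
  have h : ((Real.sqrt (∑ q, m (Sum.inr q) ^ 2) : ℝ) : ℂ) ^ 2 =
      ((∑ q, m (Sum.inr q) ^ 2 : ℝ) : ℂ) := by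
    rw [← Complex.ofReal_pow, Real.sq_sqrt (Finset.sum_nonneg fun q _ => sq_nonneg _)]
  rw [Matrix.det_fin_two]
  simp only [herm1, hermMat, symMat_two, antiMat_two, Matrix.sub_apply, Matrix.smul_apply,
    Matrix.of_apply, Matrix.one_apply, poly1]
  simp
  rw [Complex.ofReal_sum] at h
  simp only [Complex.ofReal_pow] at h
  linear_combination h - ((Real.sqrt (∑ q, m (Sum.inr q) ^ 2) : ℝ) : ℂ) ^ 2 * Complex.I_sq

/-- The coefficients of the imaginary part of the octonionic matrix of the first model. -/
def coeff1 (m : Idx1 → ℝ) (C : Finset (Fin 3)) : ℝ :=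
  if h : C ≠ ∅ then m (Sum.inr (⟨C, h⟩, antiIdx01)) else 0

/-- Antisymmetric `2 × 2` matrices form a line, so all the imaginary parts are multiples of one
matrix; this is where size 2 is needed. -/
theorem model1_eq (m : Idx1 → ℝ) : model1 m = octReal fun C =>
    if C = ∅ then symMat fun p => m (Sum.inl p) else coeff1 m C • antiMat fun _ => 1 := by
  unfold model1
  congr 1
  ext C i j
  by_cases h : C = ∅
  · simp [h]
  · rw [dif_neg h, if_neg h, coeff1, dif_pos h]
    simp only [antiMat_two]
    fin_cases i <;> fin_cases j <;> simp

theorem sum_coeff1_sq (m : Idx1 → ℝ) :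
    ∑ C ∈ Finset.univ.erase ∅, coeff1 m C ^ 2 = ∑ q, m (Sum.inr q) ^ 2 := by
  rw [Fintype.sum_prod_type, Finset.sum_subtype _ (p := fun C => C ≠ ∅) (by simp)]
  refine Finset.sum_congr rfl fun C _ => ?_
  rw [Fintype.sum_eq_single antiIdx01 fun p hp => absurd (antiIdx_two_eq p) hp, coeff1,
    dif_pos C.2]

theorem charP_model1 (m : Idx1 → ℝ) (X : ℝ) : charP (model1 m) X = poly1 m X ^ 8 := by
  have h := charP_octReal (symMat fun p => m (Sum.inl p)) (antiMat fun _ => 1)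
    (transpose_symMat _) (transpose_antiMat _) (coeff1 m)
    (r := Real.sqrt (∑ q, m (Sum.inr q) ^ 2))
    (by rw [Real.sq_sqrt (Finset.sum_nonneg fun q _ => sq_nonneg _), sum_coeff1_sq]) X
  rw [← model1_eq] at h
  have h2 : (charP (model1 m) X : ℂ) = (poly1 m X : ℂ) ^ 8 := by
    rw [ofReal_poly1]; exact h
  exact_mod_cast h2

theorem spectralModel_model1 : SpectralModel 2 cov1 model1 poly1 ((2 * 4 : ℕ) : ℝ) where
  symm a b := by unfold cov1 pairing; grind
  contDiff := contDiff_poly1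
  roots m := by
    obtain ⟨x, hx, h, -⟩ := exists_monotone_roots_of_isHermitian (isHermitian_herm1 m)
    exact ⟨x, hx, fun X => Complex.ofReal_injective (by rw [ofReal_poly1, h])⟩
  charP_eq := charP_model1
  isSymm m := by
    rw [model1_eq]
    exact isSymm_octReal _ _ (transpose_symMat _) (transpose_antiMat _) _
  diffOp_of_ne m X _ := by rw [diffOp_poly1, deriv_deriv_poly1]; norm_num
  gradForm_of_ne m X Y _ _ _ := gradForm_poly1 m X Y
  surj x _ := by
    refine ⟨Sum.elim (fun p => if p.1.1 = p.1.2 then x p.1.1 else 0) fun _ => 0, fun X => ?_⟩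
    simp [poly1, Fin.prod_univ_two]

end Model1

/-! ### Multiplicity of the eigenvalues -/

section Eigenspace

variable {κ : Type} [Fintype κ] [DecidableEq κ]

/-- For symmetric `N = M - μ`, `N² v = 0` implies `N v = 0` because `NᵀN` and `N` have the same
kernel. Generalised eigenvectors are thus eigenvectors, and the algebraic multiplicity is the
geometric one. -/
theorem finrank_eigenspace_eq_rootMultiplicity_of_isSymm {M : Matrix κ κ ℝ} (hM : M.IsSymm)
    (μ : ℝ) : Module.finrank ℝ (Module.End.eigenspace (Matrix.toLin' M) μ) =
      M.charpoly.rootMultiplicity μ := by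
  rw [← Matrix.charpoly_toLin', ← LinearMap.finrank_maxGenEigenspace_eq]
  set N : Matrix κ κ ℝ := M - μ • 1 with hN
  have hNT : N.transpose = N := by rw [hN, Matrix.transpose_sub, hM.eq]; simp
  have hlin : Matrix.toLin' M - μ • (1 : Module.End ℝ (κ → ℝ)) = Matrix.toLin' N := by
    rw [hN, map_sub, map_smul, Matrix.toLin'_one]; rfl
  have hker : ∀ v, N.mulVec (N.mulVec v) = 0 → N.mulVec v = 0 := fun v hv => by
    have : v ∈ LinearMap.ker (N.transpose * N).mulVecLin := by
      rw [LinearMap.mem_ker, Matrix.mulVecLin_apply, hNT, ← Matrix.mulVec_mulVec, hv]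
    rw [Matrix.ker_mulVecLin_transpose_mul_self] at this
    exact this
  have hpow : ∀ (k : ℕ) (v : κ → ℝ), (Matrix.toLin' N ^ k) v = 0 → N.mulVec v = 0 := fun k => by
    induction k with
    | zero => intro v hv; rw [show v = 0 from hv, Matrix.mulVec_zero]
    | succ k ih =>
      intro v hv
      rw [pow_succ] at hv
      exact hker v (ih _ hv)
  have heq : Module.End.eigenspace (Matrix.toLin' M) μ =
      Module.End.maxGenEigenspace (Matrix.toLin' M) μ := by
    ext v
    rw [Module.End.mem_maxGenEigenspace, Module.End.mem_eigenspace_iff, hlin]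
    have h1 : Matrix.toLin' M v = μ • v ↔ N.mulVec v = 0 := by
      rw [hN, Matrix.sub_mulVec, sub_eq_zero, Matrix.toLin'_apply, Matrix.smul_mulVec,
        Matrix.one_mulVec]
    rw [h1]
    exact ⟨fun h => ⟨1, by simpa using h⟩, fun ⟨k, hk⟩ => hpow k v hk⟩
  rw [heq]

theorem eval_charpoly_eq_charP (M : Matrix κ κ ℝ) (X : ℝ) :
    M.charpoly.eval X = (-1) ^ Fintype.card κ * charP M X := by
  rw [Matrix.eval_charpoly, charP, ← Matrix.det_neg, neg_sub, Matrix.scalar_apply,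
    Matrix.smul_one_eq_diagonal]

end Eigenspace

theorem SpectralModel.charpoly_eq {ι κ : Type} [Fintype ι] [DecidableEq ι] [Fintype κ]
    [DecidableEq κ] {n : ℕ} {g : ι → ι → ℝ} {M : (ι → ℝ) → Matrix κ κ ℝ} {Q : (ι → ℝ) → ℝ → ℝ}
    {β : ℝ} (h : SpectralModel n g M Q β) {m : ι → ℝ} {x : Fin n → ℝ}
    (hQ : ∀ X, Q m X = ∏ i, (X - x i)) :
    (M m).charpoly = (∏ i, (Polynomial.X - Polynomial.C (x i))) ^ 8 := by
  have h1 : (M m).charpoly = Polynomial.C ((-1) ^ Fintype.card κ) *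
      (∏ i, (Polynomial.X - Polynomial.C (x i))) ^ 8 := by
    refine Polynomial.funext fun X => ?_
    rw [eval_charpoly_eq_charP, h.charP_eq, hQ]
    simp [Polynomial.eval_prod]
  have h2 : ((∏ i, (Polynomial.X - Polynomial.C (x i))) ^ 8).Monic :=
    (Polynomial.monic_prod_of_monic _ _ fun i _ => Polynomial.monic_X_sub_C _).pow 8
  -- Both polynomials being monic, the sign must be 1; the parity of the dimension is not used.
  have h3 := (Matrix.charpoly_monic (M m)).leadingCoeff
  rw [h1, Polynomial.leadingCoeff_mul, h2.leadingCoeff, Polynomial.leadingCoeff_C, mul_one] at h3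
  rw [h1, h3, Polynomial.C_1, one_mul]

theorem SpectralModel.finrank_eigenspace {ι κ : Type} [Fintype ι] [DecidableEq ι] [Fintype κ]
    [DecidableEq κ] {n : ℕ} {g : ι → ι → ℝ} {M : (ι → ℝ) → Matrix κ κ ℝ} {Q : (ι → ℝ) → ℝ → ℝ}
    {β : ℝ} (h : SpectralModel n g M Q β) {m : ι → ℝ} {x : Fin n → ℝ}
    (hx : ListsSpectrum (M m) x) (i : Fin n) :
    Module.finrank ℝ (Module.End.eigenspace (Matrix.toLin' (M m)) (x i)) = 8 := by
  obtain ⟨hmono, hQ⟩ := h.listsSpectrum_iff.1 hx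
  rw [finrank_eigenspace_eq_rootMultiplicity_of_isSymm (h.isSymm m), h.charpoly_eq hQ,
    ← Polynomial.count_roots, Polynomial.roots_pow, Multiset.count_nsmul]
  have h1 : (∏ i, (Polynomial.X - Polynomial.C (x i))).roots = Finset.univ.val.map x := by
    rw [← Polynomial.roots_multiset_prod_X_sub_C (Finset.univ.val.map x), Multiset.map_map]
    rfl
  rw [h1, Multiset.count_map_eq_count' _ _ hmono.injective]
  simp

/-! ### Simplicity of the spectrum almost everywhere -/

/-- If the roots coincide, `Q` is a square; but at each of the two diagonal entries `Q ≤ 0`, so both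
equal the double root. -/
theorem strictMono_of_roots_poly1 {m : Idx1 → ℝ}
    (hm : m (Sum.inl symIdx00) ≠ m (Sum.inl symIdx11)) {x : Fin 2 → ℝ} (hx : Monotone x)
    (hQ : ∀ X, poly1 m X = ∏ i, (X - x i)) : StrictMono x := by
  refine hx.strictMono_of_injective ?_
  have hN : 0 ≤ ∑ q, m (Sum.inr q) ^ 2 := Finset.sum_nonneg fun q _ => sq_nonneg _
  have h01 : x 0 ≠ x 1 := fun h => by
    have h0 := hQ (m (Sum.inl symIdx00))
    have h1 := hQ (m (Sum.inl symIdx11))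
    simp only [poly1, Fin.prod_univ_two, ← h, sub_self, zero_mul, mul_zero, zero_sub] at h0 h1
    have e0 : m (Sum.inl symIdx00) - x 0 = 0 := by nlinarith
    have e1 : m (Sum.inl symIdx11) - x 0 = 0 := by nlinarith
    exact hm (by linarith)
  intro i j hij
  fin_cases i <;> fin_cases j <;> simp_all

/-- The exceptional matrices lie in the hyperplane where the diagonal entries agree, a null set. -/
theorem ae_exists_listsSpectrum_model1 :
    ∀ᵐ m : Idx1 → ℝ, ∃ x : Fin 2 → ℝ, ListsSpectrum (model1 m) x := by
  set ℓ : (Idx1 → ℝ) →ₗ[ℝ] ℝ :=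
    LinearMap.proj (R := ℝ) (φ := fun _ : Idx1 => ℝ) (Sum.inl symIdx00) -
      LinearMap.proj (Sum.inl symIdx11) with hℓ
  have h1 : LinearMap.ker ℓ ≠ ⊤ := fun h => by
    have : (Pi.single (Sum.inl symIdx00) 1 : Idx1 → ℝ) ∈ LinearMap.ker ℓ := h ▸ Submodule.mem_top
    simp [hℓ, LinearMap.mem_ker] at this
  have h2 := Measure.addHaar_submodule volume _ h1
  rw [← compl_compl (LinearMap.ker ℓ : Set (Idx1 → ℝ)), ← mem_ae_iff] at h2
  filter_upwards [h2] with m hm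
  obtain ⟨x, hx, hQ⟩ := spectralModel_model1.roots m
  refine ⟨x, spectralModel_model1.listsSpectrum_iff.2
    ⟨strictMono_of_roots_poly1 (fun h => hm ?_) hx hQ, hQ⟩⟩
  simp [hℓ, LinearMap.mem_ker, h]

/-! ### Discriminant of the second model -/

section Model2

variable {n : ℕ}

/-- The discriminant of a matrix, as the determinant of the traces of its powers. -/
def traceDisc {R : Type*} [CommRing R] (H : Matrix (Fin n) (Fin n) R) : R :=
  (Matrix.of fun i j : Fin n => (H ^ (i + j : ℕ)).trace).det

theorem traceDisc_map {R S : Type*} [CommRing R] [CommRing S] (f : R →+* S)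
    (H : Matrix (Fin n) (Fin n) R) : traceDisc (H.map f) = f (traceDisc H) := by
  rw [traceDisc, traceDisc, RingHom.map_det]
  congr 1
  ext i j
  have := (map_pow f.mapMatrix H (i + j : ℕ)).symm
  simp only [RingHom.mapMatrix_apply] at this
  simp only [Matrix.of_apply, RingHom.mapMatrix_apply, Matrix.map_apply, this]
  exact (AddMonoidHom.map_trace f.toAddMonoidHom _).symm

theorem traceDisc_smul {R : Type*} [CommRing R] (t : R) (H : Matrix (Fin n) (Fin n) R) :
    traceDisc (t • H) = (∏ i : Fin n, t ^ (i : ℕ)) ^ 2 * traceDisc H := by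
  rw [traceDisc, traceDisc, sq, mul_assoc, ← Matrix.det_mul_row, ← Matrix.det_mul_column]
  congr 1
  ext i j
  simp [smul_pow, pow_add, mul_left_comm (t ^ (j : ℕ))]

/-- The Hankel matrix of power sums is `VᵀV` for the Vandermonde matrix `V`. Thus a polynomial in
the entries of `H` detects multiple eigenvalues. -/
theorem traceDisc_eq_sq_det_vandermonde {R : Type*} [CommRing R] {H : Matrix (Fin n) (Fin n) R}
    {x : Fin n → R} (h : ∀ k : ℕ, (H ^ k).trace = ∑ i, x i ^ k) :
    traceDisc H = (Matrix.vandermonde x).det ^ 2 := by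
  rw [sq]
  nth_rewrite 1 [← Matrix.det_transpose]
  rw [← Matrix.det_mul, traceDisc]
  congr 1
  ext i j
  rw [Matrix.vandermonde_transpose_mul_vandermonde, Matrix.of_apply, h]

/-- A polynomial in `s` that is nonzero at `s = 0` has finitely many roots. -/
theorem finite_setOf_traceDisc_add_smul_eq_zero (H L : Matrix (Fin n) (Fin n) ℂ)
    (hL : traceDisc L ≠ 0) : {s : ℝ | traceDisc ((s : ℂ) • H + L) = 0}.Finite := by
  set R : Polynomial ℂ := traceDisc ((Polynomial.X : Polynomial ℂ) • H.map Polynomial.C +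
    L.map Polynomial.C) with hR
  have he : ∀ s : ℂ, R.eval s = traceDisc (s • H + L) := fun s => by
    rw [hR, ← Polynomial.coe_evalRingHom, ← traceDisc_map]
    congr 1
    ext i j
    simp [mul_comm (H i j)]
  have hne : R ≠ 0 := fun h0 => hL (by simpa [h0] using (he 0).symm)
  refine Set.Finite.subset ((Polynomial.finite_setOfPred_isRoot hne).preimage
    Complex.ofReal_injective.injOn) fun s hs => ?_
  simpa [Polynomial.IsRoot, he] using hs

theorem traceDisc_herm2_diagCoord2 {x : Fin n → ℝ} (hx : Function.Injective x) :
    traceDisc (herm2 n (diagCoord2 x)) ≠ 0 := by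
  rw [herm2_diagCoord2, traceDisc_eq_sq_det_vandermonde (x := fun i => (x i : ℂ)) fun k => by
    rw [Matrix.diagonal_pow, Matrix.trace_diagonal]; rfl]
  exact pow_ne_zero _ (Matrix.det_vandermonde_ne_zero_iff.2 (Complex.ofReal_injective.comp hx))

theorem exists_strictMono_roots_of_traceDisc_ne_zero {m : Idx2 n → ℝ}
    (hm : traceDisc (herm2 n m) ≠ 0) :
    ∃ x : Fin n → ℝ, StrictMono x ∧ ∀ X, herm2Poly n m X = ∏ i, (X - x i) := by
  obtain ⟨x, hx, h, ht⟩ := exists_monotone_roots_of_isHermitian (isHermitian_herm2 m)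
  refine ⟨x, hx.strictMono_of_injective ?_, fun X => by rw [herm2Poly, h, Complex.ofReal_re]⟩
  rw [traceDisc_eq_sq_det_vandermonde (x := fun i => (x i : ℂ)) fun k => by
    rw [ht]; push_cast; rfl] at hm
  have hv : (Matrix.vandermonde fun i => (x i : ℂ)).det ≠ 0 := fun h0 => hm (by rw [h0]; simp)
  exact fun i j hij => Matrix.det_vandermonde_ne_zero_iff.1 hv (congrArg Complex.ofReal hij)

theorem continuous_traceDisc_herm2 : Continuous fun m : Idx2 n → ℝ => traceDisc (herm2 n m) := by
  have h : Continuous fun m : Idx2 n → ℝ => herm2 n m :=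
    continuous_matrix fun i j => (contDiff_herm2_apply i j).continuous
  exact Continuous.matrix_det (continuous_matrix fun i j => (h.pow _).matrix_trace)

/-- By Fubini it suffices to treat every line in one fixed direction. The direction is a diagonal
matrix with distinct entries; by homogeneity the discriminant at `H + tL` vanishes with the one at
`t⁻¹H + L`, so for finitely many `t ≠ 0`. -/
theorem ae_traceDisc_herm2_ne_zero : ∀ᵐ m : Idx2 n → ℝ, traceDisc (herm2 n m) ≠ 0 := by
  set d : Idx2 n → ℝ := diagCoord2 fun i => (i : ℕ) with hd
  have hL : traceDisc (herm2 n d) ≠ 0 :=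
    traceDisc_herm2_diagCoord2 fun i j h => Fin.ext (by exact_mod_cast h)
  refine ae_mem_of_ae_add_linearMap_mem (LinearMap.toSpanSingleton ℝ _ d) volume volume
    (s := {m | traceDisc (herm2 n m) ≠ 0})
    (isOpen_ne_fun continuous_traceDisc_herm2 continuous_const).measurableSet fun p => ?_
  have hfin := ((finite_setOf_traceDisc_add_smul_eq_zero (herm2 n p) _ hL).image
    fun s => s⁻¹).insert 0
  have hae : ∀ᵐ t : ℝ, t ∈ (insert (0 : ℝ) ((fun s : ℝ => s⁻¹) ''
      {s : ℝ | traceDisc ((s : ℂ) • herm2 n p + herm2 n d) = 0}))ᶜ :=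
    compl_mem_ae_iff.2 (hfin.measure_zero _)
  filter_upwards [hae] with t ht
  have ht0 : t ≠ 0 := fun h => ht (Or.inl h)
  have hne : traceDisc (((t⁻¹ : ℝ) : ℂ) • herm2 n p + herm2 n d) ≠ 0 := fun h =>
    ht (Or.inr ⟨t⁻¹, h, inv_inv t⟩)
  have he : herm2 n (p + t • d) = (t : ℂ) • (((t⁻¹ : ℝ) : ℂ) • herm2 n p + herm2 n d) := by
    ext i j
    have : (t : ℂ) ≠ 0 := by exact_mod_cast ht0
    rw [herm2_add_smul]
    simp [mul_add, this]
  show traceDisc (herm2 n (p + t • d)) ≠ 0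
  rw [he, traceDisc_smul]
  refine mul_ne_zero (pow_ne_zero _ (Finset.prod_ne_zero_iff.2 fun i _ => pow_ne_zero _ ?_)) hne
  exact_mod_cast ht0

theorem ae_exists_listsSpectrum_model2 (n : ℕ) :
    ∀ᵐ m : Idx2 n → ℝ, ∃ x : Fin n → ℝ, ListsSpectrum (model2 n m) x := by
  filter_upwards [ae_traceDisc_herm2_ne_zero] with m hm
  obtain ⟨x, hx⟩ := exists_strictMono_roots_of_traceDisc_ne_zero hm
  exact ⟨x, (spectralModel_model2 n).listsSpectrum_iff.2 hx⟩

end Model2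

/-! ### The theorem -/

namespace SpectralModel

variable {ι κ : Type} [Fintype ι] [DecidableEq ι] [Fintype κ] [DecidableEq κ]
    {n : ℕ} {g : ι → ι → ℝ} {M : (ι → ℝ) → Matrix κ κ ℝ} {Q : (ι → ℝ) → ℝ → ℝ} {β : ℝ}

theorem exists_monotone_charP_eq_prod (h : SpectralModel n g M Q β) (m : ι → ℝ) :
    ∃ x : Fin n → ℝ, Monotone x ∧ ∀ X : ℝ, charP (M m) X = ∏ i, (X - x i) ^ 8 := by
  obtain ⟨x, hx, hQ⟩ := h.roots m
  exact ⟨x, hx, fun X => by rw [h.charP_eq, hQ, Finset.prod_pow]⟩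

theorem ae_exists_finrank_eigenspace (h : SpectralModel n g M Q β)
    (hae : ∀ᵐ m : ι → ℝ, ∃ x : Fin n → ℝ, ListsSpectrum (M m) x) :
    ∀ᵐ m : ι → ℝ, ∃ x : Fin n → ℝ, ListsSpectrum (M m) x ∧
      ∀ i, Module.finrank ℝ (Module.End.eigenspace (Matrix.toLin' (M m)) (x i)) = 8 := by
  filter_upwards [hae] with m ⟨x, hx⟩
  exact ⟨x, hx, h.finrank_eigenspace hx⟩

theorem isReversible_iff {k : ℕ} (h : SpectralModel n g M Q ((2 * k : ℕ) : ℝ))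
    {ℒ : WeylTest n →ₗ[ℝ] WeylTest n} (hℒ : IsSpectralOperator g M ℒ)
    {μ : Measure (Fin n → ℝ)} (hμ : IsRadonOnWeyl μ) :
    IsReversible ℒ μ ↔ ∃ C : ℝ≥0, HasWeylDensity μ fun x => C * weylWeight n k x := by
  rw [h.eq_dysonOp hℒ, isReversible_dysonOp_iff hμ]

end SpectralModel

end

theorem mainTheorem5 :
    -- first model: the `2 × 2` model
    ((∀ (m : Idx1 → ℝ) (X : ℝ), charP (model1 m) X ≠ 0 →
        diffOp cov1 (fun m' => charP (model1 m') X) m =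
          (-11) * iteratedDeriv 2 (charP (model1 m)) X +
            21 / 2 * ((deriv (charP (model1 m)) X) ^ 2 / charP (model1 m) X)) ∧
      (∀ (m : Idx1 → ℝ) (X Y : ℝ), X ≠ Y → charP (model1 m) X ≠ 0 → charP (model1 m) Y ≠ 0 →
        carre cov1 (fun m' => Real.log (charP (model1 m') X))
            (fun m' => Real.log (charP (model1 m') Y)) m =
          8 / (Y - X) * (deriv (charP (model1 m)) X / charP (model1 m) X -
            deriv (charP (model1 m)) Y / charP (model1 m) Y)) ∧
      (∀ a : ℝ, 0 < a →
        (a ^ 2 * ((-11) + 21 / 2) - a * ((-11) + 8) + 8 = 0 ↔ a = 8)) ∧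
      (∀ m : Idx1 → ℝ, ∃ x : Fin 2 → ℝ, Monotone x ∧
        ∀ X : ℝ, charP (model1 m) X = ∏ i, (X - x i) ^ 8) ∧
      (∀ᵐ m : Idx1 → ℝ, ∃ x : Fin 2 → ℝ, ListsSpectrum (model1 m) x ∧
        ∀ i, Module.finrank ℝ
          (Module.End.eigenspace (Matrix.toLin' (model1 m)) (x i)) = 8) ∧
      (∃! ℒ : WeylTest 2 →ₗ[ℝ] WeylTest 2, IsSpectralOperator cov1 model1 ℒ) ∧
      (∀ ℒ : WeylTest 2 →ₗ[ℝ] WeylTest 2, IsSpectralOperator cov1 model1 ℒ →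
        ∀ μ : Measure (Fin 2 → ℝ), IsRadonOnWeyl μ →
          (IsReversible ℒ μ ↔ ∃ C : ℝ≥0, HasWeylDensity μ fun x =>
            C * ∏ i, ∏ j ∈ Finset.Ioi i, (x i - x j) ^ 8))) ∧
    -- second model, in any dimension
    (∀ n : ℕ,
      (∀ (m : Idx2 n → ℝ) (X : ℝ), charP (model2 n m) X ≠ 0 →
        diffOp (cov2 n) (fun m' => charP (model2 n m') X) m =
          (-8) * iteratedDeriv 2 (charP (model2 n m)) X +
            63 / 8 * ((deriv (charP (model2 n m)) X) ^ 2 / charP (model2 n m) X)) ∧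
      (∀ (m : Idx2 n → ℝ) (X Y : ℝ), X ≠ Y → charP (model2 n m) X ≠ 0 → charP (model2 n m) Y ≠ 0 →
        carre (cov2 n) (fun m' => Real.log (charP (model2 n m') X))
            (fun m' => Real.log (charP (model2 n m') Y)) m =
          8 / (Y - X) * (deriv (charP (model2 n m)) X / charP (model2 n m) X -
            deriv (charP (model2 n m)) Y / charP (model2 n m) Y)) ∧
      (∀ a : ℝ, 0 < a →
        (a ^ 2 * ((-8) + 63 / 8) - a * ((-8) + 8) + 8 = 0 ↔ a = 8)) ∧
      (∀ m : Idx2 n → ℝ, ∃ x : Fin n → ℝ, Monotone x ∧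
        ∀ X : ℝ, charP (model2 n m) X = ∏ i, (X - x i) ^ 8) ∧
      (∀ᵐ m : Idx2 n → ℝ, ∃ x : Fin n → ℝ, ListsSpectrum (model2 n m) x ∧
        ∀ i, Module.finrank ℝ
          (Module.End.eigenspace (Matrix.toLin' (model2 n m)) (x i)) = 8) ∧
      (∃! ℒ : WeylTest n →ₗ[ℝ] WeylTest n, IsSpectralOperator (cov2 n) (model2 n) ℒ) ∧
      (∀ ℒ : WeylTest n →ₗ[ℝ] WeylTest n, IsSpectralOperator (cov2 n) (model2 n) ℒ →
        ∀ μ : Measure (Fin n → ℝ), IsRadonOnWeyl μ →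
          (IsReversible ℒ μ ↔ ∃ C : ℝ≥0, HasWeylDensity μ fun x =>
            C * ∏ i, ∏ j ∈ Finset.Ioi i, |x i - x j| ^ 2))) := by
  refine ⟨⟨fun m X hX => ?_, spectralModel_model1.carre_log_charP, fun a ha => ?_,
    spectralModel_model1.exists_monotone_charP_eq_prod,
    spectralModel_model1.ae_exists_finrank_eigenspace ae_exists_listsSpectrum_model1,
    spectralModel_model1.existsUnique_isSpectralOperator,
    fun ℒ hℒ μ hμ => spectralModel_model1.isReversible_iff hℒ hμ⟩, fun n =>
    ⟨fun m X hX => ?_, (spectralModel_model2 n).carre_log_charP, fun a ha => ?_,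
    (spectralModel_model2 n).exists_monotone_charP_eq_prod,
    (spectralModel_model2 n).ae_exists_finrank_eigenspace (ae_exists_listsSpectrum_model2 n),
    (spectralModel_model2 n).existsUnique_isSpectralOperator, fun ℒ hℒ μ hμ => ?_⟩⟩
  -- With `β = 8`: `-(4 + 7) = -11` and `7 + 56/16 = 21/2`. With `β = 2`, below: `-(1 + 7) = -8` and
  -- `7 + 14/16 = 63/8`.
  · rw [spectralModel_model1.diffOp_charP m X hX]
    norm_num
  · constructor
    · intro h
      have h2 : (a - 8) * (a + 2) = 0 := by linarith
      rcases mul_eq_zero.1 h2 with h3 | h3 <;> linarith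
    · rintro rfl
      norm_num
  · rw [(spectralModel_model2 n).diffOp_charP m X hX]
    norm_num
  · constructor
    · intro h
      have h2 : (a - 8) * (a + 8) = 0 := by linarith
      rcases mul_eq_zero.1 h2 with h3 | h3 <;> linarith
    · rintro rfl
      norm_num
  · simp only [sq_abs]
    exact (spectralModel_model2 n).isReversible_iff hℒ hμ
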